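/- Let $(\Omega,\mathcal F,\mathbb P;(\mathcal F_t)_{t=0}^T)$ be a filtered probability space with $\Omega$ finite, $\mathcal F_0=\{\emptyset,\Omega\}$, $\mathcal F_T=\mathcal F=2^\Omega$ and $\mathbb P(\{\omega\})>0$ for all $\omega\in\Omega$. Let $\mathcal L_t$ be the set of $\mathcal F_t$-measurable $\mathbb R^d$-valued random variables. At each time $t=0,\dots,T$ one unit of asset $k$ can be obtained by giving up $\pi^{jk}_t$ units of asset $j$, where the exchange rates $\pi^{jk}_t>0$ $(j,k=1,\dots,d)$ are $\mathcal F_t$-measurable and $\pi^{jj}_t=1$. A portfolio $x\in\mathcal L_t$ can be exchanged into $y\in\mathcal L_t$ at time $t$ if there are $\mathcal F_t$-measurable $\beta^{jk}\ge0$ with $y^k=x^k+\sum_j\beta^{jk}-\sum_j\beta^{kj}\pi^{kj}_t$ for all $k$; the solvency cone $\mathcal K_t\subseteq\mathcal L_t$ consists of the portfolios that can be exchanged at time $t$ into portfolios with non-negative holdings in all assets. A trading strategy is a process $y=(y_t)_{t=0}^{T+1}$ with $y_0\in\mathbb R^d$, $y_t\in\mathcal L_{t-1}$ for $t\ge1$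 and $y_{T+1}=0$; $\Phi$ is the set of trading strategies. An arbitrage opportunity is a $y\in\Phi$ such that $y_0=0$, $y_t-y_{t+1}\in\mathcal K_t$ for $t=0,\dots,T-1$, and $y_T-x\in\mathcal K_T$ for some $x\in\mathcal L_T\setminus\{0\}$ with non-negative holdings in all assets. Assume that there is no arbitrage opportunity. A mixed stopping time is an adapted process $\chi=(\chi_t)_{t=0}^T$ with values in $[0,1]$ and $\sum_{t=0}^T\chi_t=1$; $\mathcal X$ is the set of mixed stopping times. For an adapted process $X$ put $X_\chi:=\sum_{s=0}^T\chi_sX_s$ and $X^{\chi*}_{t}:=\sum_{s=t}^{T}\chi_sX_s$ for $t=0,\dots,T$, with $X^{\chi*}_{T+1}:=0$. Let $\xi=(\xi_t)_{t=0}^T$ be an $\mathbb R^d$-valued adapted process, the payoff of an American option. Let $\Phi^{\mathrm{ag}}(\xi)$ be the set of maps $Y:\mathcal X\to\Phi$, $\chi\mapsto Y^\chi$, such that $Y^\chi_t-\chi_t\xi_t-Y^\chi_{t+1}\in\mathcal K_t$ for all $\chi\in\mathcal X$ and $t=0,\dots,T$, and such that for all $\chi,\chi'\in\mathcal X$, $t=0,\dots,T$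 and $\omega\in\Omega$: if $\chi_s(\omega)=\chi'_s(\omega)$ for all $s<t$, then $Y^\chi_t(\omega)=Y^{\chi'}_t(\omega)$. Then $Y_0:=Y^\chi_0$ does not depend on $\chi$. The ask price of the option under gradual exercise in asset $j\in\{1,\dots,d\}$ is $$\pi^{\mathrm{ag}}_j(\xi):=\inf\{x\in\mathbb R \mid \exists\,Y\in\Phi^{\mathrm{ag}}(\xi):\ xe^j=Y_0\},$$ where $e^j$ is the $j$-th vector of the canonical basis. Let $\mathcal Q_t$ be the deferred solvency cone: the set of all $z\in\mathcal L_t$ for which there are $y_{t+1},\dots,y_{T+1}$ with $y_s\in\mathcal L_{s-1}$, $z-y_{t+1}\in\mathcal K_t$, $y_s-y_{s+1}\in\mathcal K_s$ for $s=t+1,\dots,T$, and $y_{T+1}=0$. For $\omega\in\Omega$ let $\mathcal Q_t^{*}(\omega):=\{s\in\mathbb R^d \mid s\cdot z(\omega)\ge0 \text{ for all } z\in\mathcal Q_t\}$. For $\chi\in\mathcal X$ let $\bar{\mathcal P}^{\mathrm d}_j(\chi)$ be the set of pairs $(\mathbb Q,S)$ where $\mathbb Q$ is a probability measure on $\Omega$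 and $S=(S_t)_{t=0}^T$ is an $\mathbb R^d$-valued adapted process such that, for each $t=0,\dots,T$, $$S_t\in\mathcal Q_t^*\setminus\{0\},\qquad \mathbb E_{\mathbb Q}(S^{\chi*}_{t+1}\mid\mathcal F_t)\in\mathcal Q_t^*\ \ \mathbb Q\text{-a.s.},\qquad S^j_t=1 .$$ **Theorem.** For every $j=1,\dots,d$ and every $\xi$, the ask price $\pi^{\mathrm{ag}}_j(\xi)$ is finite and $$\pi^{\mathrm{ag}}_j(\xi)=\max_{\chi\in\mathcal X}\ \max_{(\mathbb Q,S)\in\bar{\mathcal P}^{\mathrm d}_j(\chi)}\mathbb E_{\mathbb Q}\big((\xi\cdot S)_\chi\big),$$ where all the maxima are attained. Moreover, $\hat\chi\in\mathcal X$ and $(\hat{\mathbb Q},\hat S)\in\bar{\mathcal P}^{\mathrm d}_j(\hat\chi)$ with $$\pi^{\mathrm{ag}}_j(\xi)=\mathbb E_{\hat{\mathbb Q}}\big((\xi\cdot\hat S)_{\hat\chi}\big)$$ can be constructed algorithmically, in the following sense: for every such filtered space, every $d$ and every $j$ there is a finite algorithm in exact real arithmetic (a finite algebraic computation tree, which uses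 only rational constants, the four arithmetic operations and comparisons of real numbers) that, for all exchange rates $\pi$ without arbitrage and all payoffs $\xi$, computes from the numbers $\pi^{ik}_t(\omega)$ and $\xi^k_t(\omega)$ the numbers $\hat\chi_t(\omega)$, $\hat{\mathbb Q}(\{\omega\})$ and $\hat S^k_t(\omega)$ of such a triple. -/

import Mathlib

open MeasureTheory

namespace GradualExercise

section Algorithms

/-- Arithmetic expressions in real input variables indexed by `ι`, with rational constants. -/
inductive ArithExpr (ι : Type*) where
  | input (i : ι) : ArithExpr ι
  | const (c : ℚ) : ArithExpr ι
  | add (a b : ArithExpr ι) : ArithExpr ι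
  | sub (a b : ArithExpr ι) : ArithExpr ι
  | mul (a b : ArithExpr ι) : ArithExpr ι
  | div (a b : ArithExpr ι) : ArithExpr ι

/-- The value of an arithmetic expression (a division by `0` returns `0`). -/
noncomputable def ArithExpr.eval {ι : Type*} (x : ι → ℝ) : ArithExpr ι → ℝ
  | .input i => x i
  | .const c => (c : ℝ)
  | .add a b => a.eval x + b.eval x
  | .sub a b => a.eval x - b.eval x
  | .mul a b => a.eval x * b.eval x
  | .div a b => a.eval x / b.eval x

/-- A finite algorithm in exact real arithmetic with real inputs indexed by `ι` and real outputs
indexed by `κ` (an algebraic computation tree): it branches finitely often according to whether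
an arithmetic expression in the inputs is `≤ 0`, and then returns one arithmetic expression in the
inputs for each output. -/
inductive ArithAlgorithm (ι κ : Type*) where
  | ret (out : κ → ArithExpr ι) : ArithAlgorithm ι κ
  | branch (e : ArithExpr ι) (ifNonpos ifPos : ArithAlgorithm ι κ) : ArithAlgorithm ι κ

/-- The output of an algorithm on the input `x`. -/
noncomputable def ArithAlgorithm.run {ι κ : Type*} (x : ι → ℝ) : ArithAlgorithm ι κ → κ → ℝ
  | .ret out => fun k => (out k).eval x
  | .branch e a b => if e.eval x ≤ 0 then a.run x else b.run x

end Algorithms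

section Market

variable {Ω : Type*} {m : MeasurableSpace Ω} {T d : ℕ}

/-- Exchange rates: `rate t ω j k` is the number `π^{jk}_t(ω)` of units of asset `j` that have to be
given up in order to receive one unit of asset `k` at time `t`. -/
structure IsExchangeRate (𝓕 : Filtration (Fin (T + 1)) m)
    (rate : Fin (T + 1) → Ω → Fin d → Fin d → ℝ) : Prop where
  adapted : ∀ t j k, Measurable[𝓕 t] (fun ω => rate t ω j k)
  pos : ∀ t ω j k, 0 < rate t ω j k
  self : ∀ t ω j, rate t ω j j = 1

/-- The portfolio `x` can be exchanged into the portfolio `y` at time `t`. -/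
def CanExchange (𝓕 : Filtration (Fin (T + 1)) m) (rate : Fin (T + 1) → Ω → Fin d → Fin d → ℝ)
    (t : Fin (T + 1)) (x y : Ω → Fin d → ℝ) : Prop :=
  ∃ β : Fin d → Fin d → Ω → ℝ,
    (∀ j k, Measurable[𝓕 t] (β j k)) ∧ (∀ j k ω, 0 ≤ β j k ω) ∧
      ∀ ω k, y ω k = x ω k + ∑ j, β j k ω - ∑ j, β k j ω * rate t ω k j

/-- The solvency cone `𝒦_t`, a set of `𝓕_t`-measurable portfolios. -/
def solvencyCone (𝓕 : Filtration (Fin (T + 1)) m) (rate : Fin (T + 1) → Ω → Fin d → Fin d → ℝ)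
    (t : Fin (T + 1)) : Set (Ω → Fin d → ℝ) :=
  {x | Measurable[𝓕 t] x ∧
    ∃ y : Ω → Fin d → ℝ, Measurable[𝓕 t] y ∧ (∀ ω k, 0 ≤ y ω k) ∧ CanExchange 𝓕 rate t x y}

/-- The set `Φ` of trading strategies `y_0, …, y_{T+1}`: predictable, with deterministic initial
endowment `y_0` and with `y_{T+1} = 0`. For `t : Fin (T + 1)` the portfolios `y_t` and `y_{t+1}`
are `y t.castSucc` and `y t.succ`. -/
def tradingStrategies (𝓕 : Filtration (Fin (T + 1)) m) (d : ℕ) :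
    Set (Fin (T + 2) → Ω → Fin d → ℝ) :=
  {y | (∃ c, ∀ ω, y 0 ω = c) ∧ (∀ t : Fin (T + 1), Measurable[𝓕 t] (y t.succ)) ∧
    y (Fin.last (T + 1)) = 0}

/-- `y_t - y_{t+1} ∈ 𝒦_t` for `t = 0, …, T - 1`. -/
def IsSelfFinancing (𝓕 : Filtration (Fin (T + 1)) m)
    (rate : Fin (T + 1) → Ω → Fin d → Fin d → ℝ) (y : Fin (T + 2) → Ω → Fin d → ℝ) : Prop :=
  ∀ t : Fin (T + 1), t < Fin.last T → y t.castSucc - y t.succ ∈ solvencyCone 𝓕 rate t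

/-- `y` is an arbitrage opportunity. -/
def IsArbitrage (𝓕 : Filtration (Fin (T + 1)) m)
    (rate : Fin (T + 1) → Ω → Fin d → Fin d → ℝ) (y : Fin (T + 2) → Ω → Fin d → ℝ) : Prop :=
  y ∈ tradingStrategies 𝓕 d ∧ IsSelfFinancing 𝓕 rate y ∧ y 0 = 0 ∧
    ∃ x : Ω → Fin d → ℝ, Measurable[𝓕 (Fin.last T)] x ∧ x ≠ 0 ∧ (∀ ω k, 0 ≤ x ω k) ∧
      y (Fin.last T).castSucc - x ∈ solvencyCone 𝓕 rate (Fin.last T)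

/-- The model admits no arbitrage opportunity. -/
def NoArbitrage (𝓕 : Filtration (Fin (T + 1)) m)
    (rate : Fin (T + 1) → Ω → Fin d → Fin d → ℝ) : Prop :=
  ¬ ∃ y, IsArbitrage 𝓕 rate y

/-- The set `𝒳` of mixed stopping times. -/
def mixedStoppingTimes (𝓕 : Filtration (Fin (T + 1)) m) : Set (Fin (T + 1) → Ω → ℝ) :=
  {χ | (∀ t, Measurable[𝓕 t] (χ t)) ∧ (∀ t ω, χ t ω ∈ Set.Icc (0 : ℝ) 1) ∧
    ∀ ω, ∑ t, χ t ω = 1}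

/-- The family of superhedging strategies for the seller against gradual exercise: functions
`Y : 𝒳 → Φ` which satisfy the rebalancing and the non-anticipation conditions. -/
def sellerStrategies (𝓕 : Filtration (Fin (T + 1)) m)
    (rate : Fin (T + 1) → Ω → Fin d → Fin d → ℝ) (ξ : Fin (T + 1) → Ω → Fin d → ℝ) :
    Set (mixedStoppingTimes 𝓕 → tradingStrategies 𝓕 d) :=
  {Y | (∀ (χ : mixedStoppingTimes 𝓕) (t : Fin (T + 1)),
        ((Y χ).1 t.castSucc - fun ω => χ.1 t ω • ξ t ω) - (Y χ).1 t.succ ∈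
          solvencyCone 𝓕 rate t) ∧
      ∀ (χ χ' : mixedStoppingTimes 𝓕) (t : Fin (T + 1)) (ω : Ω),
        (∀ s < t, χ.1 s ω = χ'.1 s ω) → (Y χ).1 t.castSucc ω = (Y χ').1 t.castSucc ω}

/-- The ask price `π^{ag}_j(ξ)` under gradual exercise in asset `j`: the infimum, in `[-∞, ∞]`, of
the `x` such that some superhedging strategy has initial endowment `x e^j`. -/
noncomputable def askPrice (𝓕 : Filtration (Fin (T + 1)) m)
    (rate : Fin (T + 1) → Ω → Fin d → Fin d → ℝ) (ξ : Fin (T + 1) → Ω → Fin d → ℝ)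
    (j : Fin d) : EReal :=
  sInf ((fun x : ℝ => (x : EReal)) '' {x : ℝ | ∃ Y ∈ sellerStrategies 𝓕 rate ξ,
    ∀ χ ω, (Y χ).1 0 ω = x • (Pi.single j 1 : Fin d → ℝ)})

/-- The deferred solvency cone `𝒬_t`, a set of `𝓕_t`-measurable portfolios; `y s.succ` for
`s = t, …, T` is the liquidation strategy `y_{t+1}, …, y_{T+1}`. -/
def deferredSolvencyCone (𝓕 : Filtration (Fin (T + 1)) m)
    (rate : Fin (T + 1) → Ω → Fin d → Fin d → ℝ) (t : Fin (T + 1)) : Set (Ω → Fin d → ℝ) :=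
  {z | Measurable[𝓕 t] z ∧ ∃ y : Fin (T + 2) → Ω → Fin d → ℝ,
    (∀ s, t ≤ s → Measurable[𝓕 s] (y s.succ)) ∧
    z - y t.succ ∈ solvencyCone 𝓕 rate t ∧
    (∀ s, t < s → y s.castSucc - y s.succ ∈ solvencyCone 𝓕 rate s) ∧
    y (Fin.last (T + 1)) = 0}

/-- The cone `𝒬_t^{μ*}` in `ℝ^d`, where `μ` is the atom of `𝓕_t` that contains `ω`: the vectors `s`
with `s · x ≥ 0` for all `x` in the cone `𝒬_t^μ` of values at `ω` of the elements of `𝒬_t`. -/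
def deferredDualCone (𝓕 : Filtration (Fin (T + 1)) m)
    (rate : Fin (T + 1) → Ω → Fin d → Fin d → ℝ) (t : Fin (T + 1)) (ω : Ω) : Set (Fin d → ℝ) :=
  {s | ∀ z ∈ deferredSolvencyCone 𝓕 rate t, 0 ≤ s ⬝ᵥ z ω}

/-- The set `P̄^d_j(χ)` of pairs `(Q, S)`, where `Q` is a probability measure and `S` an adapted
process with `S_t ∈ 𝒬_t^* \ {0}`, with `E_Q(∑_{s > t} χ_s S_s | 𝓕_t) ∈ 𝒬_t^*` (`Q`-almost surely,
which is how far the conditional expectation is determined) and with `S^j_t = 1`, for all `t`. -/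
def pricingPairs (𝓕 : Filtration (Fin (T + 1)) m)
    (rate : Fin (T + 1) → Ω → Fin d → Fin d → ℝ) (j : Fin d) (χ : Fin (T + 1) → Ω → ℝ) :
    Set (Measure Ω × (Fin (T + 1) → Ω → Fin d → ℝ)) :=
  {p | IsProbabilityMeasure p.1 ∧
    (∀ t, Measurable[𝓕 t] (p.2 t)) ∧
    (∀ t ω, p.2 t ω ∈ deferredDualCone 𝓕 rate t ω \ {0}) ∧
    (∀ t, ∀ᵐ ω ∂p.1,
      (p.1[fun ω' => ∑ s ∈ Finset.Ioi t, χ s ω' • p.2 s ω' | 𝓕 t]) ω ∈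
        deferredDualCone 𝓕 rate t ω) ∧
    ∀ t ω, p.2 t ω j = 1}

/-- `E_Q((ξ · S)_χ)`. -/
noncomputable def dualValue (ξ : Fin (T + 1) → Ω → Fin d → ℝ) (χ : Fin (T + 1) → Ω → ℝ)
    (p : Measure Ω × (Fin (T + 1) → Ω → Fin d → ℝ)) : ℝ :=
  ∫ ω, ∑ t, χ t ω * (ξ t ω ⬝ᵥ p.2 t ω) ∂p.1

/-- `v` is the (attained) maximum of `E_Q((ξ · S)_χ)` over `(Q, S) ∈ P̄^d_j(χ)`. -/
def IsInnerMax (𝓕 : Filtration (Fin (T + 1)) m)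
    (rate : Fin (T + 1) → Ω → Fin d → Fin d → ℝ) (ξ : Fin (T + 1) → Ω → Fin d → ℝ)
    (j : Fin d) (χ : Fin (T + 1) → Ω → ℝ) (v : EReal) : Prop :=
  IsGreatest ((fun p => (dualValue ξ χ p : EReal)) '' pricingPairs 𝓕 rate j χ) v

/-- Indices of the numerical data: the exchange rates `π^{jk}_t(ω)` and the payoffs `ξ^k_t(ω)`. -/
abbrev InputIndex (Ω : Type*) (T d : ℕ) :=
  (Fin (T + 1) × Ω × Fin d × Fin d) ⊕ (Fin (T + 1) × Ω × Fin d)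

/-- The numerical data of the pricing problem. -/
def inputData (rate : Fin (T + 1) → Ω → Fin d → Fin d → ℝ) (ξ : Fin (T + 1) → Ω → Fin d → ℝ) :
    InputIndex Ω T d → ℝ
  | .inl (t, ω, i, k) => rate t ω i k
  | .inr (t, ω, k) => ξ t ω k

/-- Indices of the numbers `χ_t(ω)`, `Q({ω})` and `S^k_t(ω)`. -/
abbrev OutputIndex (Ω : Type*) (T d : ℕ) :=
  (Fin (T + 1) × Ω) ⊕ Ω ⊕ (Fin (T + 1) × Ω × Fin d)

/-- The numbers that describe a triple `(χ, Q, S)`. -/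
noncomputable def outputData (χ : Fin (T + 1) → Ω → ℝ)
    (p : Measure Ω × (Fin (T + 1) → Ω → Fin d → ℝ)) : OutputIndex Ω T d → ℝ
  | .inl (t, ω) => χ t ω
  | .inr (.inl ω) => p.1.real {ω}
  | .inr (.inr (t, ω, k)) => p.2 t ω k

end Market

end GradualExercise

open GradualExercise

/-!
The seller's problem is a finite linear program, the theorem is its duality, and the algorithm
solves it.

*Reduction to pure stopping times.* A family of superhedging strategies `z t`, one for each
deterministic exercise time `t`, such that `z t` and `z t'` agree until the first of the two times
(`IsHedge`), can be mixed: `∑ t, χ t • z t` superhedges the mixed stopping time `χ`, because the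
solvency cones are convex, and it does not anticipate, because the strategies that belong to later
exercise times still coincide (`IsHedge.sum_smul_eq`). Hence the ask price is the optimal value of a
linear program with finitely many variables (`exists_seller_of_isHedge`,
`exists_isHedge_of_seller`).

*Strong duality.* If an endowment does not suffice for superhedging, then Farkas' lemma
(`exists_conic_combination`, `exists_prices_of_not_superhedge`) provides multipliers; averaged over
the atoms, they are a feasible point of the dual program (`IsDualFeasible`) with a greater value
(`exists_dual_of_not_hedge`). In the same way, the absence of arbitrage provides a strictly positive
consistent price process `c` (`exists_priceProcess`).

*From dual solutions to pricing pairs.* Let `μ t r` be the multiplier at time `r` in the scenario of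
exercise at time `t`. The diagonal terms `μ r r` and the sums `∑ t > r, μ t r` lie in the deferred
dual cones, by backward recursion (`mem_deferredDualCone_castSucc`). The diagonal is then factored
as `μ r r = q r * χ r • S r` with a density process `q`, a mixed stopping time `χ` and prices `S`
that are normalized in the numeraire `j`: the live mass `∑ t ≥ r, μ t r` in units of asset `j` is
split into a survival part and a martingale part, and `c` takes over where there is no mass left
(`density`, `unexercised`, `stopping`, `prices`). The expected payoff under the resulting pair is
the dual objective (`IsDualFeasible.isFinitePair`, `IsDualFeasible.pairValue_eq`). Since every
pricing pair satisfies weak duality (`IsFinitePair.pairValue_le`), an optimal dual solution yields a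
maximal pair, and the ask price equals its value (`askPrice_eq_dualObjective`). For a fixed mixed
stopping time the set of pricing pairs is nonempty, because it contains the consistent pricing
system given by `c`, and compact, so the inner maximum is attained as well
(`exists_isMax_pairValue`).

*The algorithm.* Functions computed by algebraic computation trees are closed under arithmetic and
case distinctions (`Arith`). A feasible and bounded linear program has an optimal solution in which
the first variable is `0` or makes some constraint tight; substituting each of these finitely many
possibilities and comparing the results solves the program by recursion on the number of variables
(`exists_arith_optimum_fin`). The dual program and the conditions on `c` are linear with
coefficients taken from the data, and the passage from `μ` and `c` to `(χ, q, S)` is arithmetic.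
Averages with respect to the uniform distribution on `Ω` are used throughout, so that all other
coefficients are rational.
-/

namespace GradualExercise

/-! ### Functions that are computed by algorithms -/

section Arithmetic

variable {ι κ κ' : Type*}

/-- Run an algorithm and continue with an algorithm that depends on the output expressions. -/
def ArithAlgorithm.bind :
    ArithAlgorithm ι κ → ((κ → ArithExpr ι) → ArithAlgorithm ι κ') → ArithAlgorithm ι κ'
  | .ret out, k => k out
  | .branch e a b, k => .branch e (a.bind k) (b.bind k)

theorem ArithAlgorithm.run_bind (x : ι → ℝ) {k : (κ → ArithExpr ι) → ArithAlgorithm ι κ'}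
    {F : (κ → ℝ) → κ' → ℝ} (hk : ∀ out, (k out).run x = F (fun i => (out i).eval x))
    (A : ArithAlgorithm ι κ) : (A.bind k).run x = F (A.run x) := by
  induction A with
  | ret out => simp [bind, run, hk]
  | branch e a b iha ihb =>
    simp only [bind, run, iha, ihb]
    split_ifs <;> rfl

/-- A real function of real input data that some finite algorithm computes. -/
def Arith (f : (ι → ℝ) → ℝ) : Prop :=
  ∃ A : ArithAlgorithm ι Unit, ∀ x, A.run x () = f x

namespace Arith

theorem input (i : ι) : Arith (fun x : ι → ℝ => x i) :=
  ⟨.ret fun _ => .input i, fun _ => rfl⟩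

theorem ratCast (c : ℚ) : Arith (fun _ : ι → ℝ => (c : ℝ)) :=
  ⟨.ret fun _ => .const c, fun _ => rfl⟩

theorem zero : Arith (fun _ : ι → ℝ => (0 : ℝ)) := by simpa using ratCast (ι := ι) 0

theorem one : Arith (fun _ : ι → ℝ => (1 : ℝ)) := by simpa using ratCast (ι := ι) 1

theorem binary (op : ℝ → ℝ → ℝ) (eop : ArithExpr ι → ArithExpr ι → ArithExpr ι)
    (hop : ∀ a b x, (eop a b).eval x = op (a.eval x) (b.eval x)) {f g : (ι → ℝ) → ℝ}
    (hf : Arith f) (hg : Arith g) : Arith (fun x => op (f x) (g x)) := by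
  obtain ⟨A, hA⟩ := hf
  obtain ⟨B, hB⟩ := hg
  refine ⟨A.bind fun a => B.bind fun b => .ret fun _ => eop (a ()) (b ()), fun x => ?_⟩
  rw [ArithAlgorithm.run_bind x (F := fun u _ => op (u ()) (g x)), hA]
  intro out
  rw [ArithAlgorithm.run_bind x (F := fun v _ => op ((out ()).eval x) (v ())), hB]
  intro out'
  funext _
  simp [ArithAlgorithm.run, hop]

variable {f g h : (ι → ℝ) → ℝ}

theorem add (hf : Arith f) (hg : Arith g) : Arith (fun x => f x + g x) :=
  binary (· + ·) .add (fun _ _ _ => rfl) hf hg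

theorem sub (hf : Arith f) (hg : Arith g) : Arith (fun x => f x - g x) :=
  binary (· - ·) .sub (fun _ _ _ => rfl) hf hg

theorem mul (hf : Arith f) (hg : Arith g) : Arith (fun x => f x * g x) :=
  binary (· * ·) .mul (fun _ _ _ => rfl) hf hg

theorem div (hf : Arith f) (hg : Arith g) : Arith (fun x => f x / g x) :=
  binary (· / ·) .div (fun _ _ _ => rfl) hf hg

theorem neg (hf : Arith f) : Arith (fun x => -f x) := by
  simpa using sub zero hf

theorem sum {α : Type*} (s : Finset α) {f : α → (ι → ℝ) → ℝ} (hf : ∀ a, Arith (f a)) :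
    Arith (fun x => ∑ a ∈ s, f a x) := by
  classical
  induction s using Finset.induction_on with
  | empty => simpa using zero
  | insert a s ha ih => simpa [Finset.sum_insert ha] using (hf a).add ih

theorem ite (hf : Arith f) (hg : Arith g) (hh : Arith h) :
    Arith (fun x => if f x ≤ 0 then g x else h x) := by
  obtain ⟨A, hA⟩ := hf
  obtain ⟨B, hB⟩ := hg
  obtain ⟨C, hC⟩ := hh
  refine ⟨A.bind fun a => .branch (a ()) B C, fun x => ?_⟩
  rw [ArithAlgorithm.run_bind x
    (F := fun u _ => if u () ≤ 0 then g x else h x), hA]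
  intro out
  funext _
  simp only [ArithAlgorithm.run]
  split_ifs
  · exact hB x
  · exact hC x

theorem max_zero (hf : Arith f) : Arith (fun x => max 0 (f x)) := by
  have h : (fun x => max 0 (f x)) = fun x => if f x ≤ 0 then 0 else f x := by
    funext x
    split_ifs with h
    · exact max_eq_left h
    · exact max_eq_right (not_le.1 h).le
  rw [h]
  exact ite hf zero hf

end Arith

/-- Finitely many computable functions are computed by a single algorithm. -/
theorem exists_algorithm_run_eq [Finite κ] {f : κ → (ι → ℝ) → ℝ} (hf : ∀ k, Arith (f k)) :
    ∃ A : ArithAlgorithm ι κ, ∀ x k, A.run x k = f k x := by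
  classical
  have := Fintype.ofFinite κ
  suffices h : ∀ s : Finset κ, ∃ A : ArithAlgorithm ι κ, ∀ x, ∀ k ∈ s, A.run x k = f k x by
    obtain ⟨A, hA⟩ := h Finset.univ
    exact ⟨A, fun x k => hA x k (Finset.mem_univ k)⟩
  intro s
  induction s using Finset.induction_on with
  | empty => exact ⟨.ret fun _ => .const 0, by simp⟩
  | insert a s ha ih =>
    obtain ⟨A, hA⟩ := ih
    obtain ⟨B, hB⟩ := hf a
    refine ⟨A.bind fun out => B.bind fun b => .ret (Function.update out a (b ())), fun x k hk => ?_⟩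
    rw [ArithAlgorithm.run_bind x (F := fun u => Function.update u a (f a x))]
    · rcases Finset.mem_insert.1 hk with rfl | hk'
      · simp
      · have hka : k ≠ a := by rintro rfl; exact ha hk'
        rw [Function.update_of_ne hka, hA x k hk']
    · intro out
      rw [ArithAlgorithm.run_bind x
        (F := fun v => Function.update (fun i => (out i).eval x) a (v ())), hB]
      intro out'
      funext i
      by_cases hi : i = a
      · subst hi; simp [ArithAlgorithm.run]
      · simp [ArithAlgorithm.run, hi]

end Arithmetic

/-! ### Solving linear programs by an algorithm -/

section LinearProgramming

theorem exists_boundary_of_nonneg {I : Type*} [Finite I] {c r : I → ℝ} {h t M : ℝ}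
    (ht : ∀ i, c i * t ≤ r i) (hM : ∀ t', (∀ i, c i * t' ≤ r i) → h * t' ≤ M) (h0 : 0 ≤ h)
    (hc : 0 < h ∨ ∃ i, 0 < c i) :
    ∃ t', (∀ i, c i * t' ≤ r i) ∧ h * t ≤ h * t' ∧ ∃ i, c i ≠ 0 ∧ t' = r i / c i := by
  have hpos : ∃ i, 0 < c i := by
    by_contra! hneg
    have h1 : 0 < h := hc.resolve_right (by simpa using hneg)
    -- moving upwards stays feasible, so the objective is unbounded
    have h2 := hM (max t ((M + 1) / h)) fun i =>
      (mul_le_mul_of_nonpos_left (le_max_left _ _) (hneg i)).trans (ht i)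
    have h3 : M + 1 ≤ h * max t ((M + 1) / h) := by
      calc M + 1 = h * ((M + 1) / h) := by field_simp
        _ ≤ _ := by gcongr; exact le_max_right _ _
    linarith
  obtain ⟨i, hi, hmin⟩ := Set.exists_min_image {i | 0 < c i} (fun i => r i / c i)
    (Set.toFinite _) hpos
  have hti : t ≤ r i / c i := by
    rw [le_div_iff₀ hi]; linarith [ht i]
  refine ⟨r i / c i, fun k => ?_, mul_le_mul_of_nonneg_left hti h0, i, ne_of_gt hi, rfl⟩
  rcases le_or_gt (c k) 0 with hk | hk
  · exact (mul_le_mul_of_nonpos_left hti hk).trans (ht k)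
  · have := hmin k hk
    calc c k * (r i / c i) ≤ c k * (r k / c k) := by gcongr
      _ = r k := by field_simp

/-- A bounded linear objective on a closed interval of the line, given by finitely many
inequalities, does not decrease when a suitable end point (or `0`, if the inequalities and the
objective are trivial) is chosen. -/
theorem exists_boundary {I : Type*} [Finite I] {c r : I → ℝ} {h t M : ℝ}
    (ht : ∀ i, c i * t ≤ r i) (hM : ∀ t', (∀ i, c i * t' ≤ r i) → h * t' ≤ M) :
    ∃ t', (∀ i, c i * t' ≤ r i) ∧ h * t ≤ h * t' ∧ (t' = 0 ∨ ∃ i, c i ≠ 0 ∧ t' = r i / c i) := by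
  by_cases h1 : 0 ≤ h ∧ (0 < h ∨ ∃ i, 0 < c i)
  · obtain ⟨t', a, b, e⟩ := exists_boundary_of_nonneg ht hM h1.1 h1.2
    exact ⟨t', a, b, .inr e⟩
  by_cases h2 : 0 ≤ -h ∧ (0 < -h ∨ ∃ i, 0 < -c i)
  · obtain ⟨t', a, b, i, e, e'⟩ := exists_boundary_of_nonneg (c := fun i => -c i) (r := r)
      (t := -t) (M := M) (by simpa using ht)
      (fun t' ht' => by simpa using hM (-t') (by simpa using ht')) h2.1 h2.2
    refine ⟨-t', by simpa using a, by simpa using b, .inr ⟨i, by simpa using e, ?_⟩⟩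
    rw [e', div_neg, neg_neg]
  · have hh : h = 0 := by
      rcases lt_trichotomy h 0 with hh | hh | hh
      · exact absurd ⟨by linarith, .inl (by linarith)⟩ h2
      · exact hh
      · exact absurd ⟨hh.le, .inl hh⟩ h1
    have hc : ∀ i, c i = 0 := fun i => by
      rcases lt_trichotomy (c i) 0 with hi | hi | hi
      · exact absurd ⟨by linarith, .inr ⟨i, by linarith⟩⟩ h2
      · exact hi
      · exact absurd ⟨hh.ge, .inr ⟨i, hi⟩⟩ h1
    exact ⟨0, fun i => by simpa [hc i] using ht i, by simp [hh], .inl rfl⟩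

variable {ι : Type*}

/-- Among finitely many computable candidates `Z o`, an algorithm can select one that is feasible
(`V ≤ 0`) and has the greatest value of `G` among the feasible ones. -/
theorem exists_best_candidate {κ O : Type*} [Finite O] (Z : O → (ι → ℝ) → κ → ℝ)
    (hZ : ∀ o k, Arith fun x => Z o x k) (V G : (ι → ℝ) → (κ → ℝ) → ℝ)
    (hV : ∀ Y : (ι → ℝ) → κ → ℝ, (∀ k, Arith fun x => Y x k) → Arith fun x => V x (Y x))
    (hG : ∀ Y : (ι → ℝ) → κ → ℝ, (∀ k, Arith fun x => Y x k) → Arith fun x => G x (Y x)) :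
    ∃ Y : (ι → ℝ) → κ → ℝ, (∀ k, Arith fun x => Y x k) ∧
      ∀ x o, V x (Z o x) ≤ 0 → V x (Y x) ≤ 0 ∧ G x (Z o x) ≤ G x (Y x) := by
  classical
  have := Fintype.ofFinite O
  suffices h : ∀ s : Finset O, ∃ Y : (ι → ℝ) → κ → ℝ, (∀ k, Arith fun x => Y x k) ∧
      ∀ x, ∀ o ∈ s, V x (Z o x) ≤ 0 → V x (Y x) ≤ 0 ∧ G x (Z o x) ≤ G x (Y x) by
    obtain ⟨Y, h1, h2⟩ := h Finset.univ
    exact ⟨Y, h1, fun x o => h2 x o (Finset.mem_univ o)⟩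
  intro s
  induction s using Finset.induction_on with
  | empty => exact ⟨fun _ _ => 0, fun _ => .zero, by simp⟩
  | insert a s ha ih =>
    obtain ⟨Y, hY, hY'⟩ := ih
    refine ⟨fun x k => if V x (Z a x) ≤ 0 then if V x (Y x) ≤ 0 then
      if G x (Z a x) - G x (Y x) ≤ 0 then Y x k else Z a x k else Z a x k else Y x k,
      fun k => .ite (hV _ (hZ a)) (.ite (hV _ hY)
        (.ite (.sub (hG _ (hZ a)) (hG _ hY)) (hY k) (hZ a k)) (hZ a k)) (hY k), ?_⟩
    intro x o ho hVo
    have key := hY' x o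
    rcases Finset.mem_insert.1 ho with rfl | ho
    · simp only [hVo, if_true]
      split_ifs with h1 h2
      · exact ⟨h1, by linarith⟩
      · exact ⟨hVo, le_rfl⟩
      · exact ⟨hVo, le_rfl⟩
    · obtain ⟨k1, k2⟩ := key ho hVo
      simp only [k1, if_true]
      split_ifs with h1 h2
      · exact ⟨k1, k2⟩
      · exact ⟨h1, by linarith⟩
      · exact ⟨k1, k2⟩

/-- Linear programs are solvable in exact arithmetic: an algorithm computes, from the coefficients,
an optimal solution of every linear program that is feasible and bounded. One variable is eliminated
at a time, because an optimal solution can be moved until that variable is `0` or some constraint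
that involves it is tight. -/
theorem exists_arith_optimum_fin {I : Type*} [Finite I] (n : ℕ)
    (A : I → Fin n → (ι → ℝ) → ℝ) (b : I → (ι → ℝ) → ℝ) (h : Fin n → (ι → ℝ) → ℝ)
    (hA : ∀ i k, Arith (A i k)) (hb : ∀ i, Arith (b i)) (hh : ∀ k, Arith (h k)) :
    ∃ z : (ι → ℝ) → Fin n → ℝ, (∀ k, Arith fun x => z x k) ∧ ∀ x (u : Fin n → ℝ),
      (∀ i, ∑ k, A i k x * u k ≤ b i x) →
      (∃ M, ∀ u' : Fin n → ℝ, (∀ i, ∑ k, A i k x * u' k ≤ b i x) → ∑ k, h k x * u' k ≤ M) →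
      (∀ i, ∑ k, A i k x * z x k ≤ b i x) ∧ ∑ k, h k x * u k ≤ ∑ k, h k x * z x k := by
  classical
  have := Fintype.ofFinite I
  induction n generalizing b with
  | zero =>
    refine ⟨fun _ k => k.elim0, fun k => k.elim0, fun x u hu _ => ⟨fun i => ?_, by simp⟩⟩
    simpa using hu i
  | succ n ih =>
    -- the first variable is replaced by `q o - ∑ k, p o k * u k`
    let p : Option I → Fin n → (ι → ℝ) → ℝ := fun o k x =>
      o.elim 0 fun i => A i k.succ x / A i 0 x
    let q : Option I → (ι → ℝ) → ℝ := fun o x => o.elim 0 fun i => b i x / A i 0 x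
    have hp : ∀ o k, Arith (p o k) := by
      rintro (_ | i) k
      · exact .zero
      · exact (hA i _).div (hA i 0)
    have hq : ∀ o, Arith (q o) := by
      rintro (_ | i)
      · exact .zero
      · exact (hb i).div (hA i 0)
    have H := fun o => ih (A := fun i k x => A i k.succ x - A i 0 x * p o k x)
      (b := fun i x => b i x - A i 0 x * q o x) (h := fun k x => h k.succ x - h 0 x * p o k x)
      (hA := fun i k => (hA _ _).sub ((hA _ _).mul (hp _ _)))
      (hb := fun i => (hb _).sub ((hA _ _).mul (hq _)))
      (hh := fun k => (hh _).sub ((hh _).mul (hp _ _)))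
    choose z hz hz' using H
    let Z : Option I → (ι → ℝ) → Fin (n + 1) → ℝ := fun o x =>
      Fin.cons (q o x - ∑ k, p o k x * z o x k) (z o x)
    have hZ : ∀ o k, Arith fun x => Z o x k := by
      intro o k
      refine Fin.cases ?_ (fun k => ?_) k
      · exact (hq o).sub (.sum _ fun k => (hp o k).mul (hz o k))
      · simpa [Z] using hz o k
    -- affine substitution in a linear form
    have sub_eq : ∀ (x : ι → ℝ) (o : Option I) (g : Fin (n + 1) → ℝ) (u : Fin n → ℝ),
        ∑ k, g k * (Fin.cons (q o x - ∑ k, p o k x * u k) u : Fin (n + 1) → ℝ) k =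
          ∑ k, (g k.succ - g 0 * p o k x) * u k + g 0 * q o x := by
      intro x o g u
      simp only [Fin.sum_univ_succ, Fin.cons_zero, Fin.cons_succ, sub_mul, Finset.sum_sub_distrib,
        mul_sub, Finset.mul_sum, mul_assoc]
      ring
    obtain ⟨Y, hY, hY'⟩ := exists_best_candidate Z hZ
      (fun x u => ∑ i, max 0 (∑ k, A i k x * u k - b i x)) (fun x u => ∑ k, h k x * u k)
      (fun Y hY => .sum _ fun i => .max_zero
        ((Arith.sum _ fun k => (hA i k).mul (hY k)).sub (hb i)))
      (fun Y hY => .sum _ fun k => (hh k).mul (hY k))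
    have hV : ∀ x (u : Fin (n + 1) → ℝ), ∑ i, max 0 (∑ k, A i k x * u k - b i x) ≤ 0 ↔
        ∀ i, ∑ k, A i k x * u k ≤ b i x := by
      intro x u
      constructor
      · intro hle i
        have h1 : max 0 (∑ k, A i k x * u k - b i x) ≤
            ∑ i, max 0 (∑ k, A i k x * u k - b i x) :=
          Finset.single_le_sum (f := fun i => max 0 (∑ k, A i k x * u k - b i x))
            (fun _ _ => le_max_left _ _) (Finset.mem_univ i)
        linarith [le_max_right 0 (∑ k, A i k x * u k - b i x)]
      · intro hle
        exact Finset.sum_nonpos fun i _ => max_le le_rfl (by linarith [hle i])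
    refine ⟨Y, hY, fun x u hu hM => ?_⟩
    obtain ⟨M, hM⟩ := hM
    obtain ⟨t', ht', hobj, hcase⟩ := exists_boundary (c := fun i => A i 0 x)
      (r := fun i => b i x - ∑ k : Fin n, A i k.succ x * u k.succ) (h := h 0 x) (t := u 0)
      (M := M - ∑ k : Fin n, h k.succ x * u k.succ)
      (fun i => by have := hu i; rw [Fin.sum_univ_succ] at this; linarith)
      (fun t' ht' => by
        have := hM (Fin.cons t' fun k => u k.succ) fun i => by
          have := ht' i
          simp only [Fin.sum_univ_succ, Fin.cons_zero, Fin.cons_succ]; linarith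
        simp only [Fin.sum_univ_succ, Fin.cons_zero, Fin.cons_succ] at this; linarith)
    obtain ⟨o, ho⟩ : ∃ o, t' = q o x - ∑ k, p o k x * u (Fin.succ k) := by
      rcases hcase with rfl | ⟨i, _, rfl⟩
      · exact ⟨none, by simp [p, q]⟩
      · refine ⟨some i, ?_⟩
        simp only [p, q, Option.elim, sub_div, Finset.sum_div]
        congr 1
        exact Finset.sum_congr rfl fun k _ => by ring
    have hfeas : ∀ (o : Option I) (v : Fin n → ℝ),
        (∀ i, ∑ k, (A i k.succ x - A i 0 x * p o k x) * v k ≤ b i x - A i 0 x * q o x) ↔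
        ∀ i, ∑ k, A i k x *
          (Fin.cons (q o x - ∑ k, p o k x * v k) v : Fin (n + 1) → ℝ) k ≤ b i x := by
      intro o v
      refine forall_congr' fun i => ?_
      rw [sub_eq x o (fun k => A i k x)]
      constructor <;> intro h <;> linarith
    have hu' : ∀ i, ∑ k, A i k x * (Fin.cons t' fun k => u k.succ : Fin (n + 1) → ℝ) k ≤ b i x := by
      intro i
      have := ht' i
      simp only [Fin.sum_univ_succ, Fin.cons_zero, Fin.cons_succ]; linarith
    obtain ⟨f1, f2⟩ := hz' o x (fun k => u k.succ) ((hfeas o _).2 (ho ▸ hu'))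
      ⟨M - h 0 x * q o x, fun v hv => by
        have := hM _ ((hfeas o v).1 hv)
        rw [sub_eq x o (fun k => h k x)] at this
        linarith⟩
    obtain ⟨g1, g2⟩ := hY' x o ((hV x _).2 ((hfeas o _).1 f1))
    refine ⟨(hV x _).1 g1, le_trans ?_ g2⟩
    calc ∑ k, h k x * u k ≤ ∑ k, h k x * (Fin.cons t' fun k => u k.succ : Fin (n + 1) → ℝ) k := by
          simp only [Fin.sum_univ_succ, Fin.cons_zero, Fin.cons_succ]; linarith
      _ ≤ _ := by
          rw [ho, sub_eq x o (fun k => h k x), sub_eq x o (fun k => h k x)]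
          linarith

end LinearProgramming

/-! ### Linear programs with named constraints -/

section LinearSystems

variable {ι U : Type*} [Fintype U]

/-- A function of data `x` and unknowns `u` that is affine in `u`, with coefficients that can be
computed from `x`. -/
def AffArith (g : (ι → ℝ) → (U → ℝ) → ℝ) : Prop :=
  ∃ (A : U → (ι → ℝ) → ℝ) (b : (ι → ℝ) → ℝ), (∀ k, Arith (A k)) ∧ Arith b ∧
    ∀ x u, g x u = ∑ k, A k x * u k + b x

namespace AffArith

theorem var (k : U) : AffArith (fun (_ : ι → ℝ) u => u k) := by
  classical
  refine ⟨fun l _ => if l = k then 1 else 0, fun _ => 0, fun l => ?_, .zero, by simp⟩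
  by_cases h : l = k
  · simpa [h] using Arith.one
  · simpa [h] using Arith.zero

theorem of_arith {f : (ι → ℝ) → ℝ} (hf : Arith f) : AffArith (fun x (_ : U → ℝ) => f x) :=
  ⟨fun _ _ => 0, f, fun _ => .zero, hf, by simp⟩

variable {f g : (ι → ℝ) → (U → ℝ) → ℝ}

theorem add (hf : AffArith f) (hg : AffArith g) : AffArith (fun x u => f x u + g x u) := by
  obtain ⟨A, b, hA, hb, h⟩ := hf
  obtain ⟨A', b', hA', hb', h'⟩ := hg
  refine ⟨fun k x => A k x + A' k x, fun x => b x + b' x, fun k => (hA k).add (hA' k),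
    hb.add hb', fun x u => ?_⟩
  simp only [h, h', add_mul, Finset.sum_add_distrib]
  ring

theorem mul {c : (ι → ℝ) → ℝ} (hc : Arith c) (hf : AffArith f) :
    AffArith (fun x u => c x * f x u) := by
  obtain ⟨A, b, hA, hb, h⟩ := hf
  refine ⟨fun k x => c x * A k x, fun x => c x * b x, fun k => hc.mul (hA k), hc.mul hb,
    fun x u => ?_⟩
  simp only [h, mul_add, Finset.mul_sum, mul_assoc]

theorem sub (hf : AffArith f) (hg : AffArith g) : AffArith (fun x u => f x u - g x u) := by
  have := hf.add (hg.mul (Arith.ratCast (-1)))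
  simpa [sub_eq_add_neg] using this

theorem sum {α : Type*} (s : Finset α) {f : α → (ι → ℝ) → (U → ℝ) → ℝ}
    (hf : ∀ a, AffArith (f a)) : AffArith (fun x u => ∑ a ∈ s, f a x u) := by
  classical
  induction s using Finset.induction_on with
  | empty => simpa using of_arith .zero
  | insert a s ha ih => simpa [Finset.sum_insert ha] using (hf a).add ih

end AffArith

/-- A condition on unknowns `u` that is a finite system of linear inequalities, with coefficients
that can be computed from the data `x`. -/
def PolyArith (P : (ι → ℝ) → (U → ℝ) → Prop) : Prop :=
  ∃ S : Set ((ι → ℝ) → (U → ℝ) → ℝ), S.Finite ∧ (∀ g ∈ S, AffArith g) ∧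
    ∀ x u, P x u ↔ ∀ g ∈ S, g x u ≤ 0

namespace PolyArith

theorem le {f g : (ι → ℝ) → (U → ℝ) → ℝ} (hf : AffArith f) (hg : AffArith g) :
    PolyArith (fun x u => f x u ≤ g x u) :=
  ⟨{fun x u => f x u - g x u}, Set.finite_singleton _, by simpa using hf.sub hg, by simp⟩

theorem and {P P' : (ι → ℝ) → (U → ℝ) → Prop} (hP : PolyArith P) (hP' : PolyArith P') :
    PolyArith (fun x u => P x u ∧ P' x u) := by
  obtain ⟨S, h1, h2, h3⟩ := hP
  obtain ⟨S', h1', h2', h3'⟩ := hP'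
  refine ⟨S ∪ S', h1.union h1', ?_, fun x u => ?_⟩
  · rintro g (hg | hg)
    exacts [h2 g hg, h2' g hg]
  · simp only [h3, h3']
    constructor
    · rintro ⟨a, b⟩ g (hg | hg)
      exacts [a g hg, b g hg]
    · exact fun h => ⟨fun g hg => h g (.inl hg), fun g hg => h g (.inr hg)⟩

theorem eq {f g : (ι → ℝ) → (U → ℝ) → ℝ} (hf : AffArith f) (hg : AffArith g) :
    PolyArith (fun x u => f x u = g x u) := by
  simpa only [le_antisymm_iff] using (le hf hg).and (le hg hf)

theorem forall_finite {α : Type*} [Finite α] {P : α → (ι → ℝ) → (U → ℝ) → Prop}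
    (hP : ∀ a, PolyArith (P a)) : PolyArith (fun x u => ∀ a, P a x u) := by
  choose S h1 h2 h3 using hP
  refine ⟨⋃ a, S a, Set.finite_iUnion h1, ?_, fun x u => ?_⟩
  · intro g hg
    obtain ⟨a, ha⟩ := Set.mem_iUnion.1 hg
    exact h2 a g ha
  · simp only [h3, Set.mem_iUnion]
    exact ⟨fun h g ⟨a, ha⟩ => h a g ha, fun h a g hg => h g ⟨a, hg⟩⟩

theorem imp {p : Prop} {P : (ι → ℝ) → (U → ℝ) → Prop} (hP : PolyArith P) :
    PolyArith (fun x u => p → P x u) := by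
  by_cases hp : p
  · simpa [hp] using hP
  · exact ⟨∅, Set.finite_empty, by simp, by simp [hp]⟩

end PolyArith

/-- An algorithm computes an optimal solution of every feasible and bounded linear program. -/
theorem exists_arith_optimum {P : (ι → ℝ) → (U → ℝ) → Prop} {h : (ι → ℝ) → (U → ℝ) → ℝ}
    (hP : PolyArith P) (hh : AffArith h) :
    ∃ z : (ι → ℝ) → U → ℝ, (∀ k, Arith fun x => z x k) ∧ ∀ x u, P x u →
      (∃ M, ∀ u', P x u' → h x u' ≤ M) → P x (z x) ∧ h x u ≤ h x (z x) := by
  obtain ⟨S, h1, h2, h3⟩ := hP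
  have : Finite S := h1
  choose A b hA hb hAb using fun g : S => h2 g.1 g.2
  obtain ⟨C, c, hC, hc, hCc⟩ := hh
  let e := Fintype.equivFin U
  obtain ⟨z, hz, hz'⟩ := exists_arith_optimum_fin (Fintype.card U)
    (fun g k => A g (e.symm k)) (fun g x => -b g x) (fun k => C (e.symm k))
    (fun g k => hA g _) (fun g => (hb g).neg) (fun k => hC _)
  -- the sums over `Fin (card U)` and over `U` agree
  have hsum : ∀ (a : U → ℝ) (v : Fin (Fintype.card U) → ℝ),
      ∑ k, a (e.symm k) * v k = ∑ k, a k * v (e k) := fun a v => by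
    rw [← e.symm.sum_comp (fun k => a k * v (e k))]; simp
  have hPP : ∀ x (v : Fin (Fintype.card U) → ℝ), P x (fun k => v (e k)) ↔
      ∀ g : S, ∑ k, A g (e.symm k) x * v k ≤ -b g x := by
    intro x v
    rw [h3, Subtype.forall']
    refine forall_congr' fun g => ?_
    rw [hAb g, hsum (fun k => A g k x)]
    constructor <;> intro h <;> linarith
  refine ⟨fun x k => z x (e k), fun k => hz _, fun x u hu hM => ?_⟩
  obtain ⟨M, hM⟩ := hM
  obtain ⟨k1, k2⟩ := hz' x (fun k => u (e.symm k)) ((hPP x _).1 (by simpa using hu))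
    ⟨M - c x, fun v hv => by
      have := hM _ ((hPP x v).2 hv)
      rw [hCc, ← hsum (fun k => C k x)] at this
      linarith⟩
  refine ⟨(hPP x _).2 k1, ?_⟩
  rw [hsum (fun k => C k x), hsum (fun k => C k x)] at k2
  simp only [Equiv.symm_apply_apply] at k2
  rw [hCc, hCc]
  linarith

end LinearSystems

/-! ### Farkas' lemma -/

section Farkas

/-- **Farkas' lemma** over an arbitrary real vector space: a linear form that is nonnegative wherever
finitely many linear forms are nonnegative is a conic combination of them. -/
theorem exists_conic_combination {V ι : Type*} [AddCommGroup V] [Module ℝ V] [Fintype ι]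
    (φ : ι → V →ₗ[ℝ] ℝ) (f : V →ₗ[ℝ] ℝ) (h : ∀ v, (∀ i, 0 ≤ φ i v) → 0 ≤ f v) :
    ∃ l : ι → ℝ, (∀ i, 0 ≤ l i) ∧ f = ∑ i, l i • φ i := by
  classical
  suffices H : ∀ (s : Finset ι) (φ : ι → V →ₗ[ℝ] ℝ) (f : V →ₗ[ℝ] ℝ),
      (∀ v, (∀ i ∈ s, 0 ≤ φ i v) → 0 ≤ f v) →
      ∃ l : ι → ℝ, (∀ i, 0 ≤ l i) ∧ f = ∑ i ∈ s, l i • φ i from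
    H Finset.univ φ f (by simpa using h)
  clear h f φ
  intro s
  induction s using Finset.induction_on with
  | empty =>
    intro φ f h
    refine ⟨0, by simp, LinearMap.ext fun v => ?_⟩
    have h1 := h v (by simp)
    have h2 := h (-v) (by simp)
    rw [map_neg] at h2
    simp only [Finset.sum_empty, LinearMap.zero_apply]
    linarith
  | insert a s ha ih =>
    intro φ f h
    by_cases hf : ∀ v, (∀ i ∈ s, 0 ≤ φ i v) → 0 ≤ f v
    · obtain ⟨l, hl, rfl⟩ := ih φ f hf
      refine ⟨Function.update l a 0, fun i => ?_, ?_⟩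
      · by_cases hi : i = a
        · simp [hi]
        · simp [hi, hl i]
      · rw [Finset.sum_insert ha]
        simp only [Function.update_self, zero_smul, zero_add]
        refine Finset.sum_congr rfl fun i hi => ?_
        have hia : i ≠ a := by rintro rfl; exact ha hi
        rw [Function.update_of_ne hia]
    · push Not at hf
      obtain ⟨x₀, hx, hfx⟩ := hf
      have hax : φ a x₀ < 0 := by
        by_contra! hc
        refine hfx.not_ge (h x₀ fun i hi => ?_)
        rcases Finset.mem_insert.1 hi with rfl | hi
        exacts [hc, hx i hi]
      -- project along `x₀` onto the kernel of `φ a`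
      set c : ℝ := φ a x₀ with hcdef
      have hc0 : c ≠ 0 := hax.ne
      have key : ∀ v (g : V →ₗ[ℝ] ℝ), (g - (g x₀ / c) • φ a) v = g (v - (φ a v / c) • x₀) := by
        intro v g
        simp only [LinearMap.sub_apply, LinearMap.smul_apply, smul_eq_mul, map_sub, map_smul]
        field_simp
      obtain ⟨l, hl, hl'⟩ := ih (fun i => φ i - (φ i x₀ / c) • φ a) (f - (f x₀ / c) • φ a) (by
        intro v hv
        rw [key]
        refine h _ fun i hi => ?_
        rcases Finset.mem_insert.1 hi with rfl | hi
        · simp only [map_sub, map_smul, smul_eq_mul, ← hcdef]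
          field_simp
          simp
        · rw [← key]; exact hv i hi)
      refine ⟨Function.update l a (f x₀ / c - ∑ i ∈ s, l i * (φ i x₀ / c)), fun i => ?_, ?_⟩
      · by_cases hi : i = a
        · subst hi
          simp only [Function.update_self]
          have h1 : 0 ≤ f x₀ / c := div_nonneg_of_nonpos hfx.le hax.le
          have h2 : ∑ i ∈ s, l i * (φ i x₀ / c) ≤ 0 := Finset.sum_nonpos fun k hk =>
            mul_nonpos_of_nonneg_of_nonpos (hl k) (div_nonpos_of_nonneg_of_nonpos (hx k hk) hax.le)
          linarith
        · simp [hi, hl i]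
      · rw [Finset.sum_insert ha, Function.update_self]
        have h3 : ∑ i ∈ s, Function.update l a (f x₀ / c - ∑ i ∈ s, l i * (φ i x₀ / c)) i • φ i =
            ∑ i ∈ s, l i • φ i := by
          refine Finset.sum_congr rfl fun i hi => ?_
          have hia : i ≠ a := by rintro rfl; exact ha hi
          rw [Function.update_of_ne hia]
        rw [h3]
        refine (eq_add_of_sub_eq hl').trans ?_
        ext v
        simp only [LinearMap.add_apply, LinearMap.sum_apply, LinearMap.smul_apply,
          LinearMap.sub_apply, smul_eq_mul, mul_sub, Finset.sum_sub_distrib, sub_mul,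
          Finset.sum_mul, mul_assoc]
        ring

end Farkas

/-! ### Solvent portfolios, compatible prices and their duality -/

section Cones

variable {d : ℕ}

/-- The portfolios in `ℝ^d` that can be exchanged into nonnegative holdings at the rates `π`. -/
def solvent (π : Fin d → Fin d → ℝ) : Set (Fin d → ℝ) :=
  {x | ∃ β : Fin d → Fin d → ℝ, (∀ j k, 0 ≤ β j k) ∧
    ∀ k, 0 ≤ x k + ∑ j, β j k - ∑ j, β k j * π k j}

/-- The price vectors in `ℝ^d` that are compatible with the rates `π`: the dual cone of
`solvent π`. -/
def compatible (π : Fin d → Fin d → ℝ) : Set (Fin d → ℝ) :=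
  {s | (∀ k, 0 ≤ s k) ∧ ∀ j k, s k ≤ π j k * s j}

theorem solvent_of_nonneg {π : Fin d → Fin d → ℝ} {x : Fin d → ℝ} (hx : ∀ k, 0 ≤ x k) :
    x ∈ solvent π :=
  ⟨0, by simp, by simpa using hx⟩

theorem solvent_add {π : Fin d → Fin d → ℝ} {x y : Fin d → ℝ} (hx : x ∈ solvent π)
    (hy : y ∈ solvent π) : x + y ∈ solvent π := by
  obtain ⟨β, h1, h2⟩ := hx
  obtain ⟨γ, h3, h4⟩ := hy
  refine ⟨β + γ, fun j k => add_nonneg (h1 j k) (h3 j k), fun k => ?_⟩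
  have := add_nonneg (h2 k) (h4 k)
  simp only [Pi.add_apply, add_mul, Finset.sum_add_distrib]
  linarith

theorem solvent_smul {π : Fin d → Fin d → ℝ} {x : Fin d → ℝ} {c : ℝ} (hc : 0 ≤ c)
    (hx : x ∈ solvent π) : c • x ∈ solvent π := by
  obtain ⟨β, h1, h2⟩ := hx
  refine ⟨c • β, fun j k => mul_nonneg hc (h1 j k), fun k => ?_⟩
  have := mul_nonneg hc (h2 k)
  simp only [Pi.smul_apply, smul_eq_mul, mul_assoc, ← Finset.mul_sum]
  linarith

theorem solvent_sum {π : Fin d → Fin d → ℝ} {α : Type*} (s : Finset α) {x : α → Fin d → ℝ}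
    (hx : ∀ a ∈ s, x a ∈ solvent π) : ∑ a ∈ s, x a ∈ solvent π :=
  Finset.sum_induction x (· ∈ solvent π) (fun _ _ => solvent_add)
    (solvent_of_nonneg fun _ => le_rfl) hx

theorem dotProduct_nonneg_of_compatible {π : Fin d → Fin d → ℝ} {s x : Fin d → ℝ}
    (hs : s ∈ compatible π) (hx : x ∈ solvent π) : 0 ≤ s ⬝ᵥ x := by
  obtain ⟨β, h1, h2⟩ := hx
  have h3 : 0 ≤ ∑ k, s k * (x k + ∑ j, β j k - ∑ j, β k j * π k j) :=
    Finset.sum_nonneg fun k _ => mul_nonneg (hs.1 k) (h2 k)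
  have h4 : ∑ k, s k * ∑ j, β j k ≤ ∑ k, s k * ∑ j, β k j * π k j := by
    simp only [Finset.mul_sum]
    rw [Finset.sum_comm]
    refine Finset.sum_le_sum fun j _ => Finset.sum_le_sum fun k _ => ?_
    calc s k * β j k ≤ π j k * s j * β j k := mul_le_mul_of_nonneg_right (hs.2 j k) (h1 j k)
      _ = s j * (β j k * π j k) := by ring
  simp only [mul_sub, mul_add, Finset.sum_add_distrib, Finset.sum_sub_distrib] at h3
  simp only [dotProduct]
  linarith

theorem compatible_add {π : Fin d → Fin d → ℝ} {s s' : Fin d → ℝ} (hs : s ∈ compatible π)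
    (hs' : s' ∈ compatible π) : s + s' ∈ compatible π := by
  refine ⟨fun k => add_nonneg (hs.1 k) (hs'.1 k), fun j k => ?_⟩
  have h1 := hs.2 j k
  have h2 := hs'.2 j k
  simp only [Pi.add_apply]
  linarith

theorem compatible_smul {π : Fin d → Fin d → ℝ} {s : Fin d → ℝ} {c : ℝ} (hc : 0 ≤ c)
    (hs : s ∈ compatible π) : c • s ∈ compatible π := by
  refine ⟨fun k => mul_nonneg hc (hs.1 k), fun j k => ?_⟩
  have := mul_le_mul_of_nonneg_left (hs.2 j k) hc
  simp only [Pi.smul_apply, smul_eq_mul]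
  linarith

theorem compatible_sum {π : Fin d → Fin d → ℝ} {α : Type*} (s : Finset α) {x : α → Fin d → ℝ}
    (hx : ∀ a ∈ s, x a ∈ compatible π) : ∑ a ∈ s, x a ∈ compatible π :=
  Finset.sum_induction x (· ∈ compatible π) (fun _ _ => compatible_add)
    ⟨fun _ => le_rfl, fun _ _ => by simp⟩ hx

theorem eq_zero_of_compatible {π : Fin d → Fin d → ℝ} {s : Fin d → ℝ} (hs : s ∈ compatible π)
    {j : Fin d} (hj : s j = 0) : s = 0 := by
  funext k
  refine le_antisymm ?_ (hs.1 k)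
  simpa [hj] using hs.2 j k

/-- Duality for a finite family of nodes `n` at which exchange rates `π n` are available: if no
decision `w` superhedges the claims `f n`, then this is due to compatible prices that make all
decisions costless and the claims expensive. -/
theorem exists_prices_of_not_superhedge {N W : Type*} [Fintype N] [AddCommGroup W] [Module ℝ W]
    (π : N → Fin d → Fin d → ℝ) (D : W →ₗ[ℝ] N → Fin d → ℝ) (f : N → Fin d → ℝ)
    (h : ¬ ∃ w, ∀ n, D w n - f n ∈ solvent (π n)) :
    ∃ l : N → Fin d → ℝ, (∀ n, l n ∈ compatible (π n)) ∧ (∀ w, ∑ n, l n ⬝ᵥ D w n = 0) ∧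
      0 < ∑ n, l n ⬝ᵥ f n := by
  classical
  -- the claims are scaled by an extra variable `t`, and superhedging amounts to `0 < t`
  let φ : (N × Fin d) ⊕ (N × Fin d × Fin d) →
      (W × ℝ × (N → Fin d → Fin d → ℝ)) →ₗ[ℝ] ℝ := fun i => match i with
    | .inl (n, k) =>
      { toFun := fun v => D v.1 n k - v.2.1 * f n k + ∑ j, v.2.2 n j k -
          ∑ j, v.2.2 n k j * π n k j
        map_add' := fun v v' => by
          simp only [Prod.fst_add, Prod.snd_add, map_add, Pi.add_apply, add_mul,
            Finset.sum_add_distrib]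
          ring
        map_smul' := fun c v => by
          simp only [Prod.smul_fst, Prod.smul_snd, map_smul, Pi.smul_apply, smul_eq_mul,
            RingHom.id_apply, mul_assoc, ← Finset.mul_sum]
          ring }
    | .inr (n, j, k) =>
      { toFun := fun v => v.2.2 n j k
        map_add' := fun v v' => rfl
        map_smul' := fun c v => rfl }
  let g : (W × ℝ × (N → Fin d → Fin d → ℝ)) →ₗ[ℝ] ℝ :=
    { toFun := fun v => -v.2.1
      map_add' := fun v v' => by simp only [Prod.fst_add, Prod.snd_add]; ring
      map_smul' := fun c v => by
        simp only [Prod.smul_fst, Prod.smul_snd, smul_eq_mul, RingHom.id_apply]; ring }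
  obtain ⟨l, hl, hl'⟩ := exists_conic_combination φ g (by
    rintro ⟨w, t, β⟩ hv
    change 0 ≤ -t
    by_contra! ht
    have ht : 0 < t := by linarith
    refine h ⟨t⁻¹ • w, fun n => ⟨fun j k => t⁻¹ * β n j k, fun j k =>
      mul_nonneg (inv_nonneg.2 ht.le) (hv (.inr (n, j, k))), fun k => ?_⟩⟩
    have h1 : 0 ≤ D w n k - t * f n k + ∑ j, β n j k - ∑ j, β n k j * π n k j := hv (.inl (n, k))
    have h2 := mul_nonneg (inv_nonneg.2 ht.le) h1
    have h3 : t⁻¹ * (t * f n k) = f n k := by field_simp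
    simp only [map_smul, Pi.sub_apply, Pi.smul_apply, smul_eq_mul, mul_assoc, ← Finset.mul_sum]
    rw [mul_sub, mul_add, mul_sub, h3] at h2
    linarith)
  have hv : ∀ (w : W) (t : ℝ) (β : N → Fin d → Fin d → ℝ),
      -t = ∑ n, ∑ k, l (.inl (n, k)) * (D w n k - t * f n k + ∑ j, β n j k -
      ∑ j, β n k j * π n k j) + ∑ n, ∑ j, ∑ k, l (.inr (n, j, k)) * β n j k := by
    intro w t β
    have := LinearMap.congr_fun hl' (w, t, β)
    simp only [LinearMap.sum_apply, LinearMap.smul_apply, smul_eq_mul] at this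
    simp only [Fintype.sum_sum_type, Fintype.sum_prod_type] at this
    exact this
  refine ⟨fun n k => l (.inl (n, k)), fun n => ⟨fun k => hl _, fun j k => ?_⟩, fun w => ?_, ?_⟩
  · have h1 := hv 0 0 (Pi.single n (Pi.single j (Pi.single k 1)))
    have e1 : ∀ (n' : N) (j' k' : Fin d), (Pi.single n (Pi.single j (Pi.single k (1 : ℝ))) :
        N → Fin d → Fin d → ℝ) n' j' k' =
        if n' = n then if j' = j then if k' = k then 1 else 0 else 0 else 0 := by
      intro n' j' k'
      by_cases hn : n' = n
      · subst hn
        by_cases hj : j' = j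
        · subst hj
          by_cases hk : k' = k
          · subst hk; simp
          · simp [hk]
        · simp [hj]
      · simp [hn]
    simp only [e1, map_zero, Pi.zero_apply, zero_mul, ite_mul, mul_ite, mul_one, mul_zero, one_mul,
      Finset.sum_ite_eq', Finset.mem_univ, if_true, sub_zero, zero_add,
      neg_zero, mul_sub, Finset.sum_sub_distrib, Finset.sum_ite_irrel, Finset.sum_const_zero] at h1
    have h2 := hl (.inr (n, j, k))
    linarith
  · have h1 := hv w 0 0
    simp only [dotProduct]
    simpa using h1.symm
  · have h1 := hv 0 1 0
    simp only [dotProduct]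
    simp at h1
    linarith

end Cones

/-! ### Atoms and averages on a finite probability space -/

section Atoms

variable {Ω : Type*} [Fintype Ω]

open Classical in
/-- The atom of the σ-algebra `m` that contains `ω`. -/
noncomputable def atom (m : MeasurableSpace Ω) (ω : Ω) : Finset Ω :=
  {ω' | ∀ s, MeasurableSet[m] s → ω ∈ s → ω' ∈ s}

theorem mem_atom {m : MeasurableSpace Ω} {ω ω' : Ω} :
    ω' ∈ atom m ω ↔ ∀ s, MeasurableSet[m] s → ω ∈ s → ω' ∈ s := by
  simp [atom]

theorem self_mem_atom (m : MeasurableSpace Ω) (ω : Ω) : ω ∈ atom m ω :=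
  mem_atom.2 fun _ _ h => h

theorem mem_atom_symm {m : MeasurableSpace Ω} {ω ω' : Ω} (h : ω' ∈ atom m ω) : ω ∈ atom m ω' := by
  refine mem_atom.2 fun s hs hω' => ?_
  by_contra hω
  exact mem_atom.1 h sᶜ hs.compl hω hω'

theorem atom_eq_of_mem {m : MeasurableSpace Ω} {ω ω' : Ω} (h : ω' ∈ atom m ω) :
    atom m ω' = atom m ω := by
  ext x
  exact ⟨fun hx => mem_atom.2 fun s hs hω => mem_atom.1 hx s hs (mem_atom.1 h s hs hω),
    fun hx => mem_atom.2 fun s hs hω => mem_atom.1 hx s hs (mem_atom.1 (mem_atom_symm h) s hs hω)⟩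

theorem atom_subset {m m' : MeasurableSpace Ω} (h : m ≤ m') (ω : Ω) : atom m' ω ⊆ atom m ω :=
  fun _ hx => mem_atom.2 fun s hs => mem_atom.1 hx s (h s hs)

theorem measurableSet_atom (m : MeasurableSpace Ω) (ω : Ω) :
    MeasurableSet[m] (atom m ω : Set Ω) := by
  have h : (atom m ω : Set Ω) = measurableAtom ω := by
    ext x
    simp only [Finset.mem_coe, mem_atom, measurableAtom, Set.mem_iInter]
    exact ⟨fun h s h1 h2 => h s h2 h1, fun h s h1 h2 => h s h2 h1⟩
  rw [h]
  exact MeasurableSet.measurableAtom_of_countable ω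

theorem atom_top (ω : Ω) : atom ⊤ ω = {ω} := by
  ext x
  simp only [mem_atom, Finset.mem_singleton]
  exact ⟨fun h => h {ω} trivial rfl, fun h s _ hω => h ▸ hω⟩

/-- `f` is constant on the atoms of `m`, which on a finite space means that it is
`m`-measurable. -/
def ConstOnAtoms {E : Type*} (m : MeasurableSpace Ω) (f : Ω → E) : Prop :=
  ∀ ω, ∀ ω' ∈ atom m ω, f ω' = f ω

theorem measurable_iff_constOnAtoms {E : Type*} [MeasurableSpace E] [MeasurableSingletonClass E]
    {m : MeasurableSpace Ω} {f : Ω → E} : Measurable[m] f ↔ ConstOnAtoms m f := by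
  constructor
  · intro hf ω ω' h
    exact mem_atom.1 h (f ⁻¹' {f ω}) (hf (measurableSet_singleton _)) rfl
  · intro hf s _
    have : f ⁻¹' s = ⋃ ω ∈ f ⁻¹' s, (atom m ω : Set Ω) := by
      ext x
      simp only [Set.mem_iUnion, Finset.mem_coe, Set.mem_preimage]
      refine ⟨fun hx => ⟨x, hx, self_mem_atom m x⟩, ?_⟩
      rintro ⟨ω, hω, hx⟩
      rwa [hf ω x hx]
    rw [this]
    exact MeasurableSet.biUnion (Set.to_countable _) fun ω _ => measurableSet_atom m ω

theorem ConstOnAtoms.mono {E : Type*} {m m' : MeasurableSpace Ω} (h : m ≤ m') {f : Ω → E}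
    (hf : ConstOnAtoms m f) : ConstOnAtoms m' f :=
  fun ω ω' hω' => hf ω ω' (atom_subset h ω hω')

/-- The average of `f` over the atom of `m` that contains `ω`: the conditional expectation with
respect to the uniform distribution. -/
noncomputable def av (m : MeasurableSpace Ω) (f : Ω → ℝ) (ω : Ω) : ℝ :=
  (∑ ω' ∈ atom m ω, f ω') / (atom m ω).card

theorem card_atom_pos (m : MeasurableSpace Ω) (ω : Ω) : (0 : ℝ) < (atom m ω).card :=
  Nat.cast_pos.2 (Finset.card_pos.2 ⟨ω, self_mem_atom m ω⟩)

theorem constOnAtoms_av (m : MeasurableSpace Ω) (f : Ω → ℝ) : ConstOnAtoms m (av m f) :=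
  fun ω ω' h => by simp only [av, atom_eq_of_mem h]

theorem sum_atom (m : MeasurableSpace Ω) (f : Ω → ℝ) (ω : Ω) :
    ∑ ω' ∈ atom m ω, f ω' = (atom m ω).card * av m f ω := by
  have := card_atom_pos m ω
  simp only [av]
  field_simp

theorem av_mul {m : MeasurableSpace Ω} {f g : Ω → ℝ} (hg : ConstOnAtoms m g) (ω : Ω) :
    av m (fun ω => f ω * g ω) ω = av m f ω * g ω := by
  simp only [av, div_mul_eq_mul_div, Finset.sum_mul]
  congr 1
  exact Finset.sum_congr rfl fun ω' h => by rw [hg ω ω' h]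

theorem av_of_constOnAtoms {m : MeasurableSpace Ω} {g : Ω → ℝ} (hg : ConstOnAtoms m g) (ω : Ω) :
    av m g ω = g ω := by
  have h1 := av_mul (f := fun _ => 1) hg ω
  have h2 : av m (fun _ => (1 : ℝ)) ω = 1 := by
    have := card_atom_pos m ω
    simp only [av, Finset.sum_const, nsmul_eq_mul, mul_one]
    field_simp
  simpa [h2] using h1

theorem av_add (m : MeasurableSpace Ω) (f g : Ω → ℝ) (ω : Ω) :
    av m (fun ω => f ω + g ω) ω = av m f ω + av m g ω := by
  simp only [av, Finset.sum_add_distrib, add_div]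

theorem av_finset_sum {α : Type*} (m : MeasurableSpace Ω) (s : Finset α) (f : α → Ω → ℝ) (ω : Ω) :
    av m (fun ω => ∑ a ∈ s, f a ω) ω = ∑ a ∈ s, av m (f a) ω := by
  simp only [av]
  rw [Finset.sum_comm, Finset.sum_div]

theorem av_nonneg {m : MeasurableSpace Ω} {f : Ω → ℝ} {ω : Ω} (hf : ∀ ω' ∈ atom m ω, 0 ≤ f ω') :
    0 ≤ av m f ω :=
  div_nonneg (Finset.sum_nonneg hf) (Nat.cast_nonneg _)

theorem eq_zero_of_av_eq_zero {m : MeasurableSpace Ω} {f : Ω → ℝ} {ω : Ω}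
    (hf : ∀ ω' ∈ atom m ω, 0 ≤ f ω') (h : av m f ω = 0) : f ω = 0 := by
  have h1 : ∑ ω' ∈ atom m ω, f ω' = 0 := by rw [sum_atom, h, mul_zero]
  exact (Finset.sum_eq_zero_iff_of_nonneg hf).1 h1 ω (self_mem_atom m ω)

theorem av_congr {m : MeasurableSpace Ω} {f g : Ω → ℝ} {ω : Ω}
    (h : ∀ ω' ∈ atom m ω, f ω' = g ω') : av m f ω = av m g ω := by
  simp only [av]
  rw [Finset.sum_congr rfl h]

theorem sum_av_of_saturated {m : MeasurableSpace Ω} (f : Ω → ℝ) {A : Finset Ω}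
    (hA : ∀ ω ∈ A, atom m ω ⊆ A) : ∑ ω ∈ A, av m f ω = ∑ ω ∈ A, f ω := by
  classical
  have h1 : ∀ ω ∈ A, av m f ω = ∑ ω' ∈ A, if ω' ∈ atom m ω then f ω' / (atom m ω').card else 0 := by
    intro ω hω
    rw [← Finset.sum_filter, Finset.filter_mem_eq_inter, Finset.inter_eq_right.2 (hA ω hω), av,
      Finset.sum_div]
    exact Finset.sum_congr rfl fun ω' h => by rw [atom_eq_of_mem h]
  rw [Finset.sum_congr rfl h1, Finset.sum_comm]
  refine Finset.sum_congr rfl fun ω' hω' => ?_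
  have h2 : ∀ ω, ω' ∈ atom m ω ↔ ω ∈ atom m ω' := fun ω => ⟨mem_atom_symm, mem_atom_symm⟩
  simp only [h2]
  rw [← Finset.sum_filter, Finset.filter_mem_eq_inter, Finset.inter_eq_right.2 (hA ω' hω'),
    Finset.sum_const, nsmul_eq_mul]
  have := card_atom_pos m ω'
  field_simp

theorem sum_av (m : MeasurableSpace Ω) (f : Ω → ℝ) : ∑ ω, av m f ω = ∑ ω, f ω :=
  sum_av_of_saturated f fun _ _ => Finset.subset_univ _

theorem av_av {m m' : MeasurableSpace Ω} (h : m ≤ m') (f : Ω → ℝ) (ω : Ω) :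
    av m (av m' f) ω = av m f ω := by
  simp only [av]
  congr 1
  refine sum_av_of_saturated f fun ω' hω' => ?_
  rw [← atom_eq_of_mem hω']
  exact atom_subset h ω'

theorem av_dotProduct {d : ℕ} {m : MeasurableSpace Ω} {u y : Ω → Fin d → ℝ}
    (hy : ConstOnAtoms m y) (ω : Ω) :
    av m (fun ω => u ω ⬝ᵥ y ω) ω = (fun k => av m (fun ω => u ω k) ω) ⬝ᵥ y ω := by
  simp only [dotProduct]
  rw [av_finset_sum]
  exact Finset.sum_congr rfl fun k _ => av_mul (fun ω ω' h => by rw [hy ω ω' h]) ω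

/-- On the atoms of `m`, averaging preserves a compatible cone that is constant there. -/
theorem av_mem_compatible {d : ℕ} {m : MeasurableSpace Ω} {u : Ω → Fin d → ℝ}
    {π : Ω → Fin d → Fin d → ℝ} (hπ : ConstOnAtoms m π) (hu : ∀ ω, u ω ∈ compatible (π ω)) (ω : Ω) :
    (fun k => av m (fun ω => u ω k) ω) ∈ compatible (π ω) := by
  have h1 : (fun k => av m (fun ω => u ω k) ω) =
      ((atom m ω).card : ℝ)⁻¹ • ∑ ω' ∈ atom m ω, u ω' := by
    funext k
    simp only [av, Pi.smul_apply, Finset.sum_apply, smul_eq_mul]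
    rw [inv_mul_eq_div]
  rw [h1]
  refine compatible_smul (by positivity) (compatible_sum _ fun ω' h => ?_)
  rw [← hπ ω ω' h]
  exact hu ω'

end Atoms

/-! ### Solvency cones -/

section Market

variable {Ω : Type*} [Fintype Ω] {m : MeasurableSpace Ω} {T d : ℕ}
  {𝓕 : Filtration (Fin (T + 1)) m} {rate : Fin (T + 1) → Ω → Fin d → Fin d → ℝ}

theorem IsExchangeRate.constOnAtoms (h : IsExchangeRate 𝓕 rate) (t : Fin (T + 1)) :
    ConstOnAtoms (𝓕 t) (rate t) := by
  intro ω ω' hω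
  funext j k
  exact measurable_iff_constOnAtoms.1 (h.adapted t j k) ω ω' hω

/-- Solvency is decided on each atom separately, because exchanges can be chosen there. -/
theorem mem_solvencyCone (h : IsExchangeRate 𝓕 rate) {t : Fin (T + 1)} {x : Ω → Fin d → ℝ} :
    x ∈ solvencyCone 𝓕 rate t ↔ Measurable[𝓕 t] x ∧ ∀ ω, x ω ∈ solvent (rate t ω) := by
  constructor
  · rintro ⟨hx, y, -, hy, β, -, hβ, hxy⟩
    exact ⟨hx, fun ω => ⟨fun j k => β j k ω, fun j k => hβ j k ω, fun k => hxy ω k ▸ hy ω k⟩⟩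
  · rintro ⟨hx, hs⟩
    choose β hβ hβ' using hs
    rcases isEmpty_or_nonempty Ω with hΩ | hΩ
    · exact ⟨hx, x, hx, fun ω => hΩ.elim ω, fun _ _ ω => hΩ.elim ω,
        fun _ _ => measurable_iff_constOnAtoms.2 fun ω => hΩ.elim ω,
        fun _ _ ω => hΩ.elim ω, fun ω => hΩ.elim ω⟩
    -- a representative of each atom
    let ρ : Ω → Ω := fun ω => Classical.epsilon (· ∈ atom (𝓕 t) ω)
    have hρ : ∀ ω, ρ ω ∈ atom (𝓕 t) ω := fun ω =>
      Classical.epsilon_spec (p := (· ∈ atom (𝓕 t) ω)) ⟨ω, self_mem_atom _ ω⟩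
    have hρ' : ConstOnAtoms (𝓕 t) ρ := fun ω ω' hω => by simp only [ρ, atom_eq_of_mem hω]
    have hxc := measurable_iff_constOnAtoms.1 hx
    have hβc : ∀ j k, ConstOnAtoms (𝓕 t) fun ω => β (ρ ω) j k := fun j k ω ω' hω => by
      simp only [hρ' ω ω' hω]
    refine ⟨hx, fun ω k => x ω k + ∑ j, β (ρ ω) j k - ∑ j, β (ρ ω) k j * rate t ω k j,
      measurable_iff_constOnAtoms.2 fun ω ω' hω => ?_, fun ω k => ?_,
      fun j k ω => β (ρ ω) j k, fun j k => measurable_iff_constOnAtoms.2 (hβc j k),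
      fun j k ω => hβ _ _ _, fun ω k => rfl⟩
    · funext k
      simp only [hxc ω ω' hω, hρ' ω ω' hω, h.constOnAtoms t ω ω' hω]
    · have := hβ' (ρ ω) k
      rwa [hxc ω _ (hρ ω), h.constOnAtoms t ω _ (hρ ω)] at this

end Market

/-! ### Price processes, superhedging and the dual linear program -/

section Duality

variable {Ω : Type*} [Fintype Ω] {m : MeasurableSpace Ω} {T d : ℕ}
  {𝓕 : Filtration (Fin (T + 1)) m} {rate : Fin (T + 1) → Ω → Fin d → Fin d → ℝ}

theorem constOnAtoms_castSucc {E : Type*} {y : Fin (T + 2) → Ω → E} (h0 : ∃ c, ∀ ω, y 0 ω = c)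
    (h : ∀ t : Fin (T + 1), ConstOnAtoms (𝓕 t) (y t.succ)) (t : Fin (T + 1)) :
    ConstOnAtoms (𝓕 t) (y t.castSucc) := by
  refine Fin.cases ?_ (fun s => ?_) t
  · obtain ⟨c, hc⟩ := h0
    intro ω ω' _
    simp [hc]
  · rw [← Fin.succ_castSucc]
    exact (h _).mono (𝓕.mono (Fin.castSucc_lt_succ (i := s)).le)

open Classical in
/-- The trading strategy that holds, between times `s` and `s + 1`, one unit of asset `k` on the
atom of `𝓕 s` that contains `ω`. -/
noncomputable def testStrategy (𝓕 : Filtration (Fin (T + 1)) m) (s : Fin T) (ω : Ω) (k : Fin d) :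
    Fin (T + 2) → Ω → Fin d → ℝ := fun r ω' i =>
  if r = s.castSucc.succ ∧ ω' ∈ atom (𝓕 s.castSucc) ω ∧ i = k then 1 else 0

theorem testStrategy_of_ne {s : Fin T} {ω : Ω} {k : Fin d} {r : Fin (T + 2)}
    (h : r ≠ s.castSucc.succ) : testStrategy 𝓕 s ω k r = 0 := by
  funext ω' i
  simp [testStrategy, h]

theorem constOnAtoms_testStrategy (s : Fin T) (ω : Ω) (k : Fin d) (r : Fin (T + 1)) :
    ConstOnAtoms (𝓕 r) (testStrategy 𝓕 s ω k r.succ) := by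
  intro ω₁ ω₂ h
  funext i
  by_cases hr : r = s.castSucc
  · subst hr
    have : ω₂ ∈ atom (𝓕 s.castSucc) ω ↔ ω₁ ∈ atom (𝓕 s.castSucc) ω :=
      ⟨fun h2 => by rw [← atom_eq_of_mem h2]; exact mem_atom_symm h,
        fun h1 => by rw [← atom_eq_of_mem h1]; exact h⟩
    classical
    exact if_congr (by rw [this]) rfl rfl
  · have : r.succ ≠ s.castSucc.succ := fun e => hr (Fin.succ_injective _ e)
    simp [testStrategy_of_ne this]

/-- Testing prices `l` against a strategy that is active in one period on one atom reveals the
one-period increment of their conditional averages. -/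
theorem sum_dotProduct_testStrategy (l : Fin (T + 1) → Ω → Fin d → ℝ) (s : Fin T) (ω : Ω)
    (k : Fin d) :
    ∑ t : Fin (T + 1), ∑ ω', l t ω' ⬝ᵥ
        (testStrategy 𝓕 s ω k t.castSucc ω' - testStrategy 𝓕 s ω k t.succ ω') =
      (atom (𝓕 s.castSucc) ω).card * (av (𝓕 s.castSucc) (fun ω => l s.succ ω k) ω -
        av (𝓕 s.castSucc) (fun ω => l s.castSucc ω k) ω) := by
  classical
  have h1 : ∀ (t : Fin (T + 1)) (r : Fin (T + 2)), ∑ ω', l t ω' ⬝ᵥ testStrategy 𝓕 s ω k r ω' =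
      if r = s.castSucc.succ then ∑ ω' ∈ atom (𝓕 s.castSucc) ω, l t ω' k else 0 := by
    intro t r
    split_ifs with hr
    · rw [← Finset.sum_filter_add_sum_filter_not Finset.univ (· ∈ atom (𝓕 s.castSucc) ω),
        Finset.filter_mem_eq_inter, Finset.univ_inter]
      rw [Finset.sum_congr rfl (g := fun ω' => l t ω' k),
        Finset.sum_eq_zero (s := {ω' | ω' ∉ atom (𝓕 s.castSucc) ω}), add_zero]
      · intro ω' hω'
        have := (Finset.mem_filter.1 hω').2
        simp [dotProduct, testStrategy, this]
      · intro ω' hω'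
        simp [dotProduct, testStrategy, hω', hr]
    · simp [testStrategy_of_ne hr]
  simp only [dotProduct_sub, Finset.sum_sub_distrib, h1]
  have h2 : ∀ t : Fin (T + 1), t.castSucc = s.castSucc.succ ↔ t = s.succ := fun t => by
    rw [Fin.succ_castSucc, Fin.castSucc_inj]
  have h3 : ∀ t : Fin (T + 1), t.succ = s.castSucc.succ ↔ t = s.castSucc := fun t => Fin.succ_inj
  simp only [h2, h3, Finset.sum_ite_eq', Finset.mem_univ, if_true]
  rw [sum_atom, sum_atom]
  ring

/-- An adapted process of prices that are compatible with the exchange rates, and that is a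
martingale with respect to the uniform distribution. Thus `c` is the density process, with respect
to that distribution, of a (not normalized) consistent pricing system. -/
structure IsPriceProcess (𝓕 : Filtration (Fin (T + 1)) m)
    (rate : Fin (T + 1) → Ω → Fin d → Fin d → ℝ) (c : Fin (T + 1) → Ω → Fin d → ℝ) : Prop where
  adapted : ∀ t, ConstOnAtoms (𝓕 t) (c t)
  compatible : ∀ t ω, c t ω ∈ compatible (rate t ω)
  martingale : ∀ (s : Fin T) ω k,
    av (𝓕 s.castSucc) (fun ω => c s.succ ω k) ω = c s.castSucc ω k

/-- Trading strategies with zero initial endowment, as a vector space. -/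
def freeStrategies (𝓕 : Filtration (Fin (T + 1)) m) (d : ℕ) :
    Submodule ℝ (Fin (T + 2) → Ω → Fin d → ℝ) where
  carrier := {y | y 0 = 0 ∧ y (Fin.last (T + 1)) = 0 ∧ ∀ t : Fin (T + 1),
    ConstOnAtoms (𝓕 t) (y t.succ)}
  add_mem' := by
    rintro a b ⟨h1, h2, h3⟩ ⟨h1', h2', h3'⟩
    refine ⟨by simp [h1, h1'], by simp [h2, h2'], fun t ω ω' h => ?_⟩
    simp only [Pi.add_apply, h3 t ω ω' h, h3' t ω ω' h]
  zero_mem' := ⟨rfl, rfl, fun t ω ω' h => rfl⟩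
  smul_mem' := by
    rintro c a ⟨h1, h2, h3⟩
    refine ⟨by simp [h1], by simp [h2], fun t ω ω' h => ?_⟩
    simp only [Pi.smul_apply, h3 t ω ω' h]

theorem testStrategy_mem (s : Fin T) (ω : Ω) (k : Fin d) :
    testStrategy 𝓕 s ω k ∈ freeStrategies 𝓕 d := by
  refine ⟨testStrategy_of_ne (Fin.succ_ne_zero _).symm, testStrategy_of_ne ?_,
    constOnAtoms_testStrategy s ω k⟩
  rw [← Fin.succ_last, Ne, Fin.succ_inj]
  exact (Fin.castSucc_lt_last s).ne'

/-- Averaging the values at each date turns arbitrary multipliers into adapted ones. -/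
theorem average_compatible (hr : IsExchangeRate 𝓕 rate) {l : Fin (T + 1) → Ω → Fin d → ℝ}
    (hl : ∀ t ω, l t ω ∈ compatible (rate t ω)) (t : Fin (T + 1)) (ω : Ω) :
    (fun k => av (𝓕 t) (fun ω => l t ω k) ω) ∈ compatible (rate t ω) :=
  av_mem_compatible (hr.constOnAtoms t) (hl t) ω

/-- Without arbitrage there is a price process that gives the claim to one unit of asset `j` in a
single state a positive price. -/
theorem exists_priceProcess_pos (hr : IsExchangeRate 𝓕 rate) (hna : NoArbitrage 𝓕 rate)
    (hT : 𝓕 (Fin.last T) = ⊤) (j : Fin d) (ω₀ : Ω) :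
    ∃ c, IsPriceProcess 𝓕 rate c ∧ 0 < c (Fin.last T) ω₀ j := by
  classical
  let D : freeStrategies 𝓕 d →ₗ[ℝ] Fin (T + 1) × Ω → Fin d → ℝ :=
    { toFun := fun y n => y.1 n.1.castSucc n.2 - y.1 n.1.succ n.2
      map_add' := fun y y' => by
        funext n k
        simp only [Submodule.coe_add, Pi.add_apply, Pi.sub_apply]
        ring
      map_smul' := fun c y => by
        funext n k
        simp only [Submodule.coe_smul, Pi.smul_apply, Pi.sub_apply, smul_eq_mul, RingHom.id_apply]
        ring }
  let x : Ω → Fin d → ℝ := Pi.single ω₀ (Pi.single j 1)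
  let f : Fin (T + 1) × Ω → Fin d → ℝ := fun n => if n.1 = Fin.last T then x n.2 else 0
  obtain ⟨l, hl, hl0, hlf⟩ := exists_prices_of_not_superhedge (fun n => rate n.1 n.2) D f (by
    rintro ⟨⟨y, hy0, hyT, hy⟩, h⟩
    have hyc := constOnAtoms_castSucc ⟨0, fun ω => by rw [hy0]; rfl⟩ hy
    refine hna ⟨y, ⟨⟨0, fun ω => by rw [hy0]; rfl⟩,
      fun t => measurable_iff_constOnAtoms.2 (hy t), hyT⟩, fun t ht => ?_, hy0, x, ?_, ?_, ?_, ?_⟩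
    · refine (mem_solvencyCone hr).2 ⟨measurable_iff_constOnAtoms.2 fun ω ω' hω => ?_,
        fun ω => ?_⟩
      · simp only [Pi.sub_apply, hyc t ω ω' hω, hy t ω ω' hω]
      · have := h (t, ω)
        simpa [D, f, ht.ne] using this
    · rw [hT]; exact measurable_from_top
    · intro h0
      simpa [x] using congr_fun (congr_fun h0 ω₀) j
    · intro ω k
      by_cases hω : ω = ω₀
      · subst hω
        by_cases hk : k = j
        · subst hk; simp [x]
        · simp [x, hk]
      · simp [x, hω]
    · refine (mem_solvencyCone hr).2 ⟨?_, fun ω => ?_⟩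
      · rw [hT]; exact measurable_from_top
      · have := h (Fin.last T, ω)
        simpa [D, f, hyT] using this)
  refine ⟨fun t ω k => av (𝓕 t) (fun ω => l (t, ω) k) ω, ⟨fun t ω ω' h => ?_,
    average_compatible (l := fun t ω => l (t, ω)) hr fun t ω => hl (t, ω), fun s ω k => ?_⟩, ?_⟩
  · funext k
    exact constOnAtoms_av _ _ ω ω' h
  · rw [av_av (𝓕.mono (Fin.castSucc_lt_succ (i := s)).le)]
    have h1 := hl0 ⟨_, testStrategy_mem s ω k⟩
    rw [Fintype.sum_prod_type] at h1
    have h2 := (sum_dotProduct_testStrategy (𝓕 := 𝓕) (fun t ω => l (t, ω)) s ω k).symm.trans h1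
    have h3 := card_atom_pos (𝓕 s.castSucc) ω
    have h4 := (mul_eq_zero.1 h2).resolve_left h3.ne'
    linarith
  · rw [Fintype.sum_prod_type] at hlf
    have h1 : ∀ t : Fin (T + 1), ∑ ω, l (t, ω) ⬝ᵥ f (t, ω) =
        if t = Fin.last T then l (Fin.last T, ω₀) j else 0 := by
      intro t
      split_ifs with ht
      · subst ht
        rw [Finset.sum_eq_single ω₀]
        · simp [f, x]
        · intro ω _ hω
          simp [f, x, hω]
        · simp
      · simp [f, ht]
    simp only [h1, Finset.sum_ite_eq', Finset.mem_univ, if_true] at hlf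
    simp only [hT, av, atom_top, Finset.sum_singleton, Finset.card_singleton, Nat.cast_one, div_one]
    exact hlf

theorem IsPriceProcess.add {c c' : Fin (T + 1) → Ω → Fin d → ℝ} (h : IsPriceProcess 𝓕 rate c)
    (h' : IsPriceProcess 𝓕 rate c') : IsPriceProcess 𝓕 rate (c + c') where
  adapted t ω ω' hω := by simp only [Pi.add_apply, h.adapted t ω ω' hω, h'.adapted t ω ω' hω]
  compatible t ω := compatible_add (h.compatible t ω) (h'.compatible t ω)
  martingale s ω k := by
    simp only [Pi.add_apply]
    rw [av_add, h.martingale, h'.martingale]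

theorem IsPriceProcess.smul {c : Fin (T + 1) → Ω → Fin d → ℝ} (h : IsPriceProcess 𝓕 rate c)
    {a : ℝ} (ha : 0 ≤ a) : IsPriceProcess 𝓕 rate (a • c) where
  adapted t ω ω' hω := by simp only [Pi.smul_apply, h.adapted t ω ω' hω]
  compatible t ω := compatible_smul ha (h.compatible t ω)
  martingale s ω k := by
    have := av_mul (m := 𝓕 s.castSucc) (f := fun ω => c s.succ ω k) (g := fun _ => a)
      (fun _ _ _ => rfl) ω
    simp only [Pi.smul_apply, smul_eq_mul]
    rw [mul_comm a, ← h.martingale, ← this]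
    exact av_congr fun _ _ => mul_comm _ _

theorem exists_priceProcess (hr : IsExchangeRate 𝓕 rate) (hna : NoArbitrage 𝓕 rate)
    (hT : 𝓕 (Fin.last T) = ⊤) (j : Fin d) :
    ∃ c, IsPriceProcess 𝓕 rate c ∧ ∀ ω, 1 ≤ c (Fin.last T) ω j := by
  classical
  suffices h : ∀ s : Finset Ω, ∃ c, IsPriceProcess 𝓕 rate c ∧ ∀ ω ∈ s, 1 ≤ c (Fin.last T) ω j by
    obtain ⟨c, h1, h2⟩ := h Finset.univ
    exact ⟨c, h1, fun ω => h2 ω (Finset.mem_univ ω)⟩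
  intro s
  induction s using Finset.induction_on with
  | empty =>
    refine ⟨0, ⟨fun _ _ _ _ => rfl, fun t ω => ⟨fun _ => le_rfl, fun _ _ => by simp⟩,
      fun s ω k => by simp [av]⟩, by simp⟩
  | insert a s ha ih =>
    obtain ⟨c, hc, hc'⟩ := ih
    obtain ⟨e, he, he'⟩ := exists_priceProcess_pos hr hna hT j a
    refine ⟨c + (e (Fin.last T) a j)⁻¹ • e, hc.add (he.smul (inv_nonneg.2 he'.le)), ?_⟩
    intro ω hω
    have h1 : 0 ≤ c (Fin.last T) ω j := (hc.compatible _ ω).1 j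
    have h2 : 0 ≤ (e (Fin.last T) a j)⁻¹ * e (Fin.last T) ω j :=
      mul_nonneg (inv_nonneg.2 he'.le) ((he.compatible _ ω).1 j)
    simp only [Pi.add_apply, Pi.smul_apply, smul_eq_mul]
    rcases Finset.mem_insert.1 hω with rfl | hω
    · rw [inv_mul_cancel₀ he'.ne'] at h2 ⊢
      linarith
    · linarith [hc' ω hω]

/-- A superhedging strategy of the seller against the pure stopping times: `z t` is the strategy
that is followed if the option is exercised at time `t`, and `z t`, `z t'` agree as long as the
option has not been exercised under either of them. -/
structure IsHedge (𝓕 : Filtration (Fin (T + 1)) m) (rate : Fin (T + 1) → Ω → Fin d → Fin d → ℝ)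
    (ξ : Fin (T + 1) → Ω → Fin d → ℝ) (v : Fin d → ℝ)
    (z : Fin (T + 1) → Fin (T + 2) → Ω → Fin d → ℝ) : Prop where
  start : ∀ t ω, z t 0 ω = v
  final : ∀ t, z t (Fin.last (T + 1)) = 0
  adapted : ∀ t (r : Fin (T + 1)), ConstOnAtoms (𝓕 r) (z t r.succ)
  agree : ∀ (t t' : Fin (T + 1)) (r : Fin (T + 2)), r ≤ t.castSucc → r ≤ t'.castSucc →
    z t r = z t' r
  solvent : ∀ (t r : Fin (T + 1)) ω,
    z t r.castSucc ω - (if t = r then ξ r ω else 0) - z t r.succ ω ∈ solvent (rate r ω)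

/-- The constraints dual to superhedging. `μ t r` is the multiplier of the budget constraint at
time `r` in the scenario of exercise at time `t`: a martingale after the exercise, whereas before
the exercise only the sum over all scenarios is one. -/
structure IsDualFeasible (𝓕 : Filtration (Fin (T + 1)) m)
    (rate : Fin (T + 1) → Ω → Fin d → Fin d → ℝ) (j : Fin d)
    (μ : Fin (T + 1) → Fin (T + 1) → Ω → Fin d → ℝ) : Prop where
  adapted : ∀ t r, ConstOnAtoms (𝓕 r) (μ t r)
  compatible : ∀ t r ω, μ t r ω ∈ compatible (rate r ω)
  stopped : ∀ (s : Fin T) (t : Fin (T + 1)), t ≤ s.castSucc → ∀ ω k,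
    av (𝓕 s.castSucc) (fun ω => μ t s.succ ω k) ω = μ t s.castSucc ω k
  running : ∀ (s : Fin T) ω k,
    ∑ t ∈ Finset.Ioi s.castSucc, av (𝓕 s.castSucc) (fun ω => μ t s.succ ω k) ω =
      ∑ t ∈ Finset.Ioi s.castSucc, μ t s.castSucc ω k
  total : ∑ t, ∑ ω, μ t 0 ω j = 1

/-- The objective of the dual problem. -/
def dualObjective (ξ : Fin (T + 1) → Ω → Fin d → ℝ)
    (μ : Fin (T + 1) → Fin (T + 1) → Ω → Fin d → ℝ) : ℝ :=
  ∑ t, ∑ ω, μ t t ω ⬝ᵥ ξ t ω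

/-- Families of strategies with zero endowment that do not anticipate the time of exercise. -/
def freeHedges (𝓕 : Filtration (Fin (T + 1)) m) (d : ℕ) :
    Submodule ℝ (Fin (T + 1) → Fin (T + 2) → Ω → Fin d → ℝ) where
  carrier := {z | (∀ t, z t ∈ freeStrategies 𝓕 d) ∧
    ∀ (t t' : Fin (T + 1)) (r : Fin (T + 2)), r ≤ t.castSucc → r ≤ t'.castSucc → z t r = z t' r}
  add_mem' := by
    rintro a b ⟨h1, h2⟩ ⟨h1', h2'⟩
    refine ⟨fun t => add_mem (h1 t) (h1' t), fun t t' r h h' => ?_⟩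
    simp only [Pi.add_apply, h2 t t' r h h', h2' t t' r h h']
  zero_mem' := ⟨fun t => zero_mem _, fun _ _ _ _ _ => rfl⟩
  smul_mem' := by
    rintro c a ⟨h1, h2⟩
    refine ⟨fun t => Submodule.smul_mem _ c (h1 t), fun t t' r h h' => ?_⟩
    simp only [Pi.smul_apply, h2 t t' r h h']

open Classical in
theorem test_mem_freeHedges (s : Fin T) (ω : Ω) (k : Fin d) (A : Finset (Fin (T + 1)))
    (hA : ∀ t t', s.castSucc < t → s.castSucc < t' → (t ∈ A ↔ t' ∈ A)) :
    (fun t => if t ∈ A then testStrategy 𝓕 s ω k else 0) ∈ freeHedges 𝓕 d := by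
  refine ⟨fun t => ?_, fun t t' r h h' => ?_⟩
  · dsimp only
    split_ifs
    exacts [testStrategy_mem s ω k, zero_mem _]
  · by_cases hr : r = s.castSucc.succ
    · subst hr
      have h1 : s.castSucc < t := by
        simpa [Fin.lt_def, Fin.le_def, Nat.succ_le_iff] using h
      have h2 : s.castSucc < t' := by
        simpa [Fin.lt_def, Fin.le_def, Nat.succ_le_iff] using h'
      simp only [hA t t' h1 h2]
    · dsimp only
      split_ifs <;> simp [testStrategy_of_ne hr]

/-- If the endowment `x` in asset `j` does not suffice for superhedging, then the dual problem has a
feasible point with a value above `x`. -/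
theorem exists_dual_of_not_hedge (hr : IsExchangeRate 𝓕 rate) {j : Fin d}
    {ξ : Fin (T + 1) → Ω → Fin d → ℝ} (hξ : ∀ t, ConstOnAtoms (𝓕 t) (ξ t)) {x : ℝ}
    (hx : ¬ ∃ z, IsHedge 𝓕 rate ξ (x • Pi.single j 1) z)
    (hfeas : ∃ x' z, IsHedge 𝓕 rate ξ ((x' : ℝ) • Pi.single j 1) z) :
    ∃ μ, IsDualFeasible 𝓕 rate j μ ∧ x < dualObjective ξ μ := by
  classical
  let D : freeHedges 𝓕 d →ₗ[ℝ] Fin (T + 1) × Fin (T + 1) × Ω → Fin d → ℝ :=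
    { toFun := fun z n => z.1 n.1 n.2.1.castSucc n.2.2 - z.1 n.1 n.2.1.succ n.2.2
      map_add' := fun y y' => by
        funext n k
        simp only [Submodule.coe_add, Pi.add_apply, Pi.sub_apply]
        ring
      map_smul' := fun c y => by
        funext n k
        simp only [Submodule.coe_smul, Pi.smul_apply, Pi.sub_apply, smul_eq_mul, RingHom.id_apply]
        ring }
  let v : ℝ → Fin d → ℝ := fun x => x • Pi.single j 1
  let f : ℝ → Fin (T + 1) × Fin (T + 1) × Ω → Fin d → ℝ := fun x n =>
    (if n.1 = n.2.1 then ξ n.2.1 n.2.2 else 0) - if n.2.1 = 0 then v x else 0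
  obtain ⟨l, hl, hl0, hlf⟩ :=
    exists_prices_of_not_superhedge (fun n => rate n.2.1 n.2.2) D (f x) (by
    rintro ⟨⟨w, hw, hw'⟩, h⟩
    refine hx ⟨fun t r ω => w t r ω + if r = 0 then v x else 0, ?_, ?_, ?_, ?_, ?_⟩
    · intro t ω
      simp [(hw t).1, v]
    · intro t
      funext ω
      simp [(hw t).2.1]
    · intro t r ω ω' hω
      simp [(hw t).2.2 r ω ω' hω]
    · intro t t' r h h'
      funext ω
      simp only [hw' t t' r h h']
    · intro t r ω
      convert h (t, r, ω) using 1
      simp only [D, f, LinearMap.coe_mk, AddHom.coe_mk, Fin.succ_ne_zero, if_false, add_zero,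
        Fin.castSucc_eq_zero_iff]
      abel)
  -- the price of one unit of asset `j` at time `0`
  set σ : ℝ := ∑ t, ∑ ω, l (t, 0, ω) j with hσ
  set Val : ℝ := ∑ t, ∑ ω, l (t, t, ω) ⬝ᵥ ξ t ω with hVal
  have hsum : ∀ x, ∑ n, l n ⬝ᵥ f x n = Val - x * σ := by
    intro x
    simp only [Fintype.sum_prod_type, f, dotProduct_sub, Finset.sum_sub_distrib]
    congr 1
    · rw [hVal]
      refine Finset.sum_congr rfl fun t _ => ?_
      rw [Finset.sum_eq_single t]
      · simp
      · intro r _ hr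
        simp [hr.symm]
      · simp
    · rw [hσ, Finset.mul_sum]
      refine Finset.sum_congr rfl fun t _ => ?_
      rw [Finset.sum_eq_single 0, Finset.mul_sum]
      · refine Finset.sum_congr rfl fun ω _ => ?_
        simp [v, mul_comm]
      · intro r _ hr
        simp [hr]
      · simp
  have hσ0 : 0 ≤ σ := Finset.sum_nonneg fun t _ => Finset.sum_nonneg fun ω _ => (hl _).1 j
  rw [hsum] at hlf
  have hσpos : 0 < σ := by
    refine lt_of_le_of_ne hσ0 fun h0 => ?_
    obtain ⟨x', z, hz⟩ := hfeas
    have hw : (fun t r ω => z t r ω - if r = 0 then v x' else 0) ∈ freeHedges 𝓕 d := by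
      refine ⟨fun t => ⟨?_, ?_, fun r ω ω' hω => ?_⟩, fun t t' r h h' => ?_⟩
      · funext ω
        simp [hz.start, v]
      · funext ω
        simp [hz.final]
      · simp [hz.adapted t r ω ω' hω]
      · funext ω
        simp only [hz.agree t t' r h h']
    have h1 : 0 ≤ ∑ n, l n ⬝ᵥ (D ⟨_, hw⟩ n - f x' n) := by
      refine Finset.sum_nonneg fun n _ => dotProduct_nonneg_of_compatible (hl n) ?_
      obtain ⟨t, r, ω⟩ := n
      convert hz.solvent t r ω using 1
      simp only [D, f, LinearMap.coe_mk, AddHom.coe_mk, Fin.succ_ne_zero, if_false, sub_zero,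
        Fin.castSucc_eq_zero_iff]
      abel
    simp only [dotProduct_sub, Finset.sum_sub_distrib] at h1
    rw [hl0, hsum, ← h0] at h1
    rw [← h0] at hlf
    linarith
  let μ₀ : Fin (T + 1) → Fin (T + 1) → Ω → Fin d → ℝ := fun t r ω k =>
    av (𝓕 r) (fun ω => l (t, r, ω) k) ω
  have hμ₀c : ∀ t r, ConstOnAtoms (𝓕 r) (μ₀ t r) := fun t r ω ω' h => by
    funext k
    exact constOnAtoms_av _ _ ω ω' h
  -- the martingale relations, summed over a set of scenarios that cannot be told apart
  have key : ∀ (s : Fin T) (A : Finset (Fin (T + 1))),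
      (∀ t t', s.castSucc < t → s.castSucc < t' → (t ∈ A ↔ t' ∈ A)) → ∀ ω k,
      ∑ t ∈ A, av (𝓕 s.castSucc) (fun ω => μ₀ t s.succ ω k) ω =
        ∑ t ∈ A, μ₀ t s.castSucc ω k := by
    intro s A hA ω k
    have h1 := hl0 ⟨_, test_mem_freeHedges s ω k A hA⟩
    simp only [Fintype.sum_prod_type] at h1
    have h2 : ∀ t, ∑ r, ∑ ω', l (t, r, ω') ⬝ᵥ
        D ⟨_, test_mem_freeHedges s ω k A hA⟩ (t, r, ω') =
        if t ∈ A then (atom (𝓕 s.castSucc) ω).card *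
          (av (𝓕 s.castSucc) (fun ω => l (t, s.succ, ω) k) ω -
            av (𝓕 s.castSucc) (fun ω => l (t, s.castSucc, ω) k) ω) else 0 := by
      intro t
      split_ifs with ht
      · rw [← sum_dotProduct_testStrategy (𝓕 := 𝓕) (fun r ω => l (t, r, ω)) s ω k]
        simp [D, ht]
      · simp [D, ht]
    simp only [h2] at h1
    rw [← Finset.sum_filter, Finset.filter_mem_eq_inter, Finset.univ_inter, ← Finset.mul_sum] at h1
    have h3 := card_atom_pos (𝓕 s.castSucc) ω
    have h4 := (mul_eq_zero.1 h1).resolve_left h3.ne'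
    rw [Finset.sum_sub_distrib, sub_eq_zero] at h4
    rw [← h4]
    exact Finset.sum_congr rfl fun t _ => av_av (𝓕.mono (Fin.castSucc_lt_succ (i := s)).le) _ _
  have hmul : ∀ (t r s : Fin (T + 1)) (ω : Ω) (k : Fin d),
      av (𝓕 s) (fun ω => (σ⁻¹ • μ₀) t r ω k) ω = σ⁻¹ * av (𝓕 s) (fun ω => μ₀ t r ω k) ω := by
    intro t r s ω k
    have := av_mul (m := 𝓕 s) (f := fun ω => μ₀ t r ω k) (g := fun _ => σ⁻¹) (fun _ _ _ => rfl) ω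
    rw [mul_comm, ← this]
    exact av_congr fun _ _ => mul_comm _ _
  refine ⟨σ⁻¹ • μ₀, ⟨fun t r ω ω' h => ?_, fun t r ω => ?_, fun s t hst ω k => ?_, fun s ω k => ?_,
    ?_⟩, ?_⟩
  · simp only [Pi.smul_apply, hμ₀c t r ω ω' h]
  · exact compatible_smul (inv_nonneg.2 hσ0)
      (average_compatible (l := fun r ω => l (t, r, ω)) hr (fun r ω => hl (t, r, ω)) r ω)
  · have := key s {t} (fun a b ha hb => by
      simp only [Finset.mem_singleton]
      exact ⟨fun h => absurd (h ▸ ha) hst.not_gt, fun h => absurd (h ▸ hb) hst.not_gt⟩) ω k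
    rw [Finset.sum_singleton, Finset.sum_singleton] at this
    rw [hmul, this]
    rfl
  · have := key s (Finset.Ioi s.castSucc) (fun a b ha hb => by simp [ha, hb]) ω k
    simp only [hmul, ← Finset.mul_sum, this]
    rw [Finset.mul_sum]
    rfl
  · have h1 : ∑ t, ∑ ω, (σ⁻¹ • μ₀) t 0 ω j = σ⁻¹ * σ := by
      rw [hσ, Finset.mul_sum]
      refine Finset.sum_congr rfl fun t _ => ?_
      rw [← sum_av (𝓕 0) (fun ω => l (t, 0, ω) j), Finset.mul_sum]
      exact Finset.sum_congr rfl fun ω _ => rfl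
    rw [h1, inv_mul_cancel₀ hσpos.ne']
  · have h1 : dualObjective ξ (σ⁻¹ • μ₀) = σ⁻¹ * Val := by
      rw [hVal, Finset.mul_sum]
      refine Finset.sum_congr rfl fun t _ => ?_
      rw [← sum_av (𝓕 t) (fun ω => l (t, t, ω) ⬝ᵥ ξ t ω), Finset.mul_sum]
      refine Finset.sum_congr rfl fun ω _ => ?_
      rw [av_dotProduct (u := fun ω => l (t, t, ω)) (hξ t)]
      exact smul_dotProduct σ⁻¹ (μ₀ t t ω) (ξ t ω)
    rw [h1, lt_inv_mul_iff₀ hσpos]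
    linarith

end Duality

/-! ### Deferred dual cones: elementary properties -/

section DeferredDual

variable {Ω : Type*} {m : MeasurableSpace Ω} {T d : ℕ}
  {𝓕 : Filtration (Fin (T + 1)) m} {rate : Fin (T + 1) → Ω → Fin d → Fin d → ℝ}

theorem deferredDualCone_add {t : Fin (T + 1)} {ω : Ω} {s s' : Fin d → ℝ}
    (hs : s ∈ deferredDualCone 𝓕 rate t ω) (hs' : s' ∈ deferredDualCone 𝓕 rate t ω) :
    s + s' ∈ deferredDualCone 𝓕 rate t ω := fun z hz => by
  rw [add_dotProduct]
  exact add_nonneg (hs z hz) (hs' z hz)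

theorem deferredDualCone_smul {t : Fin (T + 1)} {ω : Ω} {s : Fin d → ℝ} {c : ℝ} (hc : 0 ≤ c)
    (hs : s ∈ deferredDualCone 𝓕 rate t ω) : c • s ∈ deferredDualCone 𝓕 rate t ω := fun z hz => by
  rw [smul_dotProduct]
  exact mul_nonneg hc (hs z hz)

theorem deferredDualCone_zero {t : Fin (T + 1)} {ω : Ω} :
    (0 : Fin d → ℝ) ∈ deferredDualCone 𝓕 rate t ω := fun z _ => by simp

theorem isClosed_deferredDualCone (t : Fin (T + 1)) (ω : Ω) :
    IsClosed (deferredDualCone 𝓕 rate t ω) := by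
  have : deferredDualCone 𝓕 rate t ω =
      ⋂ z ∈ deferredSolvencyCone 𝓕 rate t, {s | 0 ≤ s ⬝ᵥ z ω} := by
    ext s
    simp [deferredDualCone]
  rw [this]
  refine isClosed_biInter fun z _ => isClosed_le continuous_const ?_
  simp only [dotProduct]
  fun_prop

end DeferredDual

/-! ### Deferred dual cones: the backward recursion -/

section DeferredCone

variable {Ω : Type*} [Fintype Ω] {m : MeasurableSpace Ω} {T d : ℕ}
  {𝓕 : Filtration (Fin (T + 1)) m} {rate : Fin (T + 1) → Ω → Fin d → Fin d → ℝ}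

theorem zero_mem_solvencyCone (hr : IsExchangeRate 𝓕 rate) (t : Fin (T + 1)) :
    (0 : Ω → Fin d → ℝ) ∈ solvencyCone 𝓕 rate t :=
  (mem_solvencyCone hr).2 ⟨measurable_const, fun _ => solvent_of_nonneg fun _ => le_rfl⟩

theorem solvencyCone_subset_deferred (hr : IsExchangeRate 𝓕 rate) {t : Fin (T + 1)}
    {z : Ω → Fin d → ℝ} (hz : z ∈ solvencyCone 𝓕 rate t) : z ∈ deferredSolvencyCone 𝓕 rate t := by
  refine ⟨hz.1, 0, fun s _ => measurable_const, by simpa using hz, fun s _ => ?_, rfl⟩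
  simpa using zero_mem_solvencyCone hr s

theorem deferredDualCone_congr {t : Fin (T + 1)} {ω ω' : Ω} (h : ω' ∈ atom (𝓕 t) ω) :
    deferredDualCone 𝓕 rate t ω' = deferredDualCone 𝓕 rate t ω := by
  ext s
  refine forall₂_congr fun z hz => ?_
  rw [measurable_iff_constOnAtoms.1 hz.1 ω ω' h]

theorem compatible_of_mem_deferredDualCone (hr : IsExchangeRate 𝓕 rate) {t : Fin (T + 1)} {ω : Ω}
    {s : Fin d → ℝ} (hs : s ∈ deferredDualCone 𝓕 rate t ω) : s ∈ compatible (rate t ω) := by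
  refine ⟨fun k => ?_, fun j k => ?_⟩
  · have := hs (fun _ => Pi.single k 1) (solvencyCone_subset_deferred hr ((mem_solvencyCone hr).2
      ⟨measurable_const, fun _ => solvent_of_nonneg fun i => by
        by_cases h : i = k
        · subst h; simp
        · simp [h]⟩))
    simpa using this
  · -- the portfolio that is exactly sufficient for buying one unit of asset `k`
    have := hs (fun ω => Pi.single j (rate t ω j k) - Pi.single k 1)
      (solvencyCone_subset_deferred hr ((mem_solvencyCone hr).2
        ⟨measurable_iff_constOnAtoms.2 fun ω ω' h => by rw [hr.constOnAtoms t ω ω' h],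
          fun ω => ⟨Pi.single j (Pi.single k 1), fun a b => ?_, fun i => ?_⟩⟩))
    · simpa [dotProduct_sub, mul_comm] using this
    · by_cases ha : a = j
      · subst ha
        by_cases hb : b = k
        · subst hb; simp
        · simp [hb]
      · simp [ha]
    · have e1 : ∀ a b, (Pi.single j (Pi.single k (1 : ℝ)) : Fin d → Fin d → ℝ) a b =
          if a = j then if b = k then 1 else 0 else 0 := by
        intro a b
        by_cases ha : a = j
        · subst ha
          by_cases hb : b = k
          · subst hb; simp
          · simp [hb]
        · simp [ha]
      have e2 : ∑ a, (Pi.single j (Pi.single k (1 : ℝ)) : Fin d → Fin d → ℝ) a i =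
          if i = k then 1 else 0 := by
        simp [e1]
      have e3 : ∑ b, (Pi.single j (Pi.single k (1 : ℝ)) : Fin d → Fin d → ℝ) i b * rate t ω i b =
          if i = j then rate t ω j k else 0 := by
        by_cases hi : i = j
        · subst hi; simp [e1]
        · simp [e1, hi]
      rw [e2, e3]
      simp [Pi.single_apply]

theorem mem_deferredDualCone_last (hr : IsExchangeRate 𝓕 rate) {ω : Ω} {s : Fin d → ℝ}
    (hs : s ∈ compatible (rate (Fin.last T) ω)) : s ∈ deferredDualCone 𝓕 rate (Fin.last T) ω := by
  rintro z ⟨-, y, -, h1, -, h2⟩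
  rw [Fin.succ_last, h2, sub_zero] at h1
  exact dotProduct_nonneg_of_compatible hs (((mem_solvencyCone hr).1 h1).2 ω)

/-- The dual of the recursion for the deferred solvency cones: a compatible price vector that is the
conditional average of prices from the next dual cones lies in the present dual cone. -/
theorem mem_deferredDualCone_castSucc (hr : IsExchangeRate 𝓕 rate) {s : Fin T}
    {u v : Ω → Fin d → ℝ} (hu : ∀ ω, u ω ∈ deferredDualCone 𝓕 rate s.succ ω)
    (hv : ∀ ω, v ω ∈ compatible (rate s.castSucc ω))
    (huv : ∀ ω k, av (𝓕 s.castSucc) (fun ω => u ω k) ω = v ω k) (ω : Ω) :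
    v ω ∈ deferredDualCone 𝓕 rate s.castSucc ω := by
  rintro z ⟨-, y, hy, h1, h2, h3⟩
  have hle : 𝓕 s.castSucc ≤ 𝓕 s.succ := 𝓕.mono (Fin.castSucc_lt_succ (i := s)).le
  -- what is held at the end of the period belongs to the next deferred solvency cone
  have hq : y s.castSucc.succ ∈ deferredSolvencyCone 𝓕 rate s.succ := by
    refine ⟨(hy _ le_rfl).mono hle le_rfl, y,
      fun r hsr => hy r (Fin.castSucc_lt_succ.le.trans hsr), ?_,
      fun r hsr => h2 r (Fin.castSucc_lt_succ.trans hsr), h3⟩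
    rw [Fin.succ_castSucc]
    exact h2 s.succ Fin.castSucc_lt_succ
  have h4 : 0 ≤ v ω ⬝ᵥ (z ω - y s.castSucc.succ ω) :=
    dotProduct_nonneg_of_compatible (hv ω) (((mem_solvencyCone hr).1 h1).2 ω)
  have h5 : 0 ≤ v ω ⬝ᵥ y s.castSucc.succ ω := by
    have : v ω = fun k => av (𝓕 s.castSucc) (fun ω => u ω k) ω := funext fun k => (huv ω k).symm
    rw [this, ← av_dotProduct (measurable_iff_constOnAtoms.1 (hy _ le_rfl))]
    exact av_nonneg fun ω' _ => hu ω' _ hq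
  rw [dotProduct_sub] at h4
  linarith

/-- Compatible prices that form a martingale from time `t` on are compatible with deferred
liquidation as well. -/
theorem mem_deferredDualCone_of_martingale (hr : IsExchangeRate 𝓕 rate) {t : Fin (T + 1)}
    {c : Fin (T + 1) → Ω → Fin d → ℝ} (hc : ∀ r ω, c r ω ∈ compatible (rate r ω))
    (hm : ∀ s : Fin T, t ≤ s.castSucc → ∀ ω k,
      av (𝓕 s.castSucc) (fun ω => c s.succ ω k) ω = c s.castSucc ω k)
    (r : Fin (T + 1)) (htr : t ≤ r) (ω : Ω) : c r ω ∈ deferredDualCone 𝓕 rate r ω := by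
  induction r using Fin.reverseInduction generalizing ω with
  | last => exact mem_deferredDualCone_last hr (hc _ ω)
  | cast s ih =>
    exact mem_deferredDualCone_castSucc hr
      (fun ω => ih (htr.trans (Fin.castSucc_lt_succ (i := s)).le) ω) (hc _) (hm s htr) ω

theorem Ioi_castSucc_eq (s : Fin T) : Finset.Ioi s.castSucc = Finset.Ici s.succ := by
  ext r
  simp [Fin.lt_def, Fin.le_def]

theorem sum_Ici {E : Type*} [AddCommMonoid E] (t : Fin (T + 1)) (f : Fin (T + 1) → E) :
    ∑ r ∈ Finset.Ici t, f r = f t + ∑ r ∈ Finset.Ioi t, f r := by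
  rw [← Finset.Ioi_insert, Finset.sum_insert (by simp)]

theorem Ioi_last : Finset.Ioi (Fin.last T) = ∅ := by
  ext r
  simpa using Fin.le_last r

variable {j : Fin d} {μ : Fin (T + 1) → Fin (T + 1) → Ω → Fin d → ℝ}

theorem IsDualFeasible.diagonal_mem (hr : IsExchangeRate 𝓕 rate) (h : IsDualFeasible 𝓕 rate j μ)
    (t : Fin (T + 1)) (ω : Ω) : μ t t ω ∈ deferredDualCone 𝓕 rate t ω :=
  mem_deferredDualCone_of_martingale hr (h.compatible t) (fun s hs => h.stopped s t hs) t le_rfl ω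

/-- The prices that are still to be paid lie in the deferred dual cones, too. -/
theorem IsDualFeasible.tail_mem (hr : IsExchangeRate 𝓕 rate) (h : IsDualFeasible 𝓕 rate j μ)
    (r : Fin (T + 1)) (ω : Ω) : ∑ t ∈ Finset.Ioi r, μ t r ω ∈ deferredDualCone 𝓕 rate r ω := by
  induction r using Fin.reverseInduction generalizing ω with
  | last =>
    rw [Ioi_last, Finset.sum_empty]
    exact deferredDualCone_zero
  | cast s ih =>
    refine mem_deferredDualCone_castSucc hr
      (u := fun ω => ∑ t ∈ Finset.Ioi s.castSucc, μ t s.succ ω)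
      (v := fun ω => ∑ t ∈ Finset.Ioi s.castSucc, μ t s.castSucc ω)
      (fun ω => ?_) (fun ω => compatible_sum _ fun t _ => h.compatible _ _ _) (fun ω k => ?_) ω
    · rw [Ioi_castSucc_eq, sum_Ici]
      exact deferredDualCone_add (h.diagonal_mem hr _ _) (ih ω)
    · simp only [Finset.sum_apply]
      rw [av_finset_sum, h.running]

end DeferredCone

/-! ### Pricing pairs: finite description, weak duality and compactness -/

section PricingPairs

variable {Ω : Type*} [Fintype Ω] {m : MeasurableSpace Ω} {T d : ℕ}
  {𝓕 : Filtration (Fin (T + 1)) m} {rate : Fin (T + 1) → Ω → Fin d → Fin d → ℝ}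

/-- The condition on the conditional expectation in the definition of pricing pairs is a finite
system of conditions, one for each atom. -/
theorem ae_condExp_mem_iff [DiscreteMeasurableSpace Ω] (Q : Measure Ω) [IsProbabilityMeasure Q]
    (t : Fin (T + 1)) (f : Ω → Fin d → ℝ) :
    (∀ᵐ ω ∂Q, (Q[f | 𝓕 t]) ω ∈ deferredDualCone 𝓕 rate t ω) ↔
      ∀ ω, ∑ ω' ∈ atom (𝓕 t) ω, Q.real {ω'} • f ω' ∈ deferredDualCone 𝓕 rate t ω := by
  have hf : Integrable f Q := .of_finite
  have hg : ConstOnAtoms (𝓕 t) (Q[f | 𝓕 t]) :=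
    measurable_iff_constOnAtoms.1 stronglyMeasurable_condExp.measurable
  have hsum : ∀ ω, ∑ ω' ∈ atom (𝓕 t) ω, Q.real {ω'} • f ω' =
      (∑ ω' ∈ atom (𝓕 t) ω, Q.real {ω'}) • (Q[f | 𝓕 t]) ω := by
    intro ω
    have h1 := setIntegral_condExp (𝓕.le t) hf (measurableSet_atom (𝓕 t) ω)
    rw [setIntegral_finset _ hf.integrableOn,
      setIntegral_finset _ integrable_condExp.integrableOn] at h1
    rw [← h1, Finset.sum_smul]
    exact Finset.sum_congr rfl fun ω' h => by rw [hg ω ω' h]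
  rw [ae_iff_of_countable]
  constructor
  · intro h ω
    by_cases h0 : ∀ ω' ∈ atom (𝓕 t) ω, Q.real {ω'} = 0
    · rw [Finset.sum_eq_zero fun ω' hω' => by rw [h0 ω' hω', zero_smul]]
      exact deferredDualCone_zero
    · push Not at h0
      obtain ⟨ω', hω', hQ⟩ := h0
      have := h ω' fun h0 => hQ (by simp [Measure.real, h0])
      rw [hg ω ω' hω', deferredDualCone_congr hω'] at this
      rw [hsum]
      exact deferredDualCone_smul (Finset.sum_nonneg fun _ _ => measureReal_nonneg) this
  · intro h ω hω
    have hpos : 0 < ∑ ω' ∈ atom (𝓕 t) ω, Q.real {ω'} :=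
      Finset.sum_pos' (fun _ _ => measureReal_nonneg) ⟨ω, self_mem_atom _ ω,
        ENNReal.toReal_pos hω (measure_ne_top _ _)⟩
    have h1 := h ω
    rw [hsum] at h1
    have := deferredDualCone_smul (inv_nonneg.2 hpos.le) h1
    rwa [smul_smul, inv_mul_cancel₀ hpos.ne', one_smul] at this

/-- The pairs of a probability vector `q` and a process `S` that correspond to the pricing pairs. -/
structure IsFinitePair (𝓕 : Filtration (Fin (T + 1)) m)
    (rate : Fin (T + 1) → Ω → Fin d → Fin d → ℝ) (j : Fin d) (χ : Fin (T + 1) → Ω → ℝ)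
    (q : Ω → ℝ) (S : Fin (T + 1) → Ω → Fin d → ℝ) : Prop where
  nonneg : ∀ ω, 0 ≤ q ω
  total : ∑ ω, q ω = 1
  adapted : ∀ t, ConstOnAtoms (𝓕 t) (S t)
  mem_dual : ∀ t ω, S t ω ∈ deferredDualCone 𝓕 rate t ω
  tail_mem : ∀ t ω, ∑ ω' ∈ atom (𝓕 t) ω, q ω' • ∑ s ∈ Finset.Ioi t, χ s ω' • S s ω' ∈
    deferredDualCone 𝓕 rate t ω
  numeraire : ∀ t ω, S t ω j = 1

/-- The expected payoff for a probability vector `q`. -/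
def pairValue (ξ : Fin (T + 1) → Ω → Fin d → ℝ) (χ : Fin (T + 1) → Ω → ℝ) (q : Ω → ℝ)
    (S : Fin (T + 1) → Ω → Fin d → ℝ) : ℝ :=
  ∑ ω, q ω * ∑ t, χ t ω * (ξ t ω ⬝ᵥ S t ω)

variable {j : Fin d} {χ : Fin (T + 1) → Ω → ℝ} {ξ : Fin (T + 1) → Ω → Fin d → ℝ}

theorem isFinitePair_of_mem [DiscreteMeasurableSpace Ω]
    {p : Measure Ω × (Fin (T + 1) → Ω → Fin d → ℝ)}
    (hp : p ∈ pricingPairs 𝓕 rate j χ) :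
    IsFinitePair 𝓕 rate j χ (fun ω => p.1.real {ω}) p.2 := by
  obtain ⟨h1, h2, h3, h4, h5⟩ := hp
  refine ⟨fun _ => measureReal_nonneg, ?_, fun t => measurable_iff_constOnAtoms.1 (h2 t),
    fun t ω => (h3 t ω).1, fun t => (ae_condExp_mem_iff p.1 t _).1 (h4 t), h5⟩
  simp

theorem dualValue_eq [DiscreteMeasurableSpace Ω]
    {p : Measure Ω × (Fin (T + 1) → Ω → Fin d → ℝ)} [IsFiniteMeasure p.1] :
    dualValue ξ χ p = pairValue ξ χ (fun ω => p.1.real {ω}) p.2 := by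
  rw [dualValue, integral_fintype .of_finite]
  rfl

/-- The measure with point masses `q`. -/
noncomputable def measureOf (m : MeasurableSpace Ω) (q : Ω → ℝ) : Measure Ω :=
  ∑ ω, ENNReal.ofReal (q ω) • @Measure.dirac Ω m ω

theorem measureOf_singleton [DiscreteMeasurableSpace Ω] {q : Ω → ℝ} (ω : Ω) :
    measureOf m q {ω} = ENNReal.ofReal (q ω) := by
  classical
  simp only [measureOf, Measure.finsetSum_apply, Measure.smul_apply, smul_eq_mul,
    Measure.dirac_apply, Set.indicator_apply, Set.mem_singleton_iff, Pi.one_apply, mul_ite, mul_one,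
    mul_zero, Finset.sum_ite_eq', Finset.mem_univ, if_true]

theorem IsFinitePair.mem_pricingPairs [DiscreteMeasurableSpace Ω] {q : Ω → ℝ}
    {S : Fin (T + 1) → Ω → Fin d → ℝ}
    (h : IsFinitePair 𝓕 rate j χ q S) :
    (measureOf m q, S) ∈ pricingPairs 𝓕 rate j χ ∧ ∀ ω, (measureOf m q).real {ω} = q ω := by
  have hq : ∀ ω, (measureOf m q).real {ω} = q ω := fun ω => by
    rw [Measure.real, measureOf_singleton, ENNReal.toReal_ofReal (h.nonneg ω)]
  have hprob : IsProbabilityMeasure (measureOf m q) := by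
    refine ⟨?_⟩
    simp only [measureOf, Measure.finsetSum_apply, Measure.smul_apply, smul_eq_mul, measure_univ,
      mul_one]
    rw [← ENNReal.ofReal_sum_of_nonneg fun ω _ => h.nonneg ω, h.total, ENNReal.ofReal_one]
  refine ⟨⟨hprob, fun t => measurable_iff_constOnAtoms.2 (h.adapted t), fun t ω =>
    ⟨h.mem_dual t ω, fun h0 => ?_⟩, fun t => (ae_condExp_mem_iff _ t _).2 fun ω => ?_,
    h.numeraire⟩, hq⟩
  · have := h.numeraire t ω
    rw [show S t ω = 0 from h0] at this
    simp at this
  · simp only [hq]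
    exact h.tail_mem t ω

/-- Weak duality: the expected payoff under a pricing pair is at most the cost of any superhedging
strategy. -/
theorem IsFinitePair.pairValue_le (hr : IsExchangeRate 𝓕 rate) {q : Ω → ℝ}
    {S : Fin (T + 1) → Ω → Fin d → ℝ} (h : IsFinitePair 𝓕 rate j χ q S)
    (hχ : χ ∈ mixedStoppingTimes 𝓕) (hξ : ∀ t, ConstOnAtoms (𝓕 t) (ξ t)) {x : ℝ}
    {z : Fin (T + 1) → Fin (T + 2) → Ω → Fin d → ℝ}
    (hz : IsHedge 𝓕 rate ξ (x • Pi.single j 1) z) : pairValue ξ χ q S ≤ x := by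
  set y : Fin (T + 2) → Ω → Fin d → ℝ := z (Fin.last T) with hy
  have hzc : ∀ t r, ConstOnAtoms (𝓕 r) (z t r.castSucc) := fun t =>
    constOnAtoms_castSucc ⟨_, hz.start t⟩ (hz.adapted t)
  have hzy : ∀ t : Fin (T + 1), z t t.castSucc = y t.castSucc := fun t =>
    hz.agree t (Fin.last T) _ le_rfl (Fin.castSucc_le_castSucc_iff.2 (Fin.le_last t))
  -- after exercise the remainder is liquidated
  have h1 : ∀ t ω, S t ω ⬝ᵥ ξ t ω ≤ S t ω ⬝ᵥ y t.castSucc ω := by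
    intro t ω
    have hq : (fun ω => y t.castSucc ω - ξ t ω) ∈ deferredSolvencyCone 𝓕 rate t := by
      refine ⟨measurable_iff_constOnAtoms.2 fun ω ω' hω => ?_, z t,
        fun s _ => measurable_iff_constOnAtoms.2 (hz.adapted t s), ?_, fun s hs => ?_, hz.final t⟩
      · simp only [hξ t ω ω' hω, hzc _ t ω ω' hω, hy]
      · refine (mem_solvencyCone hr).2 ⟨measurable_iff_constOnAtoms.2 fun ω ω' hω => ?_,
          fun ω => ?_⟩
        · simp only [Pi.sub_apply, hξ t ω ω' hω, hzc _ t ω ω' hω, hz.adapted t t ω ω' hω, hy]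
        · have := hz.solvent t t ω
          rw [hzy, if_pos rfl] at this
          exact this
      · refine (mem_solvencyCone hr).2 ⟨measurable_iff_constOnAtoms.2 fun ω ω' hω => ?_,
          fun ω => ?_⟩
        · simp only [Pi.sub_apply, hzc _ s ω ω' hω, hz.adapted t s ω ω' hω]
        · have := hz.solvent t s ω
          rw [if_neg hs.ne, sub_zero] at this
          exact this
    have := h.mem_dual t ω _ hq
    rw [dotProduct_sub] at this
    linarith
  -- before exercise the strategy is self-financing
  have h2 : ∀ s : Fin T, 0 ≤ ∑ ω, (q ω • ∑ r ∈ Finset.Ioi s.castSucc, χ r ω • S r ω) ⬝ᵥ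
      (y s.castSucc.castSucc ω - y s.castSucc.succ ω) := by
    intro s
    have hc : ConstOnAtoms (𝓕 s.castSucc)
        (fun ω => y s.castSucc.castSucc ω - y s.castSucc.succ ω) := fun ω ω' hω => by
      simp only [hy, hzc _ _ ω ω' hω, hz.adapted _ _ ω ω' hω]
    have hK : (fun ω => y s.castSucc.castSucc ω - y s.castSucc.succ ω) ∈
        deferredSolvencyCone 𝓕 rate s.castSucc := by
      refine solvencyCone_subset_deferred hr ((mem_solvencyCone hr).2
        ⟨measurable_iff_constOnAtoms.2 hc, fun ω => ?_⟩)
      have := hz.solvent (Fin.last T) s.castSucc ω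
      rwa [if_neg (Fin.castSucc_lt_last s).ne', sub_zero] at this
    rw [← sum_av (𝓕 s.castSucc)]
    refine Finset.sum_nonneg fun ω _ => ?_
    rw [av_dotProduct hc]
    have h3 := deferredDualCone_smul (inv_nonneg.2 (card_atom_pos (𝓕 s.castSucc) ω).le)
      (h.tail_mem s.castSucc ω) _ hK
    have h4 : (fun k => av (𝓕 s.castSucc)
        (fun ω => (q ω • ∑ r ∈ Finset.Ioi s.castSucc, χ r ω • S r ω) k) ω) =
        ((atom (𝓕 s.castSucc) ω).card : ℝ)⁻¹ • ∑ ω' ∈ atom (𝓕 s.castSucc) ω,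
          q ω' • ∑ r ∈ Finset.Ioi s.castSucc, χ r ω' • S r ω' := by
      funext k
      simp only [av, Pi.smul_apply, Finset.sum_apply, smul_eq_mul]
      rw [inv_mul_eq_div]
    rw [h4]
    exact h3
  have h3 : ∀ t : Fin (T + 1),
      ∑ ω, q ω * ∑ r ∈ Finset.Ici t, χ r ω * (S r ω ⬝ᵥ y r.castSucc ω) ≤
      ∑ ω, q ω * ((∑ r ∈ Finset.Ici t, χ r ω • S r ω) ⬝ᵥ y t.castSucc ω) := by
    intro t
    induction t using Fin.reverseInduction with
    | last =>
      refine le_of_eq (Finset.sum_congr rfl fun ω _ => ?_)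
      rw [sum_Ici, sum_Ici, Ioi_last, Finset.sum_empty, Finset.sum_empty, add_zero, add_zero,
        smul_dotProduct, smul_eq_mul]
    | cast s ih =>
      have h4 := h2 s
      simp only [dotProduct_sub, Finset.sum_sub_distrib, smul_dotProduct, smul_eq_mul] at h4
      rw [← Fin.succ_castSucc, ← Ioi_castSucc_eq] at ih
      simp only [sum_Ici, add_dotProduct, mul_add, Finset.sum_add_distrib, smul_dotProduct,
        smul_eq_mul]
      linarith
  have huniv : Finset.Ici (0 : Fin (T + 1)) = Finset.univ := by
    ext r
    simp
  calc pairValue ξ χ q S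
      ≤ ∑ ω, q ω * ∑ r ∈ Finset.Ici 0, χ r ω * (S r ω ⬝ᵥ y r.castSucc ω) := by
        rw [pairValue, huniv]
        refine Finset.sum_le_sum fun ω _ => mul_le_mul_of_nonneg_left
          (Finset.sum_le_sum fun t _ => mul_le_mul_of_nonneg_left ?_ (hχ.2.1 t ω).1) (h.nonneg ω)
        rw [dotProduct_comm]
        exact h1 t ω
    _ ≤ _ := h3 0
    _ = x := by
      have h5 : ∀ ω, (∑ r ∈ Finset.Ici 0, χ r ω • S r ω) ⬝ᵥ y (Fin.castSucc 0) ω = x := by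
        intro ω
        rw [huniv, Fin.castSucc_zero, hy, hz.start, dotProduct_smul, dotProduct_single,
          Finset.sum_apply]
        simp only [Pi.smul_apply, h.numeraire, smul_eq_mul, mul_one]
        rw [hχ.2.2 ω, mul_one]
      simp only [h5, ← Finset.sum_mul, h.total, one_mul]

/-- The set of pricing pairs is compact, hence the expected payoff attains its maximum there. -/
theorem exists_isMax_pairValue (hr : IsExchangeRate 𝓕 rate)
    (hne : ∃ q S, IsFinitePair 𝓕 rate j χ q S) :
    ∃ q S, IsFinitePair 𝓕 rate j χ q S ∧
      ∀ q' S', IsFinitePair 𝓕 rate j χ q' S' → pairValue ξ χ q' S' ≤ pairValue ξ χ q S := by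
  let C : Set ((Ω → ℝ) × (Fin (T + 1) → Ω → Fin d → ℝ)) := {p | IsFinitePair 𝓕 rate j χ p.1 p.2}
  have hclosed : IsClosed C := by
    have : C = {p | ∀ ω, 0 ≤ p.1 ω} ∩ {p | ∑ ω, p.1 ω = 1} ∩
        {p | ∀ t ω ω', ω' ∈ atom (𝓕 t) ω → p.2 t ω' = p.2 t ω} ∩
        {p | ∀ t ω, p.2 t ω ∈ deferredDualCone 𝓕 rate t ω} ∩
        {p | ∀ t ω, ∑ ω' ∈ atom (𝓕 t) ω, p.1 ω' • ∑ s ∈ Finset.Ioi t, χ s ω' • p.2 s ω' ∈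
          deferredDualCone 𝓕 rate t ω} ∩ {p | ∀ t ω, p.2 t ω j = 1} := by
      ext p
      exact ⟨fun h => ⟨⟨⟨⟨⟨h.nonneg, h.total⟩, h.adapted⟩, h.mem_dual⟩, h.tail_mem⟩, h.numeraire⟩,
        fun ⟨⟨⟨⟨⟨a, b⟩, c⟩, e⟩, f⟩, g⟩ => ⟨a, b, c, e, f, g⟩⟩
    rw [this]
    simp only [Set.ofPred_forall]
    refine ((((IsClosed.inter ?_ ?_).inter ?_).inter ?_).inter ?_).inter ?_
    · exact isClosed_iInter fun ω => isClosed_le continuous_const (by fun_prop)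
    · exact isClosed_eq (by fun_prop) continuous_const
    · exact isClosed_iInter fun t => isClosed_iInter fun ω => isClosed_iInter fun ω' =>
        isClosed_iInter fun _ => isClosed_eq (by fun_prop) (by fun_prop)
    · exact isClosed_iInter fun t => isClosed_iInter fun ω =>
        (isClosed_deferredDualCone t ω).preimage (by fun_prop)
    · exact isClosed_iInter fun t => isClosed_iInter fun ω =>
        (isClosed_deferredDualCone t ω).preimage (by fun_prop)
    · exact isClosed_iInter fun t => isClosed_iInter fun ω =>
        isClosed_eq (by fun_prop) continuous_const
  have hcompact : IsCompact C := by
    refine IsCompact.of_isClosed_subset (isCompact_Icc (a := (0 : (Ω → ℝ) ×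
      (Fin (T + 1) → Ω → Fin d → ℝ))) (b := (1, fun t ω k => rate t ω j k))) hclosed ?_
    rintro ⟨q, S⟩ h
    have hS : ∀ t ω, S t ω ∈ compatible (rate t ω) := fun t ω =>
      compatible_of_mem_deferredDualCone hr (h.mem_dual t ω)
    refine ⟨⟨h.nonneg, fun t ω k => (hS t ω).1 k⟩, fun ω => ?_, fun t ω k => ?_⟩
    · change q ω ≤ 1
      rw [← h.total]
      exact Finset.single_le_sum (fun ω _ => h.nonneg ω) (Finset.mem_univ ω)
    · have h1 := (hS t ω).2 j k
      have h2 : S t ω j = 1 := h.numeraire t ω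
      rw [h2, mul_one] at h1
      exact h1
  obtain ⟨q, S, hqS⟩ := hne
  obtain ⟨p, hp, hmax⟩ := hcompact.exists_isMaxOn ⟨(q, S), hqS⟩
    (f := fun p => pairValue ξ χ p.1 p.2) (by
      simp only [pairValue, dotProduct]
      fun_prop)
  exact ⟨p.1, p.2, hp, fun q' S' h' => hmax (a := (q', S')) h'⟩

end PricingPairs

/-! ### The mixed stopping time and the pricing pair of a dual solution -/

section MassProcesses

variable {Ω : Type*} {T d : ℕ}
variable (j : Fin d) (μ : Fin (T + 1) → Fin (T + 1) → Ω → Fin d → ℝ)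
  (c : Fin (T + 1) → Ω → Fin d → ℝ)

/-- The mass, in units of asset `j`, that a dual solution assigns to exercise after time `r`. -/
def tailMass (r : Fin (T + 1)) (ω : Ω) : ℝ := ∑ t ∈ Finset.Ioi r, μ t r ω j

/-- The mass, in units of asset `j`, that a dual solution assigns to exercise at or after time
`r`. -/
def liveMass (r : Fin (T + 1)) (ω : Ω) : ℝ := ∑ t ∈ Finset.Ici r, μ t r ω j

/-- The density process (with respect to the uniform distribution) of the measure `ℚ` constructed
from a dual solution `μ`. Transition probabilities are proportional to the live mass, and are taken
from the price process `c` where no mass is left. -/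
noncomputable def density : Fin (T + 1) → Ω → ℝ :=
  Fin.induction (fun ω => ∑ t, μ t 0 ω j) fun s q ω =>
    if tailMass j μ s.castSucc ω ≤ 0 then q ω * c s.succ ω j / c s.castSucc ω j
    else q ω * liveMass j μ s.succ ω / tailMass j μ s.castSucc ω

/-- The part of the option that has not been exercised before time `r`. -/
noncomputable def unexercised : Fin (T + 2) → Ω → ℝ :=
  Fin.induction (fun _ => 1) fun r u ω => u ω * (tailMass j μ r ω / liveMass j μ r ω)

/-- The mixed stopping time constructed from a dual solution. -/
noncomputable def stopping (r : Fin (T + 1)) (ω : Ω) : ℝ :=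
  unexercised j μ r.castSucc ω - unexercised j μ r.succ ω

/-- The price process constructed from a dual solution. -/
noncomputable def prices (r : Fin (T + 1)) (ω : Ω) (k : Fin d) : ℝ :=
  if μ r r ω j ≤ 0 then c r ω k / c r ω j else μ r r ω k / μ r r ω j

variable {μ c}

theorem density_succ (s : Fin T) (ω : Ω) : density j μ c s.succ ω =
    if tailMass j μ s.castSucc ω ≤ 0 then density j μ c s.castSucc ω * c s.succ ω j /
      c s.castSucc ω j
    else density j μ c s.castSucc ω * liveMass j μ s.succ ω / tailMass j μ s.castSucc ω := rfl

theorem unexercised_succ (r : Fin (T + 1)) (ω : Ω) : unexercised j μ r.succ ω =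
    unexercised j μ r.castSucc ω * (tailMass j μ r ω / liveMass j μ r ω) := rfl

theorem liveMass_eq (r : Fin (T + 1)) (ω : Ω) :
    liveMass j μ r ω = μ r r ω j + tailMass j μ r ω := sum_Ici r _

theorem sum_stopping (ω : Ω) : ∑ r, stopping j μ r ω = 1 := by
  have h1 : ∀ (n : ℕ) (f : Fin (n + 1) → ℝ),
      ∑ r : Fin n, (f r.castSucc - f r.succ) = f 0 - f (Fin.last n) := by
    intro n
    induction n with
    | zero => intro f; simp
    | succ n ih =>
      intro f
      rw [Fin.sum_univ_castSucc]
      have := ih (fun r => f r.castSucc)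
      simp only [Fin.succ_castSucc, Fin.castSucc_zero, Fin.succ_last] at this ⊢
      rw [this]
      ring
  have h2 : unexercised j μ (Fin.last (T + 1)) ω = 0 := by
    rw [← Fin.succ_last, unexercised_succ, tailMass, Ioi_last, Finset.sum_empty, zero_div, mul_zero]
  have h3 : unexercised j μ 0 ω = 1 := rfl
  simp only [stopping]
  rw [h1 (T + 1) (fun r => unexercised j μ r ω), h2, h3, sub_zero]

end MassProcesses

/-! ### Correctness of the construction -/

section Construction

variable {Ω : Type*} [Fintype Ω] {m : MeasurableSpace Ω} {T d : ℕ}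
  {𝓕 : Filtration (Fin (T + 1)) m} {rate : Fin (T + 1) → Ω → Fin d → Fin d → ℝ}
  {j : Fin d} {χ : Fin (T + 1) → Ω → ℝ} {ξ : Fin (T + 1) → Ω → Fin d → ℝ}

theorem av_last_of_martingale {q : Fin (T + 1) → Ω → ℝ} (hq : ∀ t, ConstOnAtoms (𝓕 t) (q t))
    (hm : ∀ (s : Fin T) ω, av (𝓕 s.castSucc) (q s.succ) ω = q s.castSucc ω) (t : Fin (T + 1))
    (ω : Ω) : av (𝓕 t) (q (Fin.last T)) ω = q t ω := by
  induction t using Fin.reverseInduction generalizing ω with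
  | last => exact av_of_constOnAtoms (hq _) ω
  | cast s ih =>
    rw [← hm, ← av_av (𝓕.mono (Fin.castSucc_lt_succ (i := s)).le)]
    exact av_congr fun ω' _ => ih ω'

/-- A density process `q` (with respect to the uniform distribution) and a price process `S` define
a pricing pair as soon as the conditional averages of `q χ S` are as required. -/
theorem isFinitePair_of_density {q : Fin (T + 1) → Ω → ℝ} {S : Fin (T + 1) → Ω → Fin d → ℝ}
    (hq0 : ∀ t ω, 0 ≤ q t ω) (hq : ∀ t, ConstOnAtoms (𝓕 t) (q t))
    (hm : ∀ (s : Fin T) ω, av (𝓕 s.castSucc) (q s.succ) ω = q s.castSucc ω)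
    (htot : ∑ ω, q 0 ω = 1) (hχ : ∀ t, ConstOnAtoms (𝓕 t) (χ t))
    (hS : ∀ t, ConstOnAtoms (𝓕 t) (S t)) (hSd : ∀ t ω, S t ω ∈ deferredDualCone 𝓕 rate t ω)
    (hSj : ∀ t ω, S t ω j = 1)
    (htail : ∀ t ω, (fun k => ∑ s ∈ Finset.Ioi t,
      av (𝓕 t) (fun ω => q s ω * χ s ω * S s ω k) ω) ∈ deferredDualCone 𝓕 rate t ω) :
    IsFinitePair 𝓕 rate j χ (q (Fin.last T)) S := by
  refine ⟨hq0 _, ?_, hS, hSd, fun t ω => ?_, hSj⟩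
  · rw [← sum_av (𝓕 0), ← htot]
    exact Finset.sum_congr rfl fun ω _ => av_last_of_martingale hq hm 0 ω
  · convert deferredDualCone_smul (card_atom_pos (𝓕 t) ω).le (htail t ω) using 1
    funext k
    simp only [Finset.sum_apply, Pi.smul_apply, smul_eq_mul, Finset.mul_sum]
    rw [Finset.sum_comm]
    refine Finset.sum_congr rfl fun s hs => ?_
    rw [sum_atom]
    congr 1
    rw [← av_av (𝓕.mono (Finset.mem_Ioi.1 hs).le)]
    refine av_congr fun ω' _ => ?_
    rw [av_mul (g := fun ω => χ s ω * S s ω k) (fun ω ω' h => by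
        simp only [hχ s ω ω' h, hS s ω ω' h]),
      av_last_of_martingale hq hm, mul_assoc]

theorem pairValue_of_density {q : Fin (T + 1) → Ω → ℝ} {S : Fin (T + 1) → Ω → Fin d → ℝ}
    (hq : ∀ t, ConstOnAtoms (𝓕 t) (q t))
    (hm : ∀ (s : Fin T) ω, av (𝓕 s.castSucc) (q s.succ) ω = q s.castSucc ω)
    (hχ : ∀ t, ConstOnAtoms (𝓕 t) (χ t)) (hS : ∀ t, ConstOnAtoms (𝓕 t) (S t))
    (hξ : ∀ t, ConstOnAtoms (𝓕 t) (ξ t)) :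
    pairValue ξ χ (q (Fin.last T)) S =
      ∑ t, ∑ ω, ((q t ω * χ t ω) • S t ω) ⬝ᵥ ξ t ω := by
  simp only [pairValue, Finset.mul_sum]
  rw [Finset.sum_comm]
  refine Finset.sum_congr rfl fun t _ => ?_
  rw [← sum_av (𝓕 t)]
  refine Finset.sum_congr rfl fun ω _ => ?_
  rw [av_mul (g := fun ω => χ t ω * (ξ t ω ⬝ᵥ S t ω))
    (fun ω ω' h => by simp only [hχ t ω ω' h, hS t ω ω' h, hξ t ω ω' h]),
    av_last_of_martingale hq hm, smul_dotProduct, smul_eq_mul, dotProduct_comm, mul_assoc]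

theorem IsPriceProcess.adapted_apply {c : Fin (T + 1) → Ω → Fin d → ℝ}
    (hc : IsPriceProcess 𝓕 rate c) (t : Fin (T + 1)) (k : Fin d) :
    ConstOnAtoms (𝓕 t) fun ω => c t ω k := fun ω ω' h => by simp only [hc.adapted t ω ω' h]

theorem IsPriceProcess.pos {c : Fin (T + 1) → Ω → Fin d → ℝ} (hc : IsPriceProcess 𝓕 rate c)
    (hcj : ∀ ω, 1 ≤ c (Fin.last T) ω j) (t : Fin (T + 1)) (ω : Ω) : 0 < c t ω j := by
  have h1 := av_last_of_martingale (𝓕 := 𝓕) (q := fun t ω => c t ω j)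
    (fun t => hc.adapted_apply t _) (fun s ω => hc.martingale s ω j) t ω
  rw [← h1, av]
  exact div_pos (Finset.sum_pos (fun ω' _ => lt_of_lt_of_le one_pos (hcj ω'))
    ⟨ω, self_mem_atom _ ω⟩) (card_atom_pos _ _)

theorem IsPriceProcess.mem_dual (hr : IsExchangeRate 𝓕 rate) {c : Fin (T + 1) → Ω → Fin d → ℝ}
    (hc : IsPriceProcess 𝓕 rate c) (t : Fin (T + 1)) (ω : Ω) :
    c t ω ∈ deferredDualCone 𝓕 rate t ω :=
  mem_deferredDualCone_of_martingale hr hc.compatible (fun s _ => hc.martingale s) t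
    (Fin.zero_le t) ω

/-- The consistent pricing system with density process `c` is a pricing pair for every mixed
stopping time, because the probability of exercise after time `t` is known at time `t`. -/
theorem exists_isFinitePair [Nonempty Ω] (hr : IsExchangeRate 𝓕 rate)
    {c : Fin (T + 1) → Ω → Fin d → ℝ} (hc : IsPriceProcess 𝓕 rate c)
    (hcj : ∀ ω, 1 ≤ c (Fin.last T) ω j) (hχ : χ ∈ mixedStoppingTimes 𝓕) :
    ∃ q S, IsFinitePair 𝓕 rate j χ q S := by
  have hpos := hc.pos hcj
  set N : ℝ := ∑ ω, c 0 ω j with hN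
  have hNpos : 0 < N := Finset.sum_pos (fun ω _ => hpos 0 ω) Finset.univ_nonempty
  have hχc : ∀ t, ConstOnAtoms (𝓕 t) (χ t) := fun t => measurable_iff_constOnAtoms.1 (hχ.1 t)
  refine ⟨_, _, isFinitePair_of_density (q := fun t ω => c t ω j * N⁻¹)
    (S := fun t ω => (c t ω j)⁻¹ • c t ω) (fun t ω => by have := hpos t ω; positivity)
    (fun t ω ω' h => by simp only [hc.adapted t ω ω' h])
    (fun s ω => ?_) ?_ hχc (fun t ω ω' h => by simp only [hc.adapted t ω ω' h])
    (fun t ω => deferredDualCone_smul (inv_nonneg.2 (hpos t ω).le) (hc.mem_dual hr t ω))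
    (fun t ω => inv_mul_cancel₀ (hpos t ω).ne') (fun t ω => ?_)⟩
  · rw [av_mul (fun _ _ _ => rfl), hc.martingale]
  · rw [← Finset.sum_mul, ← hN, mul_inv_cancel₀ hNpos.ne']
  · have htail : ∀ k, ∑ s ∈ Finset.Ioi t,
        av (𝓕 t) (fun ω => c s ω j * N⁻¹ * χ s ω * ((c s ω j)⁻¹ • c s ω) k) ω =
        (N⁻¹ * (1 - ∑ s ∈ Finset.Iic t, χ s ω)) * c t ω k := by
      intro k
      have h1 : ∀ s ∈ Finset.Ioi t,
          av (𝓕 t) (fun ω => c s ω j * N⁻¹ * χ s ω * ((c s ω j)⁻¹ • c s ω) k) ω =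
          av (𝓕 t) (fun ω => c (Fin.last T) ω k * (N⁻¹ * χ s ω)) ω := by
        intro s hs
        rw [← av_av (𝓕.mono (Finset.mem_Ioi.1 hs).le)
          (fun ω => c (Fin.last T) ω k * (N⁻¹ * χ s ω))]
        refine av_congr fun ω' _ => ?_
        rw [av_mul (g := fun ω => N⁻¹ * χ s ω) (fun ω ω' h => by simp only [hχc s ω ω' h]),
          av_last_of_martingale (q := fun t ω => c t ω k)
            (fun t => hc.adapted_apply t _) (fun s ω => hc.martingale s ω k)]
        have := (hpos s ω').ne'
        simp only [Pi.smul_apply, smul_eq_mul]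
        field_simp
      rw [Finset.sum_congr rfl h1, ← av_finset_sum]
      have h2 : ∀ ω, ∑ s ∈ Finset.Ioi t, χ s ω = 1 - ∑ s ∈ Finset.Iic t, χ s ω := by
        intro ω
        have h3 : Finset.Ioi t = (Finset.Iic t)ᶜ := by
          ext s
          simp
        rw [h3, ← hχ.2.2 ω, ← Finset.sum_add_sum_compl (Finset.Iic t)]
        ring
      simp only [← Finset.mul_sum, h2]
      rw [av_mul, av_last_of_martingale (q := fun t ω => c t ω k)
            (fun t => hc.adapted_apply t _) (fun s ω => hc.martingale s ω k)]
      · ring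
      · intro ω ω' h
        simp only
        rw [Finset.sum_congr rfl fun s hs => (hχc s).mono (𝓕.mono (Finset.mem_Iic.1 hs)) ω ω' h]
    simp only [htail]
    refine deferredDualCone_smul (mul_nonneg (inv_nonneg.2 hNpos.le) ?_) (hc.mem_dual hr t ω)
    rw [sub_nonneg, ← hχ.2.2 ω]
    exact Finset.sum_le_sum_of_subset_of_nonneg (Finset.subset_univ _)
      fun s _ _ => (hχ.2.1 s ω).1

variable {μ : Fin (T + 1) → Fin (T + 1) → Ω → Fin d → ℝ} {c : Fin (T + 1) → Ω → Fin d → ℝ}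

namespace IsDualFeasible

theorem tailMass_nonneg (h : IsDualFeasible 𝓕 rate j μ) (r : Fin (T + 1)) (ω : Ω) :
    0 ≤ tailMass j μ r ω := Finset.sum_nonneg fun t _ => (h.compatible t r ω).1 j

theorem liveMass_nonneg (h : IsDualFeasible 𝓕 rate j μ) (r : Fin (T + 1)) (ω : Ω) :
    0 ≤ liveMass j μ r ω := Finset.sum_nonneg fun t _ => (h.compatible t r ω).1 j

theorem tailMass_le (h : IsDualFeasible 𝓕 rate j μ) (r : Fin (T + 1)) (ω : Ω) :
    tailMass j μ r ω ≤ liveMass j μ r ω := by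
  rw [liveMass_eq]
  linarith [(h.compatible r r ω).1 j]

theorem constOnAtoms_tailMass (h : IsDualFeasible 𝓕 rate j μ) (r : Fin (T + 1)) :
    ConstOnAtoms (𝓕 r) (tailMass j μ r) := fun ω ω' hω => by
  simp only [tailMass, h.adapted _ r ω ω' hω]

theorem constOnAtoms_liveMass (h : IsDualFeasible 𝓕 rate j μ) (r : Fin (T + 1)) :
    ConstOnAtoms (𝓕 r) (liveMass j μ r) := fun ω ω' hω => by
  simp only [liveMass, h.adapted _ r ω ω' hω]

theorem av_liveMass (h : IsDualFeasible 𝓕 rate j μ) (s : Fin T) (ω : Ω) :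
    av (𝓕 s.castSucc) (liveMass j μ s.succ) ω = tailMass j μ s.castSucc ω := by
  have := h.running s ω j
  rw [← av_finset_sum, Ioi_castSucc_eq] at this
  rw [tailMass, Ioi_castSucc_eq, ← this]
  rfl

/-- The tail of a dual solution is the conditional average of the diagonal prices to come. -/
theorem sum_av_diagonal (h : IsDualFeasible 𝓕 rate j μ) (k : Fin d) (r : Fin (T + 1)) (ω : Ω) :
    ∑ s ∈ Finset.Ioi r, av (𝓕 r) (fun ω => μ s s ω k) ω = ∑ t ∈ Finset.Ioi r, μ t r ω k := by
  induction r using Fin.reverseInduction generalizing ω with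
  | last => rw [Ioi_last, Finset.sum_empty, Finset.sum_empty]
  | cast s ih =>
    have hle : 𝓕 s.castSucc ≤ 𝓕 s.succ := 𝓕.mono (Fin.castSucc_lt_succ (i := s)).le
    rw [← h.running, Ioi_castSucc_eq, sum_Ici, sum_Ici]
    congr 1
    simp_rw [← av_av hle (fun ω => μ _ _ ω k)]
    rw [← av_finset_sum, ← av_finset_sum]
    refine av_congr fun ω' _ => ?_
    rw [ih ω']
    exact Finset.sum_congr rfl fun t _ => (av_of_constOnAtoms
      (g := fun ω => μ t s.succ ω k) (fun ω ω' hω => by simp only [h.adapted t s.succ ω ω' hω])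
      ω').symm

theorem constOnAtoms_density (h : IsDualFeasible 𝓕 rate j μ) (hc : IsPriceProcess 𝓕 rate c)
    (r : Fin (T + 1)) : ConstOnAtoms (𝓕 r) (density j μ c r) := by
  induction r using Fin.induction with
  | zero =>
    intro ω ω' hω
    change ∑ t, μ t 0 ω' j = ∑ t, μ t 0 ω j
    simp only [h.adapted _ 0 ω ω' hω]
  | succ s ih =>
    have hle : 𝓕 s.castSucc ≤ 𝓕 s.succ := 𝓕.mono (Fin.castSucc_lt_succ (i := s)).le
    intro ω ω' hω
    simp only [density_succ, ih.mono hle ω ω' hω, (h.constOnAtoms_tailMass _).mono hle ω ω' hω,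
      h.constOnAtoms_liveMass _ ω ω' hω, hc.adapted _ ω ω' hω, (hc.adapted _).mono hle ω ω' hω]

theorem density_nonneg (h : IsDualFeasible 𝓕 rate j μ) (hc : IsPriceProcess 𝓕 rate c)
    (r : Fin (T + 1)) (ω : Ω) : 0 ≤ density j μ c r ω := by
  induction r using Fin.induction with
  | zero =>
    change 0 ≤ ∑ t, μ t 0 ω j
    exact Finset.sum_nonneg fun t _ => (h.compatible t 0 ω).1 j
  | succ s ih =>
    rw [density_succ]
    split_ifs
    · exact div_nonneg (mul_nonneg ih ((hc.compatible _ ω).1 j)) ((hc.compatible _ ω).1 j)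
    · exact div_nonneg (mul_nonneg ih (h.liveMass_nonneg _ ω)) (h.tailMass_nonneg _ ω)

theorem av_density (h : IsDualFeasible 𝓕 rate j μ) (hc : IsPriceProcess 𝓕 rate c)
    (hcj : ∀ ω, 1 ≤ c (Fin.last T) ω j) (s : Fin T) (ω : Ω) :
    av (𝓕 s.castSucc) (density j μ c s.succ) ω = density j μ c s.castSucc ω := by
  have hpos := hc.pos hcj s.castSucc ω
  have hq := h.constOnAtoms_density hc s.castSucc ω
  have ht := h.constOnAtoms_tailMass s.castSucc ω
  by_cases ha : tailMass j μ s.castSucc ω ≤ 0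
  · have h1 : ∀ ω' ∈ atom (𝓕 s.castSucc) ω, density j μ c s.succ ω' =
        c s.succ ω' j * (density j μ c s.castSucc ω / c s.castSucc ω j) := fun ω' hω' => by
      rw [density_succ, hq ω' hω', ht ω' hω', hc.adapted _ ω ω' hω', if_pos ha]
      ring
    rw [av_congr h1, av_mul (fun _ _ _ => rfl), hc.martingale]
    field_simp
  · have h1 : ∀ ω' ∈ atom (𝓕 s.castSucc) ω, density j μ c s.succ ω' =
        liveMass j μ s.succ ω' * (density j μ c s.castSucc ω / tailMass j μ s.castSucc ω) :=
      fun ω' hω' => by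
        rw [density_succ, hq ω' hω', ht ω' hω', if_neg ha]
        ring
    rw [av_congr h1, av_mul (f := liveMass j μ s.succ) (fun _ _ _ => rfl), h.av_liveMass]
    have := (not_le.1 ha).ne'
    field_simp

theorem density_mul_unexercised (h : IsDualFeasible 𝓕 rate j μ) (r : Fin (T + 1)) (ω : Ω) :
    density j μ c r ω * unexercised j μ r.castSucc ω = liveMass j μ r ω := by
  induction r using Fin.induction with
  | zero =>
    have : Finset.Ici (0 : Fin (T + 1)) = Finset.univ := by
      ext r
      simp
    rw [liveMass, this]
    exact mul_one _
  | succ s ih =>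
    rw [← Fin.succ_castSucc, unexercised_succ, density_succ]
    split_ifs with ha
    · have h0 : tailMass j μ s.castSucc ω = 0 := le_antisymm ha (h.tailMass_nonneg _ ω)
      have h1 : liveMass j μ s.succ ω = 0 := eq_zero_of_av_eq_zero (m := 𝓕 s.castSucc)
        (fun ω' _ => h.liveMass_nonneg _ ω') (by rw [h.av_liveMass, h0])
      rw [h0, h1]
      simp
    · have h0 := not_le.1 ha
      have h1 : 0 < liveMass j μ s.castSucc ω := h0.trans_le (h.tailMass_le _ ω)
      calc _ = (density j μ c s.castSucc ω * unexercised j μ s.castSucc.castSucc ω) *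
            liveMass j μ s.succ ω / liveMass j μ s.castSucc ω := by
            field_simp
        _ = _ := by
            rw [ih]
            field_simp

theorem density_mul_stopping (h : IsDualFeasible 𝓕 rate j μ) (r : Fin (T + 1)) (ω : Ω) :
    density j μ c r ω * stopping j μ r ω = μ r r ω j := by
  have h1 := h.density_mul_unexercised (c := c) r ω
  have h2 := liveMass_eq (μ := μ) j r ω
  rw [stopping, unexercised_succ, mul_sub, ← mul_assoc, h1]
  have h3 := h.tailMass_nonneg r ω
  have h4 := (h.compatible r r ω).1 j
  by_cases h0 : liveMass j μ r ω = 0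
  · rw [h0]
    linarith
  · rw [mul_div_cancel₀ _ h0]
    linarith

theorem unexercised_nonneg (h : IsDualFeasible 𝓕 rate j μ) (r : Fin (T + 2)) (ω : Ω) :
    0 ≤ unexercised j μ r ω := by
  induction r using Fin.induction with
  | zero => exact zero_le_one
  | succ s ih =>
    rw [unexercised_succ]
    exact mul_nonneg ih (div_nonneg (h.tailMass_nonneg _ ω) (h.liveMass_nonneg _ ω))

theorem stopping_nonneg (h : IsDualFeasible 𝓕 rate j μ) (r : Fin (T + 1)) (ω : Ω) :
    0 ≤ stopping j μ r ω := by
  rw [stopping, unexercised_succ, sub_nonneg]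
  exact mul_le_of_le_one_right (h.unexercised_nonneg _ ω)
    (div_le_one_of_le₀ (h.tailMass_le r ω) (h.liveMass_nonneg r ω))

theorem constOnAtoms_unexercised (h : IsDualFeasible 𝓕 rate j μ) (r : Fin (T + 1)) :
    ConstOnAtoms (𝓕 r) (unexercised j μ r.succ) := by
  induction r using Fin.induction with
  | zero =>
    intro ω ω' hω
    rw [unexercised_succ, unexercised_succ, h.constOnAtoms_tailMass _ ω ω' hω,
      h.constOnAtoms_liveMass _ ω ω' hω]
    rfl
  | succ s ih =>
    have hle : 𝓕 s.castSucc ≤ 𝓕 s.succ := 𝓕.mono (Fin.castSucc_lt_succ (i := s)).le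
    intro ω ω' hω
    rw [unexercised_succ, unexercised_succ, h.constOnAtoms_tailMass _ ω ω' hω,
      h.constOnAtoms_liveMass _ ω ω' hω, ← Fin.succ_castSucc, ih.mono hle ω ω' hω]

theorem constOnAtoms_stopping (h : IsDualFeasible 𝓕 rate j μ) (r : Fin (T + 1)) :
    ConstOnAtoms (𝓕 r) (stopping j μ r) := fun ω ω' hω => by
  rw [stopping, stopping, h.constOnAtoms_unexercised r ω ω' hω,
    constOnAtoms_castSucc (y := unexercised j μ) ⟨1, fun _ => rfl⟩ h.constOnAtoms_unexercised
      r ω ω' hω]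

theorem stopping_mem (h : IsDualFeasible 𝓕 rate j μ) : stopping j μ ∈ mixedStoppingTimes 𝓕 := by
  refine ⟨fun r => measurable_iff_constOnAtoms.2 (h.constOnAtoms_stopping r), fun r ω =>
    ⟨h.stopping_nonneg r ω, ?_⟩, sum_stopping j⟩
  rw [← sum_stopping j (μ := μ) ω]
  exact Finset.single_le_sum (fun r _ => h.stopping_nonneg r ω) (Finset.mem_univ r)

theorem density_mul_prices (h : IsDualFeasible 𝓕 rate j μ) (r : Fin (T + 1)) (ω : Ω) (k : Fin d) :
    density j μ c r ω * stopping j μ r ω * prices j μ c r ω k = μ r r ω k := by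
  rw [h.density_mul_stopping, prices]
  split_ifs with h0
  · have h1 : μ r r ω j = 0 := le_antisymm h0 ((h.compatible r r ω).1 j)
    rw [h1, eq_zero_of_compatible (h.compatible r r ω) h1]
    simp
  · have := (not_le.1 h0).ne'
    field_simp

theorem constOnAtoms_prices (h : IsDualFeasible 𝓕 rate j μ) (hc : IsPriceProcess 𝓕 rate c)
    (r : Fin (T + 1)) : ConstOnAtoms (𝓕 r) (prices j μ c r) := fun ω ω' hω => by
  funext k
  simp only [prices, h.adapted r r ω ω' hω, hc.adapted r ω ω' hω]

/-- A dual solution yields a mixed stopping time and a pricing pair. -/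
theorem isFinitePair (h : IsDualFeasible 𝓕 rate j μ) (hr : IsExchangeRate 𝓕 rate)
    (hc : IsPriceProcess 𝓕 rate c) (hcj : ∀ ω, 1 ≤ c (Fin.last T) ω j) :
    IsFinitePair 𝓕 rate j (stopping j μ) (density j μ c (Fin.last T)) (prices j μ c) := by
  refine isFinitePair_of_density (h.density_nonneg hc) (h.constOnAtoms_density hc)
    (h.av_density hc hcj) ?_ h.constOnAtoms_stopping (h.constOnAtoms_prices hc) (fun r ω => ?_)
    (fun r ω => ?_) (fun r ω => ?_)
  · rw [← h.total, Finset.sum_comm]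
    rfl
  · by_cases h0 : μ r r ω j ≤ 0
    · convert deferredDualCone_smul (inv_nonneg.2 (hc.pos hcj r ω).le) (hc.mem_dual hr r ω) using 1
      funext k
      simp only [prices, if_pos h0, Pi.smul_apply, smul_eq_mul]
      rw [inv_mul_eq_div]
    · convert deferredDualCone_smul (inv_nonneg.2 (not_le.1 h0).le) (h.diagonal_mem hr r ω) using 1
      funext k
      simp only [prices, if_neg h0, Pi.smul_apply, smul_eq_mul]
      rw [inv_mul_eq_div]
  · rw [prices]
    split_ifs with h0
    · exact div_self (hc.pos hcj r ω).ne'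
    · exact div_self (not_le.1 h0).ne'
  · simp only [h.density_mul_prices, h.sum_av_diagonal]
    convert h.tail_mem hr r ω using 1
    funext k
    rw [Finset.sum_apply]

theorem pairValue_eq (h : IsDualFeasible 𝓕 rate j μ)
    (hc : IsPriceProcess 𝓕 rate c) (hcj : ∀ ω, 1 ≤ c (Fin.last T) ω j)
    (hξ : ∀ t, ConstOnAtoms (𝓕 t) (ξ t)) :
    pairValue ξ (stopping j μ) (density j μ c (Fin.last T)) (prices j μ c) =
      dualObjective ξ μ := by
  rw [pairValue_of_density (h.constOnAtoms_density hc) (h.av_density hc hcj)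
    h.constOnAtoms_stopping (h.constOnAtoms_prices hc) hξ]
  refine Finset.sum_congr rfl fun t _ => Finset.sum_congr rfl fun ω _ => ?_
  congr 1
  funext k
  exact h.density_mul_prices t ω k

end IsDualFeasible

end Construction

/-! ### Superhedging gradual exercise and the ask price -/

section Hedging

variable {Ω : Type*} [Fintype Ω] {m : MeasurableSpace Ω} {T d : ℕ}
  {𝓕 : Filtration (Fin (T + 1)) m} {rate : Fin (T + 1) → Ω → Fin d → Fin d → ℝ}
  {j : Fin d} {ξ : Fin (T + 1) → Ω → Fin d → ℝ} {v : Fin d → ℝ}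
  {z : Fin (T + 1) → Fin (T + 2) → Ω → Fin d → ℝ}

/-- The pure stopping time that exercises the whole option at time `t`. -/
def pureStopping (𝓕 : Filtration (Fin (T + 1)) m) (t : Fin (T + 1)) : mixedStoppingTimes 𝓕 :=
  ⟨fun s _ => if s = t then 1 else 0, fun _ => measurable_const, fun s _ => by
    dsimp only
    split_ifs <;> simp, fun _ => by simp⟩

theorem exists_isHedge_of_seller (hr : IsExchangeRate 𝓕 rate)
    {Y : mixedStoppingTimes 𝓕 → tradingStrategies 𝓕 d} (hY : Y ∈ sellerStrategies 𝓕 rate ξ)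
    (h0 : ∀ χ ω, (Y χ).1 0 ω = v) : ∃ z, IsHedge 𝓕 rate ξ v z := by
  refine ⟨fun t => (Y (pureStopping 𝓕 t)).1, fun t => h0 _, fun t => (Y _).2.2.2,
    fun t r => measurable_iff_constOnAtoms.1 ((Y _).2.2.1 r), fun t t' r hrt hrt' => ?_,
    fun t r ω => ?_⟩
  · induction r using Fin.lastCases with
    | last => exact absurd hrt (Fin.castSucc_lt_last t).not_ge
    | cast r =>
      funext ω
      refine hY.2 _ _ r ω fun s hs => ?_
      have h1 : s ≠ t := (hs.trans_le (Fin.castSucc_le_castSucc_iff.1 hrt)).ne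
      have h2 : s ≠ t' := (hs.trans_le (Fin.castSucc_le_castSucc_iff.1 hrt')).ne
      simp [pureStopping, h1, h2]
  · have := ((mem_solvencyCone hr).1 (hY.1 (pureStopping 𝓕 t) r)).2 ω
    simpa [pureStopping, eq_comm (a := r)] using this

/-- Non-anticipation: a convex combination of the strategies against pure stopping times depends on
the weights only through what has been exercised before. -/
theorem IsHedge.sum_smul_eq (hz : IsHedge 𝓕 rate ξ v z) {χ : Fin (T + 1) → Ω → ℝ} {ω : Ω}
    (hχ : ∑ t, χ t ω = 1) (r : Fin (T + 2)) :
    ∑ t, χ t ω • z t r ω = z (Fin.last T) r ω +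
      ∑ t with t.castSucc < r, χ t ω • (z t r ω - z (Fin.last T) r ω) := by
  have h1 : ∑ t with t.castSucc < r, χ t ω • (z t r ω - z (Fin.last T) r ω) =
      ∑ t, χ t ω • (z t r ω - z (Fin.last T) r ω) := by
    refine Finset.sum_subset (Finset.subset_univ _) fun t _ ht => ?_
    have h2 : r ≤ t.castSucc := by simpa using ht
    rw [hz.agree t (Fin.last T) r h2
      (h2.trans (Fin.castSucc_le_castSucc_iff.2 (Fin.le_last t))), sub_self, smul_zero]
  rw [h1]
  simp only [smul_sub, Finset.sum_sub_distrib, ← Finset.sum_smul, hχ, one_smul]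
  abel

/-- Superhedging the pure stopping times suffices: gradual exercise is superhedged by the convex
combinations of these strategies. -/
theorem exists_seller_of_isHedge (hr : IsExchangeRate 𝓕 rate)
    (hξ : ∀ t, ConstOnAtoms (𝓕 t) (ξ t)) (hz : IsHedge 𝓕 rate ξ v z) :
    ∃ Y ∈ sellerStrategies 𝓕 rate ξ, ∀ χ ω, (Y χ).1 0 ω = v := by
  have h0 : ∀ (χ : mixedStoppingTimes 𝓕) ω, ∑ t, χ.1 t ω • z t 0 ω = v := fun χ ω => by
    simp only [hz.start, ← Finset.sum_smul, χ.2.2.2 ω, one_smul]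
  have hχc : ∀ (χ : mixedStoppingTimes 𝓕) t, ConstOnAtoms (𝓕 t) (χ.1 t) := fun χ t =>
    measurable_iff_constOnAtoms.1 (χ.2.1 t)
  have hc : ∀ (χ : mixedStoppingTimes 𝓕) (r : Fin (T + 1)),
      ConstOnAtoms (𝓕 r) fun ω => ∑ t, χ.1 t ω • z t r.succ ω := by
    intro χ r ω ω' h
    simp only [hz.sum_smul_eq (χ.2.2.2 _)]
    rw [hz.adapted _ r ω ω' h]
    congr 1
    refine Finset.sum_congr rfl fun t ht => ?_
    have htr : t ≤ r := by
      have := (Finset.mem_filter.1 ht).2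
      rwa [Fin.castSucc_lt_succ_iff] at this
    rw [hz.adapted t r ω ω' h, (hχc χ t).mono (𝓕.mono htr) ω ω' h]
  let Y : mixedStoppingTimes 𝓕 → tradingStrategies 𝓕 d := fun χ =>
    ⟨fun r ω => ∑ t, χ.1 t ω • z t r ω, ⟨v, h0 χ⟩,
      fun r => measurable_iff_constOnAtoms.2 (hc χ r), by
        funext ω
        simp [hz.final]⟩
  refine ⟨Y, ⟨fun χ r => (mem_solvencyCone hr).2 ⟨measurable_iff_constOnAtoms.2 ?_, ?_⟩, ?_⟩, h0⟩
  · have h1 := constOnAtoms_castSucc (𝓕 := 𝓕) (y := fun r ω => ∑ t, χ.1 t ω • z t r ω)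
      ⟨v, h0 χ⟩ (hc χ) r
    intro ω ω' h
    have h2 := h1 ω ω' h
    have h3 := hc χ r ω ω' h
    simp only [Y, Pi.sub_apply, hξ r ω ω' h, hχc χ r ω ω' h] at h2 h3 ⊢
    rw [h2, h3]
  · intro ω
    have h1 := solvent_sum (π := rate r ω) Finset.univ (x := fun t => χ.1 t ω •
      (z t r.castSucc ω - (if t = r then ξ r ω else 0) - z t r.succ ω))
      fun t _ => solvent_smul (χ.2.2.1 t ω).1 (hz.solvent t r ω)
    convert h1 using 1
    simp [Y, smul_sub, Finset.sum_sub_distrib]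
  · intro χ χ' r ω h
    simp only [Y, hz.sum_smul_eq (χ.2.2.2 _), hz.sum_smul_eq (χ'.2.2.2 _)]
    congr 1
    refine Finset.sum_congr rfl fun t ht => ?_
    have htr : t < r := by
      have := (Finset.mem_filter.1 ht).2
      rwa [Fin.castSucc_lt_castSucc_iff] at this
    rw [h t htr]

/-- A sufficiently large endowment superhedges: it is exchanged into a portfolio that dominates
every payoff and is held until exercise. -/
theorem exists_isHedge (hr : IsExchangeRate 𝓕 rate) (j : Fin d)
    (ξ : Fin (T + 1) → Ω → Fin d → ℝ) :
    ∃ x z, IsHedge 𝓕 rate ξ ((x : ℝ) • Pi.single j 1) z := by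
  set M : ℝ := ∑ t, ∑ ω, ∑ k, |ξ t ω k| with hM
  have hM0 : 0 ≤ M := by positivity
  have hξM : ∀ t ω k, ξ t ω k ≤ M := by
    intro t ω k
    refine (le_abs_self _).trans ?_
    calc |ξ t ω k| ≤ ∑ k, |ξ t ω k| :=
          Finset.single_le_sum (f := fun k => |ξ t ω k|) (fun _ _ => abs_nonneg _)
            (Finset.mem_univ k)
      _ ≤ ∑ ω, ∑ k, |ξ t ω k| :=
          Finset.single_le_sum (f := fun ω => ∑ k, |ξ t ω k|) (fun _ _ => by positivity)
            (Finset.mem_univ ω)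
      _ ≤ M := Finset.single_le_sum (f := fun t => ∑ ω, ∑ k, |ξ t ω k|)
            (fun _ _ => by positivity) (Finset.mem_univ t)
  set x : ℝ := ∑ ω, ∑ k, M * rate 0 ω j k with hx
  let w : Fin d → ℝ := fun _ => M
  have h1 : ∀ t ω, w - ξ t ω ∈ solvent (rate t ω) := fun t ω =>
    solvent_of_nonneg fun k => sub_nonneg.2 (hξM t ω k)
  -- the initial exchange of asset `j` into `M` units of every asset
  have h2 : ∀ ω, x • Pi.single j 1 - w ∈ solvent (rate 0 ω) := by
    intro ω
    refine ⟨fun a _ => if a = j then M else 0, fun a _ => by dsimp only; split_ifs <;> simp [hM0],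
      fun k => ?_⟩
    have h3 : ∑ k, M * rate 0 ω j k ≤ x :=
      Finset.single_le_sum (f := fun ω => ∑ k, M * rate 0 ω j k) (fun ω _ =>
        Finset.sum_nonneg fun k _ => mul_nonneg hM0 (hr.pos 0 ω j k).le) (Finset.mem_univ ω)
    by_cases hk : k = j
    · subst hk
      simp [w]
      linarith
    · simp [w, hk]
  have h0 : ∀ t ω, (0 : Fin d → ℝ) ∈ solvent (rate t ω) := fun t ω =>
    solvent_of_nonneg fun _ => le_rfl
  refine ⟨x, fun t r _ => if r = 0 then x • Pi.single j 1 else if r ≤ t.castSucc then w else 0,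
    fun t ω => by simp, fun t => ?_, fun t r ω ω' _ => rfl, fun t t' r h h' => ?_, fun t r ω => ?_⟩
  · funext ω
    have : ¬ Fin.last (T + 1) ≤ t.castSucc := (Fin.castSucc_lt_last t).not_ge
    simp [this]
  · simp only [h, h']
  · simp only [Fin.succ_ne_zero, if_false, Fin.castSucc_eq_zero_iff, Fin.castSucc_le_castSucc_iff,
      Fin.succ_le_castSucc_iff]
    rcases lt_trichotomy r t with hlt | rfl | hlt
    · rw [if_neg hlt.ne', if_pos hlt.le, if_pos hlt, sub_zero]
      split_ifs with hr0
      · subst hr0; exact h2 ω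
      · rw [sub_self]; exact h0 r ω
    · rw [if_pos le_rfl, if_pos rfl, if_neg (lt_irrefl r), sub_zero]
      split_ifs with hr0
      · subst hr0
        have := solvent_add (h2 ω) (h1 0 ω)
        rwa [sub_add_sub_cancel] at this
      · exact h1 r ω
    · have hr0 : r ≠ 0 := (lt_of_le_of_lt (Fin.zero_le t) hlt).ne'
      rw [if_neg hr0, if_neg hlt.not_ge, if_neg hlt.ne, if_neg hlt.not_gt, sub_zero, sub_zero]
      exact h0 r ω

/-- A price process provides a dual solution, which corresponds to immediate exercise. -/
theorem exists_isDualFeasible [Nonempty Ω] {c : Fin (T + 1) → Ω → Fin d → ℝ}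
    (hc : IsPriceProcess 𝓕 rate c) (hcj : ∀ ω, 1 ≤ c (Fin.last T) ω j) :
    ∃ μ, IsDualFeasible 𝓕 rate j μ := by
  set N : ℝ := ∑ ω, c 0 ω j with hN
  have hNpos : 0 < N := Finset.sum_pos (fun ω _ => hc.pos hcj 0 ω) Finset.univ_nonempty
  have hcN := hc.smul (inv_nonneg.2 hNpos.le)
  have hzero : IsPriceProcess 𝓕 rate 0 := by
    simpa using hc.smul le_rfl
  have h : ∀ t : Fin (T + 1), IsPriceProcess 𝓕 rate (if t = 0 then N⁻¹ • c else 0) := fun t => by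
    split_ifs
    exacts [hcN, hzero]
  refine ⟨fun t => if t = 0 then N⁻¹ • c else 0, fun t => (h t).adapted, fun t => (h t).compatible,
    fun s t _ => (h t).martingale s, fun s ω k => ?_, ?_⟩
  · exact Finset.sum_congr rfl fun t _ => (h t).martingale s ω k
  · rw [Finset.sum_eq_single 0]
    · simp only [if_true, Pi.smul_apply, smul_eq_mul, ← Finset.mul_sum]
      exact inv_mul_cancel₀ hNpos.ne'
    · intro t _ ht
      simp [ht]
    · simp

/-- Strong duality: the ask price is the value of an optimal dual solution. -/
theorem askPrice_eq_dualObjective (hr : IsExchangeRate 𝓕 rate)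
    (hξ : ∀ t, ConstOnAtoms (𝓕 t) (ξ t)) {c : Fin (T + 1) → Ω → Fin d → ℝ}
    (hc : IsPriceProcess 𝓕 rate c) (hcj : ∀ ω, 1 ≤ c (Fin.last T) ω j)
    {μ : Fin (T + 1) → Fin (T + 1) → Ω → Fin d → ℝ} (hμ : IsDualFeasible 𝓕 rate j μ)
    (hopt : ∀ μ', IsDualFeasible 𝓕 rate j μ' → dualObjective ξ μ' ≤ dualObjective ξ μ) :
    askPrice 𝓕 rate ξ j = (dualObjective ξ μ : EReal) := by
  refine IsLeast.csInf_eq (EReal.coe_strictMono.monotone.map_isLeast ⟨?_, ?_⟩)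
  · by_contra hx
    obtain ⟨μ', hμ', hlt⟩ := exists_dual_of_not_hedge hr hξ (x := dualObjective ξ μ) (j := j)
      (fun ⟨z, hz⟩ => hx (exists_seller_of_isHedge hr hξ hz)) (exists_isHedge hr j ξ)
    exact absurd (hopt μ' hμ') (not_le.2 hlt)
  · rintro x ⟨Y, hY, hY0⟩
    obtain ⟨z, hz⟩ := exists_isHedge_of_seller hr hY hY0
    rw [← hμ.pairValue_eq hc hcj hξ]
    exact (hμ.isFinitePair hr hc hcj).pairValue_le hr hμ.stopping_mem hξ hz

end Hedging

/-! ### The algorithm -/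

section Algorithm

variable {Ω : Type*} {m : MeasurableSpace Ω} {T d : ℕ}

theorem AffArith.av [Fintype Ω] {ι U : Type*} [Fintype U] (m : MeasurableSpace Ω)
    {f : Ω → (ι → ℝ) → (U → ℝ) → ℝ} (hf : ∀ ω, AffArith (f ω)) (ω : Ω) :
    AffArith fun x u => GradualExercise.av m (fun ω => f ω x u) ω := by
  have h := (AffArith.sum (atom m ω) hf).mul (Arith.ratCast ((atom m ω).card : ℚ)⁻¹)
  have e : (fun (x : ι → ℝ) (u : U → ℝ) => GradualExercise.av m (fun ω => f ω x u) ω) =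
      fun x u => (((atom m ω).card : ℚ)⁻¹ : ℚ) * ∑ a ∈ atom m ω, f a x u := by
    funext x u
    rw [GradualExercise.av, div_eq_inv_mul]
    push_cast
    rfl
  rw [e]
  exact h

/-- The exchange rates that are encoded in the numerical data. -/
def rateOf (x : InputIndex Ω T d → ℝ) : Fin (T + 1) → Ω → Fin d → Fin d → ℝ :=
  fun t ω i k => x (.inl (t, ω, i, k))

/-- The payoffs that are encoded in the numerical data. -/
def payoffOf (x : InputIndex Ω T d → ℝ) : Fin (T + 1) → Ω → Fin d → ℝ :=
  fun t ω k => x (.inr (t, ω, k))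

theorem polyArith_compatible {U : Type*} [Fintype U]
    {g : Fin d → (InputIndex Ω T d → ℝ) → (U → ℝ) → ℝ} (hg : ∀ k, AffArith (g k))
    (t : Fin (T + 1)) (ω : Ω) :
    PolyArith fun x u => (fun k => g k x u) ∈ compatible (rateOf x t ω) :=
  (PolyArith.forall_finite fun k => .le (.of_arith .zero) (hg k)).and
    (.forall_finite fun i => .forall_finite fun k => .le (hg k) (.mul (.input _) (hg i)))

theorem polyArith_constOnAtoms [Fintype Ω] {ι U : Type*} [Fintype U] (m : MeasurableSpace Ω)
    {g : Ω → Fin d → (ι → ℝ) → (U → ℝ) → ℝ} (hg : ∀ ω k, AffArith (g ω k)) :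
    PolyArith fun x u => ConstOnAtoms m fun ω k => g ω k x u := by
  have := PolyArith.forall_finite fun ω : Ω => PolyArith.forall_finite fun ω' : Ω =>
    PolyArith.imp (p := ω' ∈ atom m ω) <| PolyArith.forall_finite fun k =>
      PolyArith.eq (hg ω' k) (hg ω k)
  simpa only [ConstOnAtoms, funext_iff] using this

/-- The unknowns `u` as a process. -/
def unknownProcess (u : Fin (T + 1) × Ω × Fin d → ℝ) : Fin (T + 1) → Ω → Fin d → ℝ :=
  fun t ω k => u (t, ω, k)

/-- The unknowns `u` as a family of processes. -/
def unknownFamily (u : Fin (T + 1) × Fin (T + 1) × Ω × Fin d → ℝ) :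
    Fin (T + 1) → Fin (T + 1) → Ω → Fin d → ℝ :=
  fun t r ω k => u (t, r, ω, k)

theorem polyArith_isPriceProcess [Fintype Ω] (𝓕 : Filtration (Fin (T + 1)) m) :
    PolyArith fun (x : InputIndex Ω T d → ℝ) u =>
      IsPriceProcess 𝓕 (rateOf x) (unknownProcess u) := by
  have hv : ∀ t ω k, AffArith fun (_ : InputIndex Ω T d → ℝ) u =>
      unknownProcess (T := T) (Ω := Ω) (d := d) u t ω k := fun t ω k => .var (t, ω, k)
  have h := (PolyArith.forall_finite fun t => polyArith_constOnAtoms (𝓕 t) (hv t)).and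
    ((PolyArith.forall_finite fun t => .forall_finite fun ω => polyArith_compatible (hv t ω) t ω).and
    (.forall_finite fun s : Fin T => .forall_finite fun ω => .forall_finite fun k =>
      .eq (.av (𝓕 s.castSucc) (fun ω => hv s.succ ω k) ω) (hv s.castSucc ω k)))
  convert h using 3 with x u
  exact ⟨fun h => ⟨h.adapted, h.compatible, h.martingale⟩, fun h => ⟨h.1, h.2.1, h.2.2⟩⟩

theorem polyArith_isDualFeasible [Fintype Ω] (𝓕 : Filtration (Fin (T + 1)) m) (j : Fin d) :
    PolyArith fun (x : InputIndex Ω T d → ℝ) u =>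
      IsDualFeasible 𝓕 (rateOf x) j (unknownFamily u) := by
  have hv : ∀ t r ω k, AffArith fun (_ : InputIndex Ω T d → ℝ) u =>
      unknownFamily (T := T) (Ω := Ω) (d := d) u t r ω k := fun t r ω k => .var (t, r, ω, k)
  have h := (PolyArith.forall_finite fun t => .forall_finite fun r =>
      polyArith_constOnAtoms (𝓕 r) (hv t r)).and
    ((PolyArith.forall_finite fun t => .forall_finite fun r => .forall_finite fun ω =>
      polyArith_compatible (hv t r ω) r ω).and
    ((PolyArith.forall_finite fun s : Fin T => .forall_finite fun t : Fin (T + 1) =>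
      .imp (p := t ≤ s.castSucc) <| .forall_finite fun ω => .forall_finite fun k =>
      .eq (.av (𝓕 s.castSucc) (fun ω => hv t s.succ ω k) ω) (hv t s.castSucc ω k)).and
    ((PolyArith.forall_finite fun s : Fin T => .forall_finite fun ω => .forall_finite fun k =>
      .eq (.sum (Finset.Ioi s.castSucc)
        fun t => .av (𝓕 s.castSucc) (fun ω => hv t s.succ ω k) ω)
        (.sum (Finset.Ioi s.castSucc) fun t => hv t s.castSucc ω k)).and
    (.eq (.sum Finset.univ fun t => .sum Finset.univ fun ω => hv t 0 ω j) (.of_arith .one)))))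
  convert h using 3 with x u
  exact ⟨fun h => ⟨h.adapted, h.compatible, h.stopped, h.running, h.total⟩,
    fun h => ⟨h.1, h.2.1, h.2.2.1, h.2.2.2.1, h.2.2.2.2⟩⟩

theorem affArith_dualObjective [Fintype Ω] :
    AffArith fun (x : InputIndex Ω T d → ℝ) u => dualObjective (payoffOf x) (unknownFamily u) := by
  have h : AffArith fun (x : InputIndex Ω T d → ℝ) u => ∑ t, ∑ ω, ∑ k,
      payoffOf x t ω k * unknownFamily (T := T) (Ω := Ω) (d := d) u t t ω k :=
    .sum _ fun t => .sum _ fun ω => .sum _ fun k => .mul (.input _) (.var (t, t, ω, k))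
  convert h using 3
  simp only [dualObjective, dotProduct, mul_comm]

variable {ι : Type*} {μ : (ι → ℝ) → Fin (T + 1) → Fin (T + 1) → Ω → Fin d → ℝ}
  {c : (ι → ℝ) → Fin (T + 1) → Ω → Fin d → ℝ}

theorem arith_density (j : Fin d) (hμ : ∀ t r ω k, Arith fun x => μ x t r ω k)
    (hc : ∀ t ω k, Arith fun x => c x t ω k) (r : Fin (T + 1)) (ω : Ω) :
    Arith fun x => density j (μ x) (c x) r ω := by
  induction r using Fin.induction with
  | zero => exact .sum Finset.univ fun t => hμ t 0 ω j
  | succ s ih =>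
    simp only [density_succ]
    exact .ite (.sum _ fun t => hμ t _ ω j) ((ih.mul (hc _ ω j)).div (hc _ ω j))
      ((ih.mul (.sum _ fun t => hμ t _ ω j)).div (.sum _ fun t => hμ t _ ω j))

theorem arith_unexercised (j : Fin d) (hμ : ∀ t r ω k, Arith fun x => μ x t r ω k)
    (r : Fin (T + 2)) (ω : Ω) : Arith fun x => unexercised j (μ x) r ω := by
  induction r using Fin.induction with
  | zero => exact .one
  | succ s ih =>
    simp only [unexercised_succ]
    exact ih.mul (.div (.sum _ fun t => hμ t _ ω j) (.sum _ fun t => hμ t _ ω j))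

theorem arith_prices (j : Fin d) (hμ : ∀ t r ω k, Arith fun x => μ x t r ω k)
    (hc : ∀ t ω k, Arith fun x => c x t ω k) (r : Fin (T + 1)) (ω : Ω) (k : Fin d) :
    Arith fun x => prices j (μ x) (c x) r ω k :=
  .ite (hμ r r ω j) ((hc r ω k).div (hc r ω j)) ((hμ r r ω k).div (hμ r r ω j))

/-- An algorithm computes, from the exchange rates and the payoff, a positive price process and an
optimal dual solution. -/
theorem exists_arith_dual_solution [Fintype Ω] [Nonempty Ω] (𝓕 : Filtration (Fin (T + 1)) m)
    (hT : 𝓕 (Fin.last T) = ⊤) (j : Fin d) :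
    ∃ (μ : (InputIndex Ω T d → ℝ) → Fin (T + 1) → Fin (T + 1) → Ω → Fin d → ℝ)
      (c : (InputIndex Ω T d → ℝ) → Fin (T + 1) → Ω → Fin d → ℝ),
      (∀ t r ω k, Arith fun x => μ x t r ω k) ∧ (∀ t ω k, Arith fun x => c x t ω k) ∧
      ∀ x, IsExchangeRate 𝓕 (rateOf x) → NoArbitrage 𝓕 (rateOf x) →
        (∀ t, ConstOnAtoms (𝓕 t) (payoffOf x t)) →
        IsPriceProcess 𝓕 (rateOf x) (c x) ∧ (∀ ω, 1 ≤ c x (Fin.last T) ω j) ∧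
        IsDualFeasible 𝓕 (rateOf x) j (μ x) ∧ ∀ μ', IsDualFeasible 𝓕 (rateOf x) j μ' →
          dualObjective (payoffOf x) μ' ≤ dualObjective (payoffOf x) (μ x) := by
  obtain ⟨u, hu, hu'⟩ := exists_arith_optimum (ι := InputIndex Ω T d)
    (U := Fin (T + 1) × Ω × Fin d) ((polyArith_isPriceProcess 𝓕).and
      (.forall_finite fun ω => .le (.of_arith .one) (.var (Fin.last T, ω, j))))
    (.of_arith .zero)
  obtain ⟨w, hw, hw'⟩ := exists_arith_optimum (polyArith_isDualFeasible (d := d) 𝓕 j)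
    affArith_dualObjective
  refine ⟨fun x => unknownFamily (w x), fun x => unknownProcess (u x), fun t r ω k => hw _,
    fun t ω k => hu _, fun x hr hna hξ => ?_⟩
  obtain ⟨c, hc, hcj⟩ := exists_priceProcess hr hna hT j
  obtain ⟨⟨h1, h2⟩, -⟩ := hu' x (fun i => c i.1 i.2.1 i.2.2) ⟨hc, hcj⟩ ⟨0, fun _ _ => le_rfl⟩
  obtain ⟨x', z, hz⟩ := exists_isHedge hr j (payoffOf x)
  have hbdd : ∀ μ', IsDualFeasible 𝓕 (rateOf x) j μ' → dualObjective (payoffOf x) μ' ≤ x' := by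
    intro μ' hμ'
    rw [← hμ'.pairValue_eq hc hcj hξ]
    exact (hμ'.isFinitePair hr hc hcj).pairValue_le hr hμ'.stopping_mem hξ hz
  have hopt : ∀ μ', IsDualFeasible 𝓕 (rateOf x) j μ' →
      IsDualFeasible 𝓕 (rateOf x) j (unknownFamily (w x)) ∧
      dualObjective (payoffOf x) μ' ≤ dualObjective (payoffOf x) (unknownFamily (w x)) :=
    fun μ' hμ' => hw' x (fun i => μ' i.1 i.2.1 i.2.2.1 i.2.2.2) hμ' ⟨x', fun u' => hbdd _⟩
  obtain ⟨μ₀, hμ₀⟩ := exists_isDualFeasible hc hcj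
  exact ⟨h1, h2, (hopt μ₀ hμ₀).1, fun μ' hμ' => (hopt μ' hμ').2⟩

end Algorithm

end GradualExercise

theorem mainTheorem2 {Ω : Type*} [Finite Ω] [mΩ : MeasurableSpace Ω] [DiscreteMeasurableSpace Ω]
    (P : Measure Ω) [IsProbabilityMeasure P] (_hP : ∀ ω, 0 < P {ω})
    {T : ℕ} (𝓕 : Filtration (Fin (T + 1)) mΩ) (_h0 : 𝓕 0 = ⊥) (_hT : 𝓕 (Fin.last T) = ⊤)
    {d : ℕ} (j : Fin d) :
    (∀ (rate : Fin (T + 1) → Ω → Fin d → Fin d → ℝ) (ξ : Fin (T + 1) → Ω → Fin d → ℝ),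
      IsExchangeRate 𝓕 rate → NoArbitrage 𝓕 rate → (∀ t, Measurable[𝓕 t] (ξ t)) →
        (∀ χ ∈ mixedStoppingTimes 𝓕, ∃ v, IsInnerMax 𝓕 rate ξ j χ v) ∧
        IsGreatest {v | ∃ χ ∈ mixedStoppingTimes 𝓕, IsInnerMax 𝓕 rate ξ j χ v}
          (askPrice 𝓕 rate ξ j)) ∧
    ∃ alg : ArithAlgorithm (InputIndex Ω T d) (OutputIndex Ω T d),
      ∀ (rate : Fin (T + 1) → Ω → Fin d → Fin d → ℝ) (ξ : Fin (T + 1) → Ω → Fin d → ℝ),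
        IsExchangeRate 𝓕 rate → NoArbitrage 𝓕 rate → (∀ t, Measurable[𝓕 t] (ξ t)) →
          ∃ χ ∈ mixedStoppingTimes 𝓕, ∃ p ∈ pricingPairs 𝓕 rate j χ,
            alg.run (inputData rate ξ) = outputData χ p ∧
              askPrice 𝓕 rate ξ j = (dualValue ξ χ p : EReal) := by
  have := Fintype.ofFinite Ω
  have : Nonempty Ω := P.nonempty_of_neZero
  obtain ⟨μ, c, hμ, hc, H⟩ := exists_arith_dual_solution 𝓕 _hT j
  refine ⟨fun rate ξ hr hna hξ => ?_, ?_⟩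
  · have hξc : ∀ t, ConstOnAtoms (𝓕 t) (ξ t) := fun t => measurable_iff_constOnAtoms.1 (hξ t)
    obtain ⟨h1, h2, h3, h4⟩ := H (inputData rate ξ) hr hna hξc
    have hval := askPrice_eq_dualObjective hr hξc h1 h2 h3 h4
    -- weak duality
    have hle : ∀ χ ∈ mixedStoppingTimes 𝓕, ∀ p ∈ pricingPairs 𝓕 rate j χ,
        (dualValue ξ χ p : EReal) ≤ askPrice 𝓕 rate ξ j := by
      intro χ hχ p hp
      refine le_sInf ?_
      rintro _ ⟨x, ⟨Y, hY, hY0⟩, rfl⟩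
      obtain ⟨z, hz⟩ := exists_isHedge_of_seller hr hY hY0
      have := hp.1
      rw [dualValue_eq]
      exact EReal.coe_le_coe_iff.2 ((isFinitePair_of_mem hp).pairValue_le hr hχ hξc hz)
    refine ⟨fun χ hχ => ?_, ⟨_, h3.stopping_mem, ?_⟩, ?_⟩
    · obtain ⟨q, S, hqS, hmax⟩ := exists_isMax_pairValue (ξ := ξ) hr
        (exists_isFinitePair hr h1 h2 hχ)
      obtain ⟨hp, hq⟩ := hqS.mem_pricingPairs
      refine ⟨_, ⟨_, hp, rfl⟩, ?_⟩
      rintro _ ⟨p, hp', rfl⟩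
      have := hp.1
      have := hp'.1
      simp only [dualValue_eq, hq]
      exact EReal.coe_le_coe_iff.2 (hmax _ _ (isFinitePair_of_mem hp'))
    · have hpair := h3.isFinitePair hr h1 h2
      obtain ⟨hp, hq⟩ := hpair.mem_pricingPairs
      refine ⟨⟨_, hp, ?_⟩, ?_⟩
      · have := hp.1
        simp only [dualValue_eq, hq]
        rw [hval, h3.pairValue_eq h1 h2 hξc]
      · rintro _ ⟨p, hp', rfl⟩
        exact hle _ h3.stopping_mem p hp'
    · rintro v ⟨χ, hχ, ⟨p, hp, rfl⟩, -⟩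
      exact hle χ hχ p hp
  · obtain ⟨alg, halg⟩ := exists_algorithm_run_eq (κ := OutputIndex Ω T d)
      (f := fun i x => match i with
        | .inl (t, ω) => stopping j (μ x) t ω
        | .inr (.inl ω) => density j (μ x) (c x) (Fin.last T) ω
        | .inr (.inr (t, ω, k)) => prices j (μ x) (c x) t ω k) (by
      rintro (⟨t, ω⟩ | ω | ⟨t, ω, k⟩)
      · exact (arith_unexercised j hμ _ ω).sub (arith_unexercised j hμ _ ω)
      · exact arith_density j hμ hc _ ω
      · exact arith_prices j hμ hc t ω k)
    refine ⟨alg, fun rate ξ hr hna hξ => ?_⟩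
    have hξc : ∀ t, ConstOnAtoms (𝓕 t) (ξ t) := fun t => measurable_iff_constOnAtoms.1 (hξ t)
    obtain ⟨h1, h2, h3, h4⟩ := H (inputData rate ξ) hr hna hξc
    obtain ⟨hp, hq⟩ := (h3.isFinitePair hr h1 h2).mem_pricingPairs
    refine ⟨_, h3.stopping_mem, _, hp, ?_, ?_⟩
    · funext i
      rw [halg]
      rcases i with ⟨t, ω⟩ | ω | ⟨t, ω, k⟩
      · rfl
      · exact (hq ω).symm
      · rfl
    · have := hp.1
      simp only [dualValue_eq, hq]
      rw [askPrice_eq_dualObjective hr hξc h1 h2 h3 h4, h3.pairValue_eq h1 h2 hξc]
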